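/- Let $b$ be a prime, $s,\alpha,m\in\mathbb{N}$ with $2\le\alpha\le m$, $1\le q,r\le\infty$ with Hölder conjugates $q',r'$, and let $\boldsymbol\gamma=(\gamma_u)_{u\subseteq\{1,\dots,s\}}$ be non-negative real weights. Conventions: for $q$, $r$, $q'$ or $r'$ equal to $\infty$, expressions $(\sum_i a_i^{p})^{1/p}$ and $(\int|F|^p)^{1/p}$ are replaced by the maximum and the essential supremum, and $1/\infty=0$; if $\gamma_u=0$, then $\gamma_u^{-1}=\infty$ and $\infty\cdot 0=0$. **Function space.** $W_{s,\alpha,\boldsymbol\gamma,q,r}$ is the space of continuous functions $f\colon[0,1)^s\to\mathbb{R}$ which have integrable weak partial mixed derivatives $f^{(\boldsymbol\beta)}$ for all $\boldsymbol\beta\in\{0,\dots,\alpha\}^s$ and finite norm $$\|f\|_{s,\alpha,\boldsymbol\gamma,q,r}=\Bigg(\sum_{u\subseteq\{1,\dots,s\}}\Bigg(\gamma_u^{-q}\sum_{v\subseteq u}\ \sum_{\boldsymbol\tau_{u\setminus v}\in\{1,\dots,\alpha\}^{|u\setminus v|}}\int_{[0,1)^{|v|}}\bigg|\int_{[0,1)^{s-|v|}}f^{(\boldsymbol\tau_{u\setminus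 v},\boldsymbol\alpha_v,\boldsymbol 0)}(\boldsymbol x)\,d\boldsymbol x_{-v}\bigg|^q d\boldsymbol x_v\Bigg)^{r/q}\Bigg)^{1/r},$$ where $(\boldsymbol\tau_{u\setminus v},\boldsymbol\alpha_v,\boldsymbol 0)$ has $j$-th entry $\tau_j$ for $j\in u\setminus v$, $\alpha$ for $j\in v$, and $0$ for $j\notin u$. Put $I(f)=\int_{[0,1)^s}f(\boldsymbol x)\,d\boldsymbol x$. **Polynomial lattice rules.** For $n\in\mathbb{N}$ and $k=\kappa_0+\kappa_1b+\cdots\in\mathbb{N}_0$ in base $b$, let $\mathrm{tr}_n(k)=\kappa_0+\kappa_1x+\cdots+\kappa_{n-1}x^{n-1}\in\mathbb{F}_b[x]$. For $p\in\mathbb{F}_b[x]$ of degree $n$ and nonzero $g_1,\dots,g_s\in\mathbb{F}_b[x]$ of degree less than $n$, the polynomial lattice point set $P=P(p,\boldsymbol g)$ consists of the points (counted with multiplicity) $$\boldsymbol x_h=\Big(v_n\big(\tfrac{\mathrm{tr}_n(h)g_1}{p}\big),\dots,v_n\big(\tfrac{\mathrm{tr}_n(h)g_s}{p}\big)\Big),\quad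 0\le h<b^n,\qquad v_n\Big(\sum_{i\ge w}a_ix^{-i}\Big)=\sum_{i=\max\{1,w\}}^{n}a_ib^{-i},$$ where the quotients are expanded in $\mathbb{F}_b((x^{-1}))$ and $\mathbb{F}_b$ is identified with $\{0,\dots,b-1\}$. Put $I(f;P)=b^{-n}\sum_{h=0}^{b^n-1}f(\boldsymbol x_h)$. The dual polynomial lattice is $P^\perp=\{\boldsymbol k\in\mathbb{N}_0^s:\ p\mid\sum_{j}\mathrm{tr}_n(k_j)g_j\}$, and for $\emptyset\ne u\subseteq\{1,\dots,s\}$ let $P^\perp_u=\{\boldsymbol k_u\in\mathbb{N}^{|u|}:(\boldsymbol k_u,\boldsymbol 0)\in P^\perp\}$, where $\mathbb{N}=\{1,2,\dots\}$. **Constants.** Let $$a_\tau^{(\alpha)}=\prod_{j=1}^{\tau-1}\frac{-1}{b^j-1}\prod_{j=1}^{\alpha-\tau}\frac{b^j}{b^j-1}\qquad(1\le\tau\le\alpha).$$ For $k=\kappa_1b^{a_1-1}+\dots+\kappa_vb^{a_v-1}$ with $a_1>\dots>a_v>0$ and $\kappa_i\in\{1,\dots,b-1\}$ let $\mu_\alpha(k)=a_1+\dots+a_{\min(v,\alpha)}$,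 let $\mu_\alpha(0)=0$, and let $\mu_\alpha(\boldsymbol k)=\sum_j\mu_\alpha(k_j)$. Let $$C_\alpha=\max\Big(\tfrac{2}{(2\sin(\pi/b))^{\alpha}},\max_{1\le z\le\alpha-1}\tfrac{1}{(2\sin(\pi/b))^{z}}\Big)\Big(1+\tfrac1b+\tfrac1{b(b+1)}\Big)^{\alpha-2}\Big(3+\tfrac2b+\tfrac{2b+1}{b-1}\Big).$$ With the Bernoulli polynomials $B_\tau$, let $b_\tau(x)=B_\tau(x)/\tau!$, $b_\tau=b_\tau(0)$, and let $\tilde b_\alpha$ be the one-periodic extension of $b_\alpha$ from $[0,1)$; put $D_\alpha=\max\{|b_1|,\dots,|b_{\alpha-1}|,\sup_{x\in[0,1)}|\tilde b_\alpha(x)|\}$. For $P$ as above with $b^n$ points, let $$B_{\boldsymbol\gamma,r}(P)=\Bigg(\sum_{\emptyset\ne u\subseteq\{1,\dots,s\}}\Bigg(\gamma_uC_\alpha^{|u|}\sum_{\substack{\boldsymbol k_u\in P^\perp_u\\ \exists j\in u:\ b^n\nmid k_j}}b^{-\mu_\alpha(\boldsymbol k_u)}\Bigg)^{r'}\Bigg)^{1/r'},\qquad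 H_{s,\boldsymbol\gamma,q,r}=\Bigg(\sum_{u\subseteq\{1,\dots,s\}}\gamma_u^{r'}(\alpha+1)^{|u|r'/q'}D_\alpha^{r'|u|}\Bigg)^{1/r'}.$$ **Theorem.** For $1\le\tau\le\alpha$ let $P_{b^{m-\tau+1}}$ be any polynomial lattice point set whose modulus has degree $m-\tau+1$. Then $$\sup_{\substack{f\in W_{s,\alpha,\boldsymbol\gamma,q,r}\\ \|f\|_{s,\alpha,\boldsymbol\gamma,q,r}\le1}}\left|\sum_{\tau=1}^{\alpha}a_\tau^{(\alpha)}I(f;P_{b^{m-\tau+1}})-I(f)\right|\le\sum_{\tau=1}^{\alpha}|a_\tau^{(\alpha)}|\left(B_{\boldsymbol\gamma,r}(P_{b^{m-\tau+1}})+\frac{H_{s,\boldsymbol\gamma,q,r}}{b^{\alpha(m-\tau+1)}}\right).$$ -/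

import Mathlib

open MeasureTheory
open scoped ENNReal NNReal Polynomial ContDiff

namespace ExtrapolatedLattice

noncomputable section

/-! ### Finite `ℓ^p` norms -/

/-- `(∑ i, a i ^ p) ^ (1 / p)` for `p < ∞`, and `max_i a i` for `p = ∞`. -/
def finLp {ι : Type*} [Fintype ι] (p : ℝ≥0∞) (a : ι → ℝ≥0∞) : ℝ≥0∞ :=
  if p = ⊤ then ⨆ i, a i else (∑ i, a i ^ p.toReal) ^ (1 / p.toReal)

/-! ### Weighted unanchored Sobolev spaces of dominating mixed smoothness -/

/-- The half-open unit cube `[0,1)^ι`. -/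
def cube (ι : Type*) : Set (ι → ℝ) := Set.univ.pi fun _ => Set.Ico 0 1

/-- The open unit cube `(0,1)^ι`. -/
def openCube (ι : Type*) : Set (ι → ℝ) := Set.univ.pi fun _ => Set.Ioo 0 1

/-- The integral `I(f)` of `f` over the unit cube. -/
def cubeIntegral {s : ℕ} (f : (Fin s → ℝ) → ℝ) : ℝ := ∫ x in cube (Fin s), f x

/-- The partial derivative in the `j`-th coordinate. -/
def partialD {s : ℕ} (j : Fin s) (φ : (Fin s → ℝ) → ℝ) : (Fin s → ℝ) → ℝ :=
  fun x => fderiv ℝ φ x (Pi.single j 1)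

/-- The mixed partial derivative of order `β` (used for smooth functions, for which the order in
which the coordinates are processed is irrelevant). -/
def mixedD {s : ℕ} (β : Fin s → ℕ) (φ : (Fin s → ℝ) → ℝ) : (Fin s → ℝ) → ℝ :=
  (List.finRange s).foldr (fun j ψ => (partialD j)^[β j] ψ) φ

/-- `g` is an integrable weak mixed partial derivative of order `β` of `f` on the unit cube. -/
def IsWeakDeriv {s : ℕ} (β : Fin s → ℕ) (f g : (Fin s → ℝ) → ℝ) : Prop :=
  IntegrableOn g (cube (Fin s)) ∧
    ∀ φ : (Fin s → ℝ) → ℝ, ContDiff ℝ ∞ φ → HasCompactSupport φ →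
      tsupport φ ⊆ openCube (Fin s) →
      ∫ x in cube (Fin s), f x * mixedD β φ x =
        (-1) ^ (∑ j, β j) * ∫ x in cube (Fin s), g x * φ x

open scoped Classical in
/-- The weak derivative `f^{(β)}`, unique up to a null set when it exists. -/
def weakDeriv {s : ℕ} (β : Fin s → ℕ) (f : (Fin s → ℝ) → ℝ) : (Fin s → ℝ) → ℝ :=
  if h : ∃ g, IsWeakDeriv β f g then h.choose else 0

/-- `x_v ↦ ∫_{[0,1)^{s-|v|}} F(x) dx_{-v}`. -/
def partialIntegral {s : ℕ} (v : Finset (Fin s)) (F : (Fin s → ℝ) → ℝ) : ({j // j ∈ v} → ℝ) → ℝ :=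
  fun x => ∫ z in cube {j // j ∉ v},
    F ((MeasurableEquiv.piEquivPiSubtypeProd (fun _ : Fin s => ℝ) (· ∈ v)).symm (x, z))

/-- The pairs `(v, τ)` with `v ⊆ u` and `τ ∈ {1, …, α}^{u \ v}`. -/
abbrev DerivIndex {s : ℕ} (α : ℕ) (u : Finset (Fin s)) : Type :=
  Σ v : {v : Finset (Fin s) // v ⊆ u}, ({j // j ∈ u \ v.1} → {t // t ∈ Finset.Icc 1 α})

/-- The multi-index `(τ_{u∖v}, α_v, 0)`. -/
def DerivIndex.order {s α : ℕ} {u : Finset (Fin s)} (i : DerivIndex α u) : Fin s → ℕ :=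
  fun j => if h : j ∈ u \ i.1.1 then (i.2 ⟨j, h⟩ : ℕ) else if j ∈ i.1.1 then α else 0

/-- The norm `‖f‖_{s,α,γ,q,r}`, with values in `[0, ∞]`; for `γ_u = 0` the conventions
`0⁻¹ = ∞` and `∞ * 0 = 0` of `ℝ≥0∞` apply. -/
def sobolevNorm {s : ℕ} (α : ℕ) (γ : Finset (Fin s) → ℝ≥0) (q r : ℝ≥0∞)
    (f : (Fin s → ℝ) → ℝ) : ℝ≥0∞ :=
  finLp r fun u : Finset (Fin s) =>
    (γ u : ℝ≥0∞)⁻¹ * finLp q fun i : DerivIndex α u =>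
      eLpNorm (partialIntegral i.1.1 (weakDeriv i.order f)) q
        (volume.restrict (cube {j // j ∈ i.1.1}))

/-- Membership in `W_{s,α,γ,q,r}`: only the values of `f` on `[0,1)^s` matter, `f` is continuous
there, has all mixed weak derivatives up to order `α` in each variable, and its norm is finite. -/
def MemSobolev {s : ℕ} (α : ℕ) (γ : Finset (Fin s) → ℝ≥0) (q r : ℝ≥0∞)
    (f : (Fin s → ℝ) → ℝ) : Prop :=
  ContinuousOn f (cube (Fin s)) ∧
    (∀ β : Fin s → ℕ, (∀ j, β j ≤ α) → ∃ g, IsWeakDeriv β f g) ∧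
    sobolevNorm α γ q r f < ⊤

/-- The worst-case error over the unit ball of `W_{s,α,γ,q,r}` of a quadrature rule `Q`. -/
def worstCaseError {s : ℕ} (α : ℕ) (γ : Finset (Fin s) → ℝ≥0) (q r : ℝ≥0∞)
    (Q : ((Fin s → ℝ) → ℝ) → ℝ) : ℝ≥0∞ :=
  ⨆ (f : (Fin s → ℝ) → ℝ) (_ : MemSobolev α γ q r f) (_ : sobolevNorm α γ q r f ≤ 1),
    ENNReal.ofReal |Q f - cubeIntegral f|

/-! ### Polynomial lattice rules -/

/-- `tr_n(k) = κ_0 + κ_1 x + ⋯ + κ_{n-1} x^{n-1}` for `k = κ_0 + κ_1 b + ⋯` in base `b`.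
For `k < b^n` this is the polynomial identified with `k`. -/
def tr (b n k : ℕ) : (ZMod b)[X] :=
  ∑ i ∈ Finset.range n, Polynomial.C ((k / b ^ i % b : ℕ) : ZMod b) * Polynomial.X ^ i

/-- The embedding of `𝔽_b[x]` in the field `𝔽_b((x⁻¹))` of formal Laurent series; the variable of
`LaurentSeries` stands for `x⁻¹`. -/
def toLaurent (b : ℕ) : (ZMod b)[X] →+* LaurentSeries (ZMod b) :=
  Polynomial.eval₂RingHom HahnSeries.C (HahnSeries.single (-1 : ℤ) 1)

/-- `v_n(∑_i a_i x^{-i}) = ∑_{i=1}^n a_i b^{-i}`. -/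
def vmap (b n : ℕ) (L : LaurentSeries (ZMod b)) : ℝ :=
  ∑ i ∈ Finset.Icc 1 n, ((L.coeff (i : ℤ)).val : ℝ) / (b : ℝ) ^ i

/-- The `h`-th point of the polynomial lattice with modulus `p` (of degree `n`) and generating
vector `g`. -/
def latticePoint (b : ℕ) [Fact b.Prime] {s : ℕ} (n : ℕ) (p : (ZMod b)[X])
    (g : Fin s → (ZMod b)[X]) (h : ℕ) : Fin s → ℝ :=
  fun j => vmap b n (toLaurent b (tr b n h * g j) / toLaurent b p)

/-- The polynomial lattice rule `I(f; P(p, g))`. -/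
def latticeRule (b : ℕ) [Fact b.Prime] {s : ℕ} (n : ℕ) (p : (ZMod b)[X])
    (g : Fin s → (ZMod b)[X]) (f : (Fin s → ℝ) → ℝ) : ℝ :=
  (1 / (b : ℝ) ^ n) * ∑ h ∈ Finset.range (b ^ n), f (latticePoint b n p g h)

/-- The dual polynomial lattice `P^⊥(p, g)`. -/
def dualLattice (b : ℕ) {s : ℕ} (n : ℕ) (p : (ZMod b)[X]) (g : Fin s → (ZMod b)[X]) :
    Set (Fin s → ℕ) :=
  {k | p ∣ ∑ j, tr b n (k j) * g j}

/-- The vector `(k_u, 0)`. -/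
def extendZero {s : ℕ} (u : Finset (Fin s)) (k : {j // j ∈ u} → ℕ) : Fin s → ℕ :=
  fun j => if h : j ∈ u then k ⟨j, h⟩ else 0

/-- `P^⊥_u`: the vectors `k_u` of positive integers with `(k_u, 0) ∈ P^⊥`. -/
def dualProj (b : ℕ) {s : ℕ} (n : ℕ) (p : (ZMod b)[X]) (g : Fin s → (ZMod b)[X])
    (u : Finset (Fin s)) : Set ({j // j ∈ u} → ℕ) :=
  {k | (∀ j, 0 < k j) ∧ extendZero u k ∈ dualLattice b n p g}

/-! ### The extrapolated rule -/

/-- `a_ν^{(τ)} = ∏_{j=1}^{ν-1} (-1)/(b^j-1) ∏_{j=1}^{τ-ν} b^j/(b^j-1)`. -/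
def extraCoeff (b τ ν : ℕ) : ℝ :=
  (∏ j ∈ Finset.Icc 1 (ν - 1), (-1 / ((b : ℝ) ^ j - 1))) *
    ∏ j ∈ Finset.Icc 1 (τ - ν), ((b : ℝ) ^ j / ((b : ℝ) ^ j - 1))

/-- The extrapolated rule `∑_{τ=1}^α a_τ^{(α)} I(f; P_{b^{m-τ+1}})`, where `P_{b^{m-τ+1}}` has
modulus `p τ` and generating vector `g τ`. -/
def extrapolatedRule (b : ℕ) [Fact b.Prime] {s : ℕ} (α m : ℕ) (p : ℕ → (ZMod b)[X])
    (g : ℕ → Fin s → (ZMod b)[X]) (f : (Fin s → ℝ) → ℝ) : ℝ :=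
  ∑ τ ∈ Finset.Icc 1 α, extraCoeff b α τ * latticeRule b (m - τ + 1) (p τ) (g τ) f

/-! ### The constants in the error bound -/

/-- `μ_α(k)`: the sum of the `min(v, α)` largest of the numbers `a_1 > ⋯ > a_v > 0` in
`k = κ_1 b^{a_1 - 1} + ⋯ + κ_v b^{a_v - 1}` with nonzero digits `κ_i`. The leading position is
`a_1 = log_b k + 1`, and `k mod b^{a_1 - 1}` is `k` without its leading term. -/
def mu (b : ℕ) : ℕ → ℕ → ℕ
  | 0, _ => 0
  | α + 1, k => if k = 0 then 0 else (Nat.log b k + 1) + mu b α (k % b ^ Nat.log b k)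

/-- The constant `C_α` in the bound on Walsh coefficients. -/
def walshConst (b α : ℕ) : ℝ :=
  max (2 / (2 * Real.sin (Real.pi / b)) ^ α)
      (⨆ z : {z // z ∈ Finset.Icc 1 (α - 1)}, 1 / (2 * Real.sin (Real.pi / b)) ^ (z : ℕ)) *
    (1 + 1 / (b : ℝ) + 1 / ((b : ℝ) * (b + 1))) ^ (α - 2) *
    (3 + 2 / (b : ℝ) + (2 * (b : ℝ) + 1) / ((b : ℝ) - 1))

/-- `b̃_τ`, the one-periodic extension of `b_τ = B_τ / τ!` on `[0,1)`. -/
def bernTilde (τ : ℕ) (x : ℝ) : ℝ := bernoulliFun τ (Int.fract x) / (τ.factorial : ℝ)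

/-- `D_α = max {|b_1|, …, |b_{α-1}|, sup_{x ∈ [0,1)} |b̃_α(x)|}` with `b_τ = b_τ(0)`. -/
def bernConst (α : ℕ) : ℝ :=
  max (⨆ τ : {τ // τ ∈ Finset.Icc 1 (α - 1)}, |bernoulliFun τ 0 / ((τ : ℕ).factorial : ℝ)|)
    (⨆ x : Set.Ico (0 : ℝ) 1, |bernTilde α x|)

/-- `∑ b^{-μ_α(k_u)}` over all `k_u ∈ P^⊥_u` with `b^n ∤ k_j` for some `j ∈ u`. -/
def dualSum (b : ℕ) {s : ℕ} (α n : ℕ) (p : (ZMod b)[X]) (g : Fin s → (ZMod b)[X])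
    (u : Finset (Fin s)) : ℝ≥0∞ :=
  ∑' k : {k : {j // j ∈ u} → ℕ // k ∈ dualProj b n p g u ∧ ∃ j, ¬ b ^ n ∣ k j},
    ((b : ℝ≥0∞) ^ (∑ j, mu b α (k.1 j)))⁻¹

/-- `B_{γ,r}(P_{b^n})`, where `r'` is the Hölder conjugate of `r`. -/
def boundB (b : ℕ) {s : ℕ} (α : ℕ) (γ : Finset (Fin s) → ℝ≥0) (r' : ℝ≥0∞) (n : ℕ)
    (p : (ZMod b)[X]) (g : Fin s → (ZMod b)[X]) : ℝ≥0∞ :=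
  finLp r' fun u : {u : Finset (Fin s) // u.Nonempty} =>
    (γ u.1 : ℝ≥0∞) * ENNReal.ofReal (walshConst b α) ^ u.1.card * dualSum b α n p g u.1

/-- `H_{s,γ,q,r}`, where `q'`, `r'` are the Hölder conjugates of `q`, `r`; the exponent `1/q'` is
`0` for `q' = ∞`. -/
def boundH {s : ℕ} (α : ℕ) (γ : Finset (Fin s) → ℝ≥0) (q' r' : ℝ≥0∞) : ℝ≥0∞ :=
  finLp r' fun u : Finset (Fin s) =>
    (γ u : ℝ≥0∞) * ((α : ℝ≥0∞) + 1) ^ ((u.card : ℝ) * (q'⁻¹).toReal) *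
      ENNReal.ofReal (bernConst α) ^ u.card

end

end ExtrapolatedLattice

open ExtrapolatedLattice

/-! Write `b_i = B_i / i!`. In one variable, Euler–Maclaurin with remainder reads `f(y) = ∑_{i ≤ α}
b_i(y) ∫ f^{(i)} + (-1)^{α+1} ∫ f^{(α)}(x) b̃_α(x - y) dx`. Its tensor product writes `f` as a
finite sum, over `κ ∈ {0, …, α+1}^s`, of integrals of `f^{(min(κ, α))}` against products of the
kernels `kern` (`eq_sum_kernIntegral`). As only weak derivatives are at hand, the formula is proved
in dual form, paired with products of smooth functions, and transferred to points by continuity.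

The points of a lattice with `b^n` points lie on the grid `b⁻ⁿ ℤ^s`, so each kernel may be replaced
by its finite Walsh expansion on that grid. A Walsh function averages to zero over the lattice
unless its index is in `P^⊥` (`sum_prod_walE_eq_zero`). What remains is the coefficient at `k = 0`,
the mean over the full grid, and the coefficients at `0 ≠ k ∈ P^⊥` with all `k_j < b^n`.

For `k ≠ 0`, a grid coefficient is the limit of sums of true Walsh coefficients over the aliases `k
+ b^n l` (`tendsto_sum_walCoef`). These aliases are exactly the `K ∈ P^⊥` with `b^n ∤ K_j` for some
`j`. Each nonzero digit of `K`, taken from the top, permits one integration by parts with a gain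
`b^{-a_i}`. Hence the coefficients of the `α + 1` nonconstant kernels together are at most `C_α
b^{-μ_α(K)}` (`walsh_bound_aux`, `one_add_geom_le_walshConst`). This gives `B`.

For `k = 0`, the multiplication formula of the Bernoulli polynomials makes the grid mean of `b_i`
equal to `b^{-ni} b_i(0)` and gives `b̃_α` a factor `b^{-nα}`. Terms of total order `t < α` are thus
`b^{-nt}` times a number independent of the lattice. Since `∑ a_τ x^{τ-1} = ∏ (b^j - x) / (b^j -
1)`, the extrapolation kills them for `0 < t < α` and keeps `I(f)` for `t = 0`. Terms of total order
at least `α` are of size `b^{-nα}` and give `H`.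

Hölder's inequality over the derivatives and over `u` brings in the norm of `f`. -/

namespace ExtrapolatedLattice

/-! ### Normalised Bernoulli functions -/

/-- `B_t / t!`. -/
noncomputable def bernNorm (t : ℕ) (y : ℝ) : ℝ := bernoulliFun t y / (t.factorial : ℝ)

theorem bernTilde_eq (t : ℕ) (x : ℝ) : bernTilde t x = bernNorm t (Int.fract x) := rfl

theorem bernNorm_zero (y : ℝ) : bernNorm 0 y = 1 := by simp [bernNorm]

theorem bernNorm_one' (y : ℝ) : bernNorm 1 y = y - 1 / 2 := by simp [bernNorm]

theorem hasDerivAt_bernNorm (t : ℕ) (y : ℝ) :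
    HasDerivAt (bernNorm (t + 1)) (bernNorm t y) y := by
  have h := (hasDerivAt_bernoulliFun (t + 1) y).div_const ((t + 1).factorial : ℝ)
  convert! h using 1
  have : ((t : ℝ) + 1) ≠ 0 := by positivity
  have : (t.factorial : ℝ) ≠ 0 := by positivity
  simp only [bernNorm, Nat.factorial_succ, Nat.add_sub_cancel]
  push_cast
  field_simp

@[fun_prop]
theorem continuous_bernNorm (t : ℕ) : Continuous (bernNorm t) :=
  (continuous_bernoulliFun t).div_const _

theorem bernNorm_at_one (t : ℕ) : bernNorm t 1 = bernNorm t 0 + if t = 1 then 1 else 0 := by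
  simp only [bernNorm, bernoulliFun_eval_one, add_div]
  split_ifs with h <;> simp [h]

theorem integral_bernNorm (t : ℕ) :
    ∫ y in (0 : ℝ)..1, bernNorm (t + 1) y = 0 := by
  simp only [bernNorm, intervalIntegral.integral_div]
  rw [integral_bernoulliFun_eq_zero (Nat.succ_ne_zero t), zero_div]

theorem bernTilde_periodic (t : ℕ) : Function.Periodic (bernTilde t) 1 := by
  intro x
  simp [bernTilde]

theorem continuous_bernTilde {t : ℕ} (ht : 2 ≤ t) : Continuous (bernTilde t) := by
  have h : ContinuousOn (bernNorm t) (Set.Icc 0 1) := (continuous_bernNorm t).continuousOn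
  exact h.comp_fract'' (by rw [bernNorm_at_one, if_neg (by omega), add_zero])

theorem bernNorm_sub_eq_integral (t : ℕ) (x y : ℝ) :
    bernNorm (t + 1) y - bernNorm (t + 1) x = ∫ z in x..y, bernNorm t z := by
  rw [intervalIntegral.integral_eq_sub_of_hasDerivAt (fun z _ => hasDerivAt_bernNorm t z)]
  exact (continuous_bernNorm t).intervalIntegrable _ _

/-- For `t ≥ 1` the function `b_{t+1}` has mean zero, hence a zero in `(0,1)`, and it takes equal
values at `0` and `1`. On the circle every point is within `1/2` of that zero, and the Lipschitz
constant is at most `2^{-t}` by induction. -/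
theorem abs_bernNorm_le (t : ℕ) {y : ℝ} (hy : y ∈ Set.Icc (0 : ℝ) 1) :
    |bernNorm t y| ≤ (1 / 2) ^ t := by
  induction t generalizing y with
  | zero => simp [bernNorm_zero]
  | succ t ih =>
    rcases Nat.eq_zero_or_pos t with rfl | ht
    · rw [bernNorm_one', pow_one, abs_le]
      constructor <;> linarith [hy.1, hy.2]
    obtain ⟨z, hz, hz0⟩ := exists_eq_interval_average (f := bernNorm (t + 1))
      (zero_ne_one' ℝ) (continuous_bernNorm _).continuousOn
    rw [interval_average_eq, integral_bernNorm, smul_zero] at hz0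
    rw [Set.uIoo_of_le zero_le_one] at hz
    have hlip : ∀ u v : ℝ, u ∈ Set.Icc (0 : ℝ) 1 → v ∈ Set.Icc (0 : ℝ) 1 →
        |bernNorm (t + 1) v - bernNorm (t + 1) u| ≤ (1 / 2) ^ t * |v - u| := by
      intro u v hu hv
      rw [bernNorm_sub_eq_integral, ← Real.norm_eq_abs]
      refine intervalIntegral.norm_integral_le_of_norm_le_const fun w hw => ?_
      rw [Real.norm_eq_abs]
      exact ih (Set.uIcc_subset_Icc hu hv (Set.uIoc_subset_uIcc hw))
    have h01 : bernNorm (t + 1) 1 = bernNorm (t + 1) 0 := by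
      rw [bernNorm_at_one, if_neg (by omega), add_zero]
    have hz' : z ∈ Set.Icc (0 : ℝ) 1 := ⟨hz.1.le, hz.2.le⟩
    have h0 : (0 : ℝ) ∈ Set.Icc (0 : ℝ) 1 := by simp
    have h1 : (1 : ℝ) ∈ Set.Icc (0 : ℝ) 1 := by simp
    have a1 := hlip z y hz' hy
    have a2 := hlip 0 y h0 hy
    have a3 := hlip z 1 hz' h1
    have a4 := hlip 1 y h1 hy
    have a5 := hlip z 0 hz' h0
    have hp : (0 : ℝ) < (1 / 2) ^ t := by positivity
    rw [hz0, sub_zero] at a1 a3 a5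
    rw [h01] at a3 a4
    have b2 := abs_add_le (bernNorm (t + 1) y - bernNorm (t + 1) 0) (bernNorm (t + 1) 0)
    rw [sub_add_cancel] at b2
    rw [pow_succ]
    rw [abs_of_nonneg (by linarith [hy.1] : (0 : ℝ) ≤ y - 0)] at a2
    rw [abs_of_nonneg (by linarith [hz.2] : (0 : ℝ) ≤ 1 - z)] at a3
    rw [abs_of_nonpos (by linarith [hy.2] : y - 1 ≤ 0)] at a4
    rw [abs_of_nonpos (by linarith [hz.1] : 0 - z ≤ 0)] at a5
    -- The direct path from `z` to `y` and the path through the identified endpoints have total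
    -- length `1`; averaging the two bounds gives the factor `1/2`.
    rcases le_total y z with h | h
    · rw [abs_of_nonpos (by linarith : y - z ≤ 0)] at a1
      nlinarith
    · rw [abs_of_nonneg (by linarith : 0 ≤ y - z)] at a1
      nlinarith

theorem abs_bernTilde_le (t : ℕ) (x : ℝ) : |bernTilde t x| ≤ (1 / 2) ^ t :=
  abs_bernNorm_le t ⟨Int.fract_nonneg x, (Int.fract_lt_one x).le⟩

/-! ### Integration by parts against a primitive -/

/-- The primitive of an integrable `G` is only absolutely continuous, but integration by parts holds
in that class; step functions such as Walsh functions require this generality. -/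
theorem integral_mul_eq_sub_of_primitive_real {a b : ℝ} {u u' : ℝ → ℝ}
    (hu : ∀ x, HasDerivAt u (u' x) x) (hu' : Continuous u') {G : ℝ → ℝ}
    (hG : IntervalIntegrable G volume a b) :
    ∫ y in a..b, u y * G y =
      u b * (∫ t in a..b, G t) - ∫ y in a..b, u' y * ∫ t in a..y, G t := by
  have hac := hG.absolutelyContinuousOnInterval_intervalIntegral (c := a) (by simp)
  have hud : deriv u = u' := funext fun x => (hu x).deriv
  have hu1 : ContDiff ℝ 1 u := contDiff_one_iff_deriv.2
    ⟨fun x => (hu x).differentiableAt, hud ▸ hu'⟩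
  have hacu : AbsolutelyContinuousOnInterval u a b :=
    hu1.contDiffOn.absolutelyContinuousOnInterval
  have h := hacu.integral_mul_deriv_eq_deriv_mul hac
  rw [intervalIntegral.integral_same, mul_zero, sub_zero, hud] at h
  rw [← h]
  refine intervalIntegral.integral_congr_ae ?_
  filter_upwards [hG.ae_hasDerivAt_integral] with x hx hxm
  rw [(hx (Set.uIoc_subset_uIcc hxm) a (by simp)).deriv]

theorem integral_mul_eq_sub_of_primitive {a b : ℝ} {u u' : ℝ → ℝ}
    (hu : ∀ x, HasDerivAt u (u' x) x) (hu' : Continuous u') {G H : ℝ → ℂ}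
    (hG : IntervalIntegrable G volume a b)
    (hH : ∀ y ∈ Set.uIcc a b, H y = H a + ∫ t in a..y, G t) :
    ∫ y in a..b, (u y : ℂ) * G y = u b * H b - u a * H a - ∫ y in a..b, (u' y : ℂ) * H y := by
  have huc : Continuous u := continuous_iff_continuousAt.2 fun x => (hu x).continuousAt
  have hHc : ContinuousOn (fun y => ∫ t in a..y, G t) (Set.uIcc a b) :=
    intervalIntegral.continuousOn_primitive_interval' hG (by simp)
  have key : ∀ L : ℂ →L[ℝ] ℝ, L (∫ y in a..b, (u y : ℂ) * G y) =
      L (u b * (∫ t in a..b, G t) - ∫ y in a..b, (u' y : ℂ) * ∫ t in a..y, G t) := by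
    intro L
    have hLG : IntervalIntegrable (fun y => L (G y)) volume a b :=
      ⟨L.integrable_comp hG.1, L.integrable_comp hG.2⟩
    have e1 : ∀ (r : ℝ) (z : ℂ), L ((r : ℂ) * z) = r * L z := by
      intro r z
      rw [← Complex.real_smul, map_smul, smul_eq_mul]
    rw [map_sub, e1, ← L.intervalIntegral_comp_comm, ← L.intervalIntegral_comp_comm hG,
      ← L.intervalIntegral_comp_comm]
    · simp only [e1]
      rw [integral_mul_eq_sub_of_primitive_real hu hu' hLG]
      congr 1
      refine intervalIntegral.integral_congr fun y hy => ?_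
      rw [L.intervalIntegral_comp_comm]
      exact hG.mono_set (Set.uIcc_subset_uIcc_left hy)
    · exact (ContinuousOn.mul (by fun_prop) hHc).intervalIntegrable
    · exact hG.continuousOn_mul (by fun_prop)
  have hmain : ∫ y in a..b, (u y : ℂ) * G y =
      u b * (∫ t in a..b, G t) - ∫ y in a..b, (u' y : ℂ) * ∫ t in a..y, G t :=
    Complex.ext (key Complex.reCLM) (key Complex.imCLM)
  have h2 : ∫ y in a..b, (u' y : ℂ) * H y =
      (∫ y in a..b, (u' y : ℂ)) * H a + ∫ y in a..b, (u' y : ℂ) * ∫ t in a..y, G t := by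
    rw [← intervalIntegral.integral_mul_const, ← intervalIntegral.integral_add]
    · refine intervalIntegral.integral_congr fun y hy => ?_
      rw [hH y hy]; ring
    · exact Continuous.intervalIntegrable (by fun_prop) _ _
    · exact (ContinuousOn.mul (by fun_prop) hHc).intervalIntegrable
  have h3 : ∫ y in a..b, (u' y : ℂ) = u b - u a := by
    rw [intervalIntegral.integral_ofReal,
      intervalIntegral.integral_eq_sub_of_hasDerivAt (fun z _ => hu z) (hu'.intervalIntegrable _ _)]
    push_cast; rfl
  rw [hmain, h2, h3, hH b (by simp)]
  ring

/-! ### Convolution with periodic Bernoulli functions -/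

/-- `x ↦ ∫_0^1 b̃_t(x - y) G(y) dy`. -/
noncomputable def bernConv (t : ℕ) (G : ℝ → ℂ) (x : ℝ) : ℂ :=
  ∫ y in (0 : ℝ)..1, (bernTilde t (x - y) : ℂ) * G y

theorem bernConv_fract (t : ℕ) (G : ℝ → ℂ) (x : ℝ) :
    bernConv t G (Int.fract x) = bernConv t G x := by
  unfold bernConv
  congr 1
  ext y
  have h : x - y = (Int.fract x - y) + ⌊x⌋ := by linarith [Int.self_sub_floor x]
  rw [h]
  simp [bernTilde]

theorem bernTilde_sub_of_le {x y : ℝ} (t : ℕ) (hx : x < 1) (hy : 0 ≤ y) (h : y ≤ x) :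
    bernTilde t (x - y) = bernNorm t (x - y) := by
  rw [bernTilde_eq, Int.fract_eq_self.2 ⟨by linarith, by linarith⟩]

theorem bernTilde_sub_of_lt {x y : ℝ} (t : ℕ) (hx : 0 ≤ x) (hy : y ≤ 1) (h : x < y) :
    bernTilde t (x - y) = bernNorm t (x - y + 1) := by
  rw [bernTilde_eq]
  congr 1
  rw [Int.fract_eq_iff]
  exact ⟨by linarith, by linarith, -1, by push_cast; ring⟩

theorem bernConv_eq_add {t : ℕ} {G : ℝ → ℂ} (hG : IntervalIntegrable G volume 0 1) {x : ℝ}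
    (hx : x ∈ Set.Ico (0 : ℝ) 1) :
    bernConv t G x = (∫ y in (0 : ℝ)..x, (bernNorm t (x - y) : ℂ) * G y) +
      ∫ y in x..1, (bernNorm t (x - y + 1) : ℂ) * G y := by
  have hG1 : IntervalIntegrable G volume 0 x :=
    hG.mono_set (Set.uIcc_subset_uIcc (by simp) (by rw [Set.uIcc_of_le zero_le_one]; exact ⟨hx.1, hx.2.le⟩))
  have hG2 : IntervalIntegrable G volume x 1 :=
    hG.mono_set (Set.uIcc_subset_uIcc (by rw [Set.uIcc_of_le zero_le_one]; exact ⟨hx.1, hx.2.le⟩) (by simp))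
  have i1 : ∀ y ∈ Set.uIoc 0 x, (bernNorm t (x - y) : ℂ) * G y = (bernTilde t (x - y) : ℂ) * G y := by
    intro y hy
    rw [Set.uIoc_of_le hx.1] at hy
    rw [bernTilde_sub_of_le t hx.2 hy.1.le hy.2]
  have i2 : ∀ y ∈ Set.uIoc x 1,
      (bernNorm t (x - y + 1) : ℂ) * G y = (bernTilde t (x - y) : ℂ) * G y := by
    intro y hy
    rw [Set.uIoc_of_le hx.2.le] at hy
    rw [bernTilde_sub_of_lt t hx.1 hy.2 hy.1]
  have j1 : IntervalIntegrable (fun y => (bernNorm t (x - y) : ℂ) * G y) volume 0 x :=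
    hG1.continuousOn_mul (by fun_prop)
  have j2 : IntervalIntegrable (fun y => (bernNorm t (x - y + 1) : ℂ) * G y) volume x 1 :=
    hG2.continuousOn_mul (by fun_prop)
  rw [bernConv, ← intervalIntegral.integral_add_adjacent_intervals (j1.congr i1) (j2.congr i2)]
  congr 1
  · exact intervalIntegral.integral_congr_ae (ae_of_all _ fun y hy => (i1 y hy).symm)
  · exact intervalIntegral.integral_congr_ae (ae_of_all _ fun y hy => (i2 y hy).symm)

/-- Cutting at `y = x` makes the periodic kernel smooth on both pieces. Integration by parts leaves
the boundary term at `y = 1` and, for `t = 0`, the term `-H x` from the jump of `b̃_1` at the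
integers. -/
theorem bernConv_succ {t : ℕ} {G H : ℝ → ℂ} (hG : IntervalIntegrable G volume 0 1)
    (hH : ∀ y ∈ Set.Icc (0 : ℝ) 1, H y = ∫ z in (0 : ℝ)..y, G z) {x : ℝ}
    (hx : x ∈ Set.Ico (0 : ℝ) 1) :
    bernConv (t + 1) G x =
      (bernConv t H x - if t = 0 then H x else 0) + (bernNorm (t + 1) x : ℂ) * H 1 := by
  have hx' : x ∈ Set.uIcc (0 : ℝ) 1 := by
    rw [Set.uIcc_of_le zero_le_one]; exact ⟨hx.1, hx.2.le⟩
  have hG1 : IntervalIntegrable G volume 0 x := hG.mono_set (Set.uIcc_subset_uIcc (by simp) hx')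
  have hG2 : IntervalIntegrable G volume x 1 := hG.mono_set (Set.uIcc_subset_uIcc hx' (by simp))
  have hH0 : H 0 = 0 := by rw [hH 0 (by simp)]; simp
  have hHc : ContinuousOn H (Set.uIcc 0 1) := by
    refine (intervalIntegral.continuousOn_primitive_interval' (a := 0) hG (by simp)).congr ?_
    intro y hy
    rw [Set.uIcc_of_le zero_le_one] at hy
    exact hH y hy
  have p1 : ∀ y ∈ Set.uIcc 0 x, H y = H 0 + ∫ z in (0 : ℝ)..y, G z := by
    intro y hy
    rw [Set.uIcc_of_le hx.1] at hy
    rw [hH0, zero_add, hH y ⟨hy.1, hy.2.trans hx.2.le⟩]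
  have p2 : ∀ y ∈ Set.uIcc x 1, H y = H x + ∫ z in x..y, G z := by
    intro y hy
    rw [Set.uIcc_of_le hx.2.le] at hy
    rw [hH y ⟨hx.1.trans hy.1, hy.2⟩, hH x ⟨hx.1, hx.2.le⟩,
      intervalIntegral.integral_add_adjacent_intervals hG1]
    refine hG2.mono_set (Set.uIcc_subset_uIcc (by simp) ?_)
    rw [Set.uIcc_of_le hx.2.le]; exact hy
  have d1 : ∀ y, HasDerivAt (fun y => bernNorm (t + 1) (x - y)) (-bernNorm t (x - y)) y := by
    intro y
    have := (hasDerivAt_bernNorm t (x - y)).comp y ((hasDerivAt_id y).const_sub x)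
    simpa using! this
  have d2 : ∀ y, HasDerivAt (fun y => bernNorm (t + 1) (x - y + 1)) (-bernNorm t (x - y + 1)) y := by
    intro y
    have := (hasDerivAt_bernNorm t (x - y + 1)).comp y (((hasDerivAt_id y).const_sub x).add_const 1)
    simpa using! this
  rw [bernConv_eq_add hG hx, bernConv_eq_add hHc.intervalIntegrable hx,
    integral_mul_eq_sub_of_primitive d1 (by fun_prop) hG1 p1,
    integral_mul_eq_sub_of_primitive d2 (by fun_prop) hG2 p2, hH0, sub_add_cancel]
  simp only [Complex.ofReal_neg, neg_mul, intervalIntegral.integral_neg, sub_self, zero_add]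
  rw [bernNorm_at_one]
  rcases Nat.eq_zero_or_pos t with rfl | ht
  · simp only [if_true, Complex.ofReal_add, zero_add]
    push_cast
    ring
  · rw [if_neg (by omega), if_neg (by omega), add_zero]
    ring

theorem integral_bernNorm_succ_mul {t : ℕ} {G H : ℝ → ℂ} (hG : IntervalIntegrable G volume 0 1)
    (hH : ∀ y ∈ Set.Icc (0 : ℝ) 1, H y = ∫ z in (0 : ℝ)..y, G z) (hH1 : H 1 = 0) :
    ∫ y in (0 : ℝ)..1, (bernNorm (t + 1) y : ℂ) * G y =
      -∫ y in (0 : ℝ)..1, (bernNorm t y : ℂ) * H y := by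
  have hH0 : H 0 = 0 := by rw [hH 0 (by simp)]; simp
  rw [integral_mul_eq_sub_of_primitive (hasDerivAt_bernNorm t) (by fun_prop) hG (H := H), hH1, hH0]
  · ring
  · intro y hy
    rw [Set.uIcc_of_le zero_le_one] at hy
    rw [hH0, zero_add, hH y hy]

end ExtrapolatedLattice

/-! ### Walsh analysis of the Bernoulli kernels -/

namespace ExtrapolatedLattice

/-! ### Functions with a common profile on equal cells -/

/-- On the `i`-th cell `[i/N, (i+1)/N)` this is `lam i` times the rescaled profile `w`. -/
noncomputable def cellFn (N : ℕ) (lam : ℕ → ℂ) (w : ℝ → ℂ) (y : ℝ) : ℂ :=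
  lam ⌊(N : ℝ) * y⌋₊ * w (Int.fract ((N : ℝ) * y))

theorem cellFn_of_mem {N : ℕ} (hN : 0 < N) (lam : ℕ → ℂ) (w : ℝ → ℂ) (i : ℕ) {y : ℝ}
    (hy : y ∈ Set.Ico ((i : ℝ) / N) (((i : ℝ) + 1) / N)) :
    cellFn N lam w y = lam i * w (N * y - i) := by
  have hN' : (0 : ℝ) < N := by exact_mod_cast hN
  have h1 : (i : ℝ) ≤ N * y := by have := (div_le_iff₀ hN').1 hy.1; linarith
  have h2 : N * y < (i : ℝ) + 1 := by have := (lt_div_iff₀ hN').1 hy.2; linarith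
  have hf : ⌊(N : ℝ) * y⌋₊ = i := (Nat.floor_eq_iff ((Nat.cast_nonneg i).trans h1)).2 ⟨h1, h2⟩
  have hfr : Int.fract ((N : ℝ) * y) = N * y - i :=
    Int.fract_eq_iff.2 ⟨by linarith, by linarith, i, by push_cast; ring⟩
  rw [cellFn, hf, hfr]

theorem cellFn_interval {N : ℕ} (hN : 0 < N) (lam : ℕ → ℂ) {w : ℝ → ℂ}
    (hw : IntervalIntegrable w volume 0 1) (i : ℕ) {t : ℝ} (ht : t ∈ Set.Icc (0 : ℝ) 1) :
    IntervalIntegrable (cellFn N lam w) volume ((i : ℝ) / N) (((i : ℝ) + t) / N) ∧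
    ∫ y in ((i : ℝ) / N)..(((i : ℝ) + t) / N), cellFn N lam w y =
      (N : ℂ)⁻¹ * (lam i * ∫ z in (0 : ℝ)..t, w z) := by
  have hN' : (0 : ℝ) < N := by exact_mod_cast hN
  have hle : (i : ℝ) / N ≤ ((i : ℝ) + t) / N := by
    gcongr; linarith [ht.1]
  have hwt : IntervalIntegrable w volume 0 t :=
    hw.mono_set (Set.uIcc_subset_uIcc (by simp) (by rwa [Set.uIcc_of_le zero_le_one]))
  have hcongr : ∀ᵐ y, y ∈ Set.uIoc ((i : ℝ) / N) (((i : ℝ) + t) / N) →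
      lam i * w (N * y - i) = cellFn N lam w y := by
    have : ∀ᵐ y : ℝ, y ≠ ((i : ℝ) + 1) / N := by simp [ae_iff, measure_singleton]
    filter_upwards [this] with y hy1 hy
    rw [Set.uIoc_of_le hle] at hy
    rw [cellFn_of_mem hN]
    refine ⟨hy.1.le, lt_of_le_of_ne (hy.2.trans ?_) hy1⟩
    gcongr
    exact ht.2
  have hint : IntervalIntegrable (fun y => lam i * w (N * y - i)) volume
      ((i : ℝ) / N) (((i : ℝ) + t) / N) := by
    have h1 := (hwt.comp_sub_right (i : ℝ)).comp_mul_left (c := (N : ℝ))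
    refine IntervalIntegrable.const_mul ?_ _
    convert! h1 using 1
    · rw [zero_add]
    · rw [add_comm]
  refine ⟨hint.congr_ae ?_, ?_⟩
  · rw [Filter.EventuallyEq, ae_restrict_iff' measurableSet_uIoc]
    exact hcongr
  · rw [← intervalIntegral.integral_congr_ae hcongr, intervalIntegral.integral_const_mul,
      intervalIntegral.integral_comp_mul_sub (fun z => w z) hN'.ne']
    rw [mul_div_cancel₀ _ hN'.ne', mul_div_cancel₀ _ hN'.ne', sub_self, add_sub_cancel_left,
      Complex.real_smul]
    push_cast
    ring

theorem cellFn_integral_nat {N : ℕ} (hN : 0 < N) (lam : ℕ → ℂ) {w : ℝ → ℂ}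
    (hw : IntervalIntegrable w volume 0 1) (n : ℕ) :
    IntervalIntegrable (cellFn N lam w) volume 0 ((n : ℝ) / N) ∧
    ∫ y in (0 : ℝ)..((n : ℝ) / N), cellFn N lam w y =
      (N : ℂ)⁻¹ * ((∑ c ∈ Finset.range n, lam c) * ∫ z in (0 : ℝ)..1, w z) := by
  induction n with
  | zero => simp
  | succ n ih =>
    obtain ⟨h1, h2⟩ := cellFn_interval hN lam hw n (t := 1) (by simp)
    have e : ((n + 1 : ℕ) : ℝ) = (n : ℝ) + 1 := by push_cast; ring
    rw [e]
    refine ⟨ih.1.trans h1, ?_⟩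
    rw [← intervalIntegral.integral_add_adjacent_intervals ih.1 h1, ih.2, h2,
      Finset.sum_range_succ]
    ring

/-- Completed cells contribute the mean of the profile and the current cell a partial primitive. If
the profile has mean zero, the primitive is again a cell function; the induction over digits rests
on this. -/
theorem cellFn_integral {N : ℕ} (hN : 0 < N) (lam : ℕ → ℂ) {w : ℝ → ℂ}
    (hw : IntervalIntegrable w volume 0 1) {y : ℝ} (hy : 0 ≤ y) :
    IntervalIntegrable (cellFn N lam w) volume 0 y ∧
    ∫ y in (0 : ℝ)..y, cellFn N lam w y =
      (N : ℂ)⁻¹ * ((∑ c ∈ Finset.range ⌊(N : ℝ) * y⌋₊, lam c) * (∫ z in (0 : ℝ)..1, w z) +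
        lam ⌊(N : ℝ) * y⌋₊ * ∫ z in (0 : ℝ)..(Int.fract ((N : ℝ) * y)), w z) := by
  have hN' : (0 : ℝ) < N := by exact_mod_cast hN
  set n := ⌊(N : ℝ) * y⌋₊ with hn
  obtain ⟨h1, h2⟩ := cellFn_integral_nat hN lam hw n
  obtain ⟨h3, h4⟩ := cellFn_interval hN lam hw n (t := Int.fract ((N : ℝ) * y))
    ⟨Int.fract_nonneg _, (Int.fract_lt_one _).le⟩
  have e : ((n : ℝ) + Int.fract ((N : ℝ) * y)) / N = y := by
    rw [hn, natCast_floor_eq_intCast_floor (by positivity), Int.floor_add_fract]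
    field_simp
  rw [e] at h3 h4
  refine ⟨h1.trans h3, ?_⟩
  rw [← intervalIntegral.integral_add_adjacent_intervals h1 h3, h2, h4]
  ring

theorem cellFn_integral_one {N : ℕ} (hN : 0 < N) (lam : ℕ → ℂ) {w : ℝ → ℂ}
    (hw : IntervalIntegrable w volume 0 1) :
    ∫ y in (0 : ℝ)..1, cellFn N lam w y =
      (N : ℂ)⁻¹ * ((∑ c ∈ Finset.range N, lam c) * (∫ z in (0 : ℝ)..1, w z)) := by
  have h := (cellFn_integral_nat hN lam hw N).2
  rwa [div_self (by positivity)] at h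

theorem cellFn_intervalIntegrable {N : ℕ} (hN : 0 < N) (lam : ℕ → ℂ) {w : ℝ → ℂ}
    (hw : IntervalIntegrable w volume 0 1) :
    IntervalIntegrable (cellFn N lam w) volume 0 1 :=
  (cellFn_integral hN lam hw zero_le_one).1

theorem norm_cellFn_le {N : ℕ} {lam : ℕ → ℂ} (hlam : ∀ i, ‖lam i‖ ≤ 1) {w : ℝ → ℂ} {w0 : ℝ}
    (hw : ∀ t ∈ Set.Ico (0 : ℝ) 1, ‖w t‖ ≤ w0) (y : ℝ) : ‖cellFn N lam w y‖ ≤ w0 := by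
  rw [cellFn, norm_mul]
  have h1 := hw (Int.fract (N * y)) ⟨Int.fract_nonneg _, Int.fract_lt_one _⟩
  calc _ ≤ 1 * w0 := mul_le_mul (hlam _) h1 (norm_nonneg _) zero_le_one
    _ = w0 := one_mul _

/-! ### Discrete Walsh functions -/

/-- The value on the cell with index `i < b ^ A` of the `k`-th Walsh function in base `b`. -/
noncomputable def walE (b : ℕ) [NeZero b] : ℕ → ℕ → ℕ → ℂ
  | 0, _, _ => 1
  | A + 1, k, i =>
    walE b A k (i / b) * ZMod.stdAddChar (((k / b ^ A : ℕ) : ZMod b) * (i : ZMod b))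

variable {b : ℕ} [NeZero b]

theorem norm_stdAddChar (x : ZMod b) : ‖(ZMod.stdAddChar x : ℂ)‖ = 1 := by
  rw [ZMod.stdAddChar_apply, Circle.norm_coe]

theorem norm_walE (A k i : ℕ) : ‖walE b A k i‖ = 1 := by
  induction A generalizing i with
  | zero => simp [walE]
  | succ A ih => rw [walE, norm_mul, ih, norm_stdAddChar, one_mul]

theorem walE_add_mul (A k l i : ℕ) : walE b A (k + b ^ A * l) i = walE b A k i := by
  induction A generalizing i l with
  | zero => simp [walE]
  | succ A ih =>
    have hb : 0 < b ^ A := Nat.pos_of_ne_zero (pow_ne_zero _ (NeZero.ne b))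
    have e : k + b ^ (A + 1) * l = k + b ^ A * (b * l) := by ring
    rw [walE, walE, e, ih, Nat.add_mul_div_left _ _ hb]
    simp

theorem walE_mod (A k i : ℕ) : walE b A (k % b ^ A) i = walE b A k i := by
  conv_rhs => rw [← Nat.mod_add_div k (b ^ A), walE_add_mul]

theorem walE_zero_right (A i : ℕ) : walE b A 0 i = 1 := by
  induction A generalizing i with
  | zero => simp [walE]
  | succ A ih => simp [walE, ih]

theorem sum_range_mul_eq {M : Type*} [AddCommMonoid M] (m n : ℕ) (f : ℕ → M) :
    ∑ i ∈ Finset.range (m * n), f i =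
      ∑ i ∈ Finset.range m, ∑ c ∈ Finset.range n, f (n * i + c) := by
  induction m with
  | zero => simp
  | succ m ih =>
    rw [Nat.succ_mul, Finset.sum_range_add, ih, Finset.sum_range_succ, mul_comm m n]

theorem sum_range_stdAddChar (x : ZMod b) :
    ∑ c ∈ Finset.range b, (ZMod.stdAddChar (x * (c : ZMod b)) : ℂ) = if x = 0 then (b : ℂ) else 0 := by
  have h := AddChar.sum_mulShift x (ZMod.isPrimitive_stdAddChar b)
  rw [ZMod.card] at h
  push_cast at h
  rw [← h]
  refine Finset.sum_bij' (fun c _ => (c : ZMod b)) (fun x _ => x.val) ?_ ?_ ?_ ?_ ?_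
  · simp
  · intro a _; simpa using ZMod.val_lt a
  · intro a ha; exact ZMod.val_cast_of_lt (Finset.mem_range.1 ha)
  · intro a _; simp
  · intro a _; rw [mul_comm]

theorem natCast_div_eq_zero_iff {A k : ℕ} (hk : k < b ^ (A + 1)) :
    (((k / b ^ A : ℕ) : ZMod b) = 0) ↔ k < b ^ A := by
  have hb : 0 < b ^ A := Nat.pos_of_ne_zero (pow_ne_zero _ (NeZero.ne b))
  rw [ZMod.natCast_eq_zero_iff, ← Nat.div_eq_zero_iff_lt hb]
  refine ⟨fun h => Nat.eq_zero_of_dvd_of_lt h ?_, fun h => h ▸ dvd_zero _⟩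
  rw [Nat.div_lt_iff_lt_mul hb]
  rwa [pow_succ, mul_comm] at hk

theorem walE_succ_mul_add (A k i c : ℕ) (hc : c < b) :
    walE b (A + 1) k (b * i + c) =
      walE b A k i * ZMod.stdAddChar (((k / b ^ A : ℕ) : ZMod b) * (c : ZMod b)) := by
  rw [walE, Nat.mul_add_div (Nat.pos_of_ne_zero (NeZero.ne b)), Nat.div_eq_of_lt hc]
  simp

theorem sum_walE_eq_zero {A k : ℕ} (hk0 : 0 < k) (hk : k < b ^ A) :
    ∑ i ∈ Finset.range (b ^ A), walE b A k i = 0 := by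
  induction A generalizing k with
  | zero => simp at hk; omega
  | succ A ih =>
    rw [pow_succ, sum_range_mul_eq]
    have h : ∀ i ∈ Finset.range (b ^ A), ∑ c ∈ Finset.range b, walE b (A + 1) k (b * i + c) =
        walE b A k i * if ((k / b ^ A : ℕ) : ZMod b) = 0 then (b : ℂ) else 0 := by
      intro i _
      rw [← sum_range_stdAddChar, Finset.mul_sum]
      exact Finset.sum_congr rfl fun c hc => walE_succ_mul_add A k i c (Finset.mem_range.1 hc)
    rw [Finset.sum_congr rfl h, ← Finset.sum_mul]
    split_ifs with h0
    · rw [ih hk0 ((natCast_div_eq_zero_iff hk).1 h0), zero_mul]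
    · rw [mul_zero]

theorem floor_mul_div (A : ℕ) (y : ℝ) :
    ⌊((b ^ (A + 1) : ℕ) : ℝ) * y⌋₊ / b = ⌊((b ^ A : ℕ) : ℝ) * y⌋₊ := by
  rw [← Nat.floor_div_natCast]
  congr 1
  have : (b : ℝ) ≠ 0 := by exact_mod_cast NeZero.ne b
  push_cast
  rw [pow_succ]
  field_simp

/-- The leading digit of `k` is paired with the last digit of the cell index, hence with the finest
scale. It can be peeled off and absorbed into a profile on cells `b` times as long. -/
theorem cellFn_walE_succ (A k : ℕ) (w : ℝ → ℂ) {y : ℝ} (hy : 0 ≤ y) :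
    cellFn (b ^ (A + 1)) (walE b (A + 1) k) w y =
      cellFn (b ^ A) (walE b A k)
        (cellFn b (fun c => ZMod.stdAddChar (((k / b ^ A : ℕ) : ZMod b) * (c : ZMod b))) w) y := by
  set z : ℝ := ((b ^ A : ℕ) : ℝ) * y with hz
  have hz0 : 0 ≤ z := by positivity
  have e : ((b ^ (A + 1) : ℕ) : ℝ) * y = b * Int.fract z + (b * ⌊z⌋₊ : ℕ) := by
    push_cast
    rw [natCast_floor_eq_intCast_floor hz0, ← mul_add, Int.fract_add_floor, hz]
    push_cast
    ring
  unfold cellFn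
  rw [walE, floor_mul_div, ← hz, mul_assoc]
  congr 1
  rw [e, Nat.floor_add_natCast (by have := Int.fract_nonneg z; positivity)]
  congr 1
  · simp
  · rw [Int.fract_add_natCast]

end ExtrapolatedLattice

namespace ExtrapolatedLattice

/-! ### Bounds on Walsh coefficients of Bernoulli functions -/

section walshBounds

variable {b : ℕ}

theorem two_sin_pos (hb : 2 ≤ b) : 0 < 2 * Real.sin (Real.pi / b) := by
  have : (2 : ℝ) ≤ b := by exact_mod_cast hb
  have := Real.sin_pos_of_pos_of_lt_pi (x := Real.pi / b) (by positivity)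
    (by rw [div_lt_iff₀ (by positivity)]; nlinarith [Real.pi_pos])
  linarith

theorem two_sin_le_two : 2 * Real.sin (Real.pi / b) ≤ 2 := by
  linarith [Real.sin_le_one (Real.pi / b)]

/-- The right side is `2 sin(π v / b)` with `1 ≤ v ≤ b - 1`, and the sine is smallest at the ends of
this range. -/
theorem two_sin_le_norm_one_sub [NeZero b] {x : ZMod b} (hx : x ≠ 0) :
    2 * Real.sin (Real.pi / b) ≤ ‖1 - (ZMod.stdAddChar x : ℂ)‖ := by
  have hb : (0 : ℝ) < b := by exact_mod_cast Nat.pos_of_ne_zero (NeZero.ne b)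
  have hv : x.val ≠ 0 := by rwa [Ne, ZMod.val_eq_zero]
  have hv1 : (1 : ℝ) ≤ x.val := by exact_mod_cast Nat.one_le_iff_ne_zero.2 hv
  have hv2 : (x.val : ℝ) ≤ b - 1 := by
    have := ZMod.val_lt x
    have : (x.val : ℝ) + 1 ≤ b := by exact_mod_cast this
    linarith
  have e : (ZMod.stdAddChar x : ℂ) = Complex.exp (Complex.I * (2 * Real.pi * x.val / b : ℝ)) := by
    rw [ZMod.stdAddChar_apply, ZMod.toCircle_apply]
    congr 1
    push_cast
    ring
  rw [norm_sub_rev, e, Complex.norm_exp_I_mul_ofReal_sub_one, Real.norm_eq_abs]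
  refine le_trans ?_ (le_abs_self _)
  have e2 : 2 * Real.pi * x.val / b / 2 = Real.pi * x.val / b := by ring
  rw [e2]
  gcongr
  have hpi := Real.pi_pos
  rcases le_total (Real.pi * x.val / b) (Real.pi / 2) with h | h
  · refine Real.sin_le_sin_of_le_of_le_pi_div_two ?_ h ?_
    · have : 0 < Real.pi / b := by positivity
      linarith
    · gcongr
      nlinarith
  · rw [← Real.sin_pi_sub (Real.pi * x.val / b)]
    refine Real.sin_le_sin_of_le_of_le_pi_div_two ?_ ?_ ?_
    · have : 0 < Real.pi / b := by positivity
      linarith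
    · linarith
    · rw [div_le_iff₀ hb, sub_mul, div_mul_cancel₀ _ hb.ne']
      nlinarith

theorem stdAddChar_mul_natCast [NeZero b] (x : ZMod b) (c : ℕ) :
    (ZMod.stdAddChar (x * (c : ZMod b)) : ℂ) = ZMod.stdAddChar x ^ c := by
  rw [← AddChar.map_nsmul_eq_pow, nsmul_eq_mul, mul_comm]

/-- `mu` in terms of the leading digit. -/
theorem mu_succ_of_digit {A k a : ℕ} (hb : 2 ≤ b) (h1 : b ^ A ≤ k) (h2 : k < b ^ (A + 1)) :
    mu b (a + 1) k = A + 1 + mu b a (k % b ^ A) := by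
  have hlog : Nat.log b k = A := Nat.log_eq_of_pow_le_of_lt_pow h1 h2
  have hk : k ≠ 0 := by
    have : 0 < b ^ A := by positivity
    omega
  rw [mu, if_neg hk, hlog]

theorem mu_zero_right (a : ℕ) : mu b a 0 = 0 := by cases a <;> simp [mu]

variable [NeZero b]

/-- The primitive of a profile modulated by a nontrivial character of the leading digit. -/
theorem primitive_cellFn_char {x : ZMod b} (hx : x ≠ 0) {w : ℝ → ℂ}
    (hw : IntervalIntegrable w volume 0 1) {y : ℝ} (hy : 0 ≤ y) :
    ∫ t in (0 : ℝ)..y, cellFn b (fun c => ZMod.stdAddChar (x * (c : ZMod b))) w t =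
      (b : ℂ)⁻¹ * ((∫ t in (0 : ℝ)..1, w t) / (1 - ZMod.stdAddChar x)) +
      cellFn b (fun c => ZMod.stdAddChar (x * (c : ZMod b)))
        (fun t => (b : ℂ)⁻¹ * ((∫ z in (0 : ℝ)..t, w z) -
          (∫ t in (0 : ℝ)..1, w t) / (1 - ZMod.stdAddChar x))) y := by
  have hb : 0 < b := Nat.pos_of_ne_zero (NeZero.ne b)
  have hne : (1 - ZMod.stdAddChar x : ℂ) ≠ 0 := by
    rw [sub_ne_zero]
    intro h
    exact hx (ZMod.injective_stdAddChar (by rw [← h, AddChar.map_zero_eq_one]))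
  rw [(cellFn_integral hb _ hw hy).2]
  simp only [cellFn, stdAddChar_mul_natCast]
  -- The completed cells form a geometric sum. Its power of the character is constant on the current
  -- cell and goes into the new profile; the constant part stays outside.
  have hg : ∑ c ∈ Finset.range ⌊(b : ℝ) * y⌋₊, (ZMod.stdAddChar x : ℂ) ^ c =
      (1 - ZMod.stdAddChar x ^ ⌊(b : ℝ) * y⌋₊) / (1 - ZMod.stdAddChar x) := by
    rw [eq_div_iff hne, geom_sum_mul_neg]
  rw [hg]
  ring

theorem sum_half_pow (a : ℕ) :
    ∑ t ∈ Finset.range a, ((1 : ℝ) / 2) ^ (t + 1) + (1 / 2) ^ a = 1 := by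
  induction a with
  | zero => simp
  | succ a ih => rw [Finset.sum_range_succ]; linarith [pow_succ ((1 : ℝ) / 2) a]

theorem norm_integral_mul_le {u : ℝ → ℝ} {G : ℝ → ℂ} {c d : ℝ}
    (hu : ∀ y ∈ Set.Icc (0 : ℝ) 1, |u y| ≤ c) (hG : ∀ y, ‖G y‖ ≤ d) :
    ‖∫ y in (0 : ℝ)..1, (u y : ℂ) * G y‖ ≤ c * d := by
  have h := intervalIntegral.norm_integral_le_of_norm_le_const (a := (0 : ℝ)) (b := 1)
    (f := fun y => (u y : ℂ) * G y) (C := c * d) ?_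
  · simpa using h
  · intro y hy
    rw [Set.uIoc_of_le zero_le_one] at hy
    have h1 := hu y ⟨hy.1.le, hy.2⟩
    rw [norm_mul, Complex.norm_real, Real.norm_eq_abs]
    exact mul_le_mul h1 (hG y) (norm_nonneg _) ((abs_nonneg _).trans h1)

theorem bernConv_zero (G : ℝ → ℂ) (x : ℝ) : bernConv 0 G x = ∫ y in (0 : ℝ)..1, G y := by
  simp [bernConv, bernTilde]

/-- Induction over the digits of `k` from the top, for an arbitrary profile with sup bound `w0` and
mean bound `m0`. A zero digit is absorbed into the profile without changing either bound. A nonzero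
digit makes the profile mean-free, so the primitive is a cell function for the remaining digits,
smaller by `b^{-(A+1)}`; one integration by parts lowers every Bernoulli order by one and passes to
it. Up to that factor, `(w0, m0)` becomes `(w0 + 2 m0 r, m0 r)` with `r = 1 / (2 sin(π / b))`, and
iteration produces the geometric sum. All orders are bounded jointly because the sum over kernels is
needed later. -/
theorem walsh_bound_aux (hb : 2 ≤ b) (A : ℕ) {k : ℕ} (hk0 : 0 < k) (hk : k < b ^ A) {w : ℝ → ℂ}
    {m0 w0 : ℝ} (hw : IntervalIntegrable w volume 0 1)
    (hw0 : ∀ t ∈ Set.Ico (0 : ℝ) 1, ‖w t‖ ≤ w0) (hm0 : ‖∫ t in (0 : ℝ)..1, w t‖ ≤ m0)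
    (a : ℕ) {x : ℝ} (hx : x ∈ Set.Ico (0 : ℝ) 1) :
    ∑ t ∈ Finset.range (a + 1),
        ‖∫ y in (0 : ℝ)..1, (bernNorm (t + 1) y : ℂ) * cellFn (b ^ A) (walE b A k) w y‖ +
      ‖bernConv (a + 1) (cellFn (b ^ A) (walE b A k) w) x‖ ≤
      (w0 + 2 * m0 * ∑ j ∈ Finset.range (a + 1), (2 * Real.sin (Real.pi / b))⁻¹ ^ (j + 1)) /
        (b : ℝ) ^ mu b (a + 1) k := by
  have hbpos : 0 < b := by omega
  have hbR : (0 : ℝ) < b := by exact_mod_cast hbpos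
  induction A generalizing k w m0 w0 a with
  | zero => simp at hk; omega
  | succ A ih =>
    set r : ℝ := (2 * Real.sin (Real.pi / b))⁻¹ with hr
    have hs := two_sin_pos hb
    have hr0 : 0 < r := inv_pos.2 hs
    have hr1 : 1 ≤ 2 * r := by
      rw [hr, ← div_eq_mul_inv, le_div_iff₀ hs, one_mul]
      exact two_sin_le_two
    have hm : 0 ≤ m0 := (norm_nonneg _).trans hm0
    have hAb : 0 < b ^ A := by positivity
    have hA1 : 0 < b ^ (A + 1) := by positivity
    set d : ZMod b := ((k / b ^ A : ℕ) : ZMod b) with hd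
    set v : ℝ → ℂ := cellFn b (fun c => ZMod.stdAddChar (d * (c : ZMod b))) w with hv
    have hvint : IntervalIntegrable v volume 0 1 := cellFn_intervalIntegrable hbpos _ hw
    have hvn : ∀ y, ‖v y‖ ≤ w0 := norm_cellFn_le (fun i => (norm_stdAddChar _).le) hw0
    set G := cellFn (b ^ (A + 1)) (walE b (A + 1) k) w with hG
    have hGv : ∀ y, 0 ≤ y → G y = cellFn (b ^ A) (walE b A k) v y := fun y hy =>
      cellFn_walE_succ A k w hy
    have hGint : IntervalIntegrable G volume 0 1 := cellFn_intervalIntegrable hA1 _ hw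
    by_cases hd0 : d = 0
    · have hk' : k < b ^ A := (natCast_div_eq_zero_iff hk).1 hd0
      have hm' : ‖∫ t in (0 : ℝ)..1, v t‖ ≤ m0 := by
        rw [hv, cellFn_integral_one hbpos _ hw, hd0]
        simp [hbR.ne']
        exact hm0
      have h := ih hk0 hk' hvint (fun t _ => hvn t) hm' a
      convert! h using 2
      · refine Finset.sum_congr rfl fun t _ => ?_
        congr 1
        refine intervalIntegral.integral_congr fun y hy => ?_
        rw [Set.uIcc_of_le zero_le_one] at hy
        rw [hGv y hy.1]
      · congr 1
        refine intervalIntegral.integral_congr fun y hy => ?_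
        rw [Set.uIcc_of_le zero_le_one] at hy
        rw [hGv y hy.1]
    have hk' : b ^ A ≤ k := by
      by_contra! h
      exact hd0 ((natCast_div_eq_zero_iff hk).2 h)
    set k' := k % b ^ A with hk'd
    have hk'lt : k' < b ^ A := Nat.mod_lt _ hAb
    -- the primitive of the profile
    set M := ∫ t in (0 : ℝ)..1, w t with hMdef
    set χ : ℂ := ZMod.stdAddChar d with hχ
    have hχn : ‖χ‖ = 1 := norm_stdAddChar d
    have hq : ‖M / (1 - χ)‖ ≤ m0 * r := by
      rw [norm_div, hr, ← div_eq_mul_inv]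
      exact div_le_div₀ hm hm0 hs (two_sin_le_norm_one_sub hd0)
    set p : ℝ → ℂ := fun t => (b : ℂ)⁻¹ * ((∫ z in (0 : ℝ)..t, w z) - M / (1 - χ)) with hp
    set V : ℝ → ℂ := fun t => (b : ℂ)⁻¹ * (M / (1 - χ)) +
      cellFn b (fun c => ZMod.stdAddChar (d * (c : ZMod b))) p t with hV
    have hVprim : ∀ y, 0 ≤ y → ∫ t in (0 : ℝ)..y, v t = V y := fun y hy =>
      primitive_cellFn_char hd0 hw hy
    have hpint : IntervalIntegrable p volume 0 1 := by
      have : ContinuousOn p (Set.uIcc 0 1) := by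
        have := intervalIntegral.continuousOn_primitive_interval' (a := 0) hw (by simp)
        exact continuousOn_const.mul (this.sub continuousOn_const)
      exact this.intervalIntegrable
    have hbn : ‖(b : ℂ)⁻¹‖ = (b : ℝ)⁻¹ := by simp
    have hpn : ∀ t ∈ Set.Ico (0 : ℝ) 1, ‖p t‖ ≤ (b : ℝ)⁻¹ * (w0 + m0 * r) := by
      intro t ht
      rw [hp, norm_mul, hbn]
      gcongr
      refine (norm_sub_le _ _).trans (add_le_add ?_ hq)
      have h := intervalIntegral.norm_integral_le_of_norm_le_const (a := (0 : ℝ)) (b := t)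
        (f := w) (C := w0) ?_
      · refine h.trans ?_
        rw [sub_zero, abs_of_nonneg ht.1]
        have : 0 ≤ w0 := (norm_nonneg _).trans (hw0 t ht)
        nlinarith [ht.2]
      · intro z hz
        rw [Set.uIoc_of_le ht.1] at hz
        exact hw0 z ⟨hz.1.le, hz.2.trans_lt ht.2⟩
    have hcp : ∀ y, ‖cellFn b (fun c => ZMod.stdAddChar (d * (c : ZMod b))) p y‖ ≤
        (b : ℝ)⁻¹ * (w0 + m0 * r) := norm_cellFn_le (fun i => (norm_stdAddChar _).le) hpn
    have hVn : ∀ y, ‖V y‖ ≤ (b : ℝ)⁻¹ * (w0 + 2 * m0 * r) := by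
      intro y
      refine (norm_add_le _ _).trans ?_
      rw [norm_mul, hbn]
      have h1 := hcp y
      have h2 : (b : ℝ)⁻¹ * ‖M / (1 - χ)‖ ≤ (b : ℝ)⁻¹ * (m0 * r) := by gcongr
      linarith
    have hcint : IntervalIntegrable
        (cellFn b (fun c => ZMod.stdAddChar (d * (c : ZMod b))) p) volume 0 1 :=
      cellFn_intervalIntegrable hbpos _ hpint
    have hVint : IntervalIntegrable V volume 0 1 := intervalIntegrable_const.add hcint
    have hVmean : ∫ t in (0 : ℝ)..1, V t = (b : ℂ)⁻¹ * (M / (1 - χ)) := by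
      rw [hV, intervalIntegral.integral_add intervalIntegrable_const hcint,
        cellFn_integral_one hbpos _ hpint, sum_range_stdAddChar, if_neg hd0]
      simp
    -- A nontrivial character sums to zero over one block of `b` cells.
    have hV1 : V 1 = 0 := by
      rw [← hVprim 1 zero_le_one, hv, cellFn_integral_one hbpos _ hw, sum_range_stdAddChar,
        if_neg hd0]
      simp
    -- the primitive of `G`
    set c : ℂ := ((b ^ A : ℕ) : ℂ)⁻¹ with hc
    have hcn : ‖c‖ = ((b : ℝ) ^ A)⁻¹ := by simp [hc]
    set W : ℝ → ℂ := fun t => c * V t with hW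
    set H := cellFn (b ^ A) (walE b A k') W with hH
    have hHprim : ∀ y ∈ Set.Icc (0 : ℝ) 1, H y = ∫ z in (0 : ℝ)..y, G z := by
      intro y hy
      have : ∫ z in (0 : ℝ)..y, G z = ∫ z in (0 : ℝ)..y, cellFn (b ^ A) (walE b A k) v z := by
        refine intervalIntegral.integral_congr fun z hz => ?_
        rw [Set.uIcc_of_le hy.1] at hz
        exact hGv z hz.1
      rw [this, (cellFn_integral hAb _ hvint hy.1).2, hVprim 1 zero_le_one, hV1,
        hVprim _ (Int.fract_nonneg _), mul_zero, zero_add, hH, cellFn, hk'd, walE_mod]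
      ring
    have hH1 : H 1 = 0 := by
      rw [hH, cellFn, mul_one, Int.fract_natCast]
      have : V 0 = 0 := by rw [← hVprim 0 le_rfl]; simp
      simp [hW, this]
    have hWint : IntervalIntegrable W volume 0 1 := hVint.const_mul c
    -- The cell length gives `b^{-A}` and `V` gives `b^{-1}`; together they are the contribution of
    -- the leading digit to `b^{-μ}`.
    set B : ℝ := (b : ℝ) ^ (A + 1) with hB
    have hBpos : 0 < B := by positivity
    have hBe : ((b : ℝ) ^ A)⁻¹ * (b : ℝ)⁻¹ = B⁻¹ := by rw [hB, pow_succ, mul_inv]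
    have hWn : ∀ y, ‖W y‖ ≤ B⁻¹ * (w0 + 2 * m0 * r) := by
      intro y
      rw [hW, norm_mul, hcn, ← hBe, mul_assoc]
      gcongr
      exact hVn y
    have hWmean : ‖∫ t in (0 : ℝ)..1, W t‖ ≤ B⁻¹ * (m0 * r) := by
      rw [hW, intervalIntegral.integral_const_mul, hVmean, norm_mul, norm_mul, hcn, hbn, ← mul_assoc,
        hBe]
      gcongr
    have hHn : ∀ y, ‖H y‖ ≤ B⁻¹ * (w0 + 2 * m0 * r) :=
      norm_cellFn_le (fun i => (norm_walE _ _ _).le) (fun t _ => hWn t)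
    have hX : ∀ t, ‖∫ y in (0 : ℝ)..1, (bernNorm (t + 1) y : ℂ) * G y‖ =
        ‖∫ y in (0 : ℝ)..1, (bernNorm t y : ℂ) * H y‖ := by
      intro t
      rw [integral_bernNorm_succ_mul hGint hHprim hH1, norm_neg]
    simp only [hX]
    rw [bernConv_succ hGint hHprim hx, hH1, mul_zero, add_zero, mu_succ_of_digit hb hk' hk, pow_add, ← hB,
      ← hk'd, div_mul_eq_div_div]
    have hgoal : ∀ {X : ℝ} {K : ℕ}, X ≤ B⁻¹ * (w0 + 2 * m0 *
        ∑ j ∈ Finset.range (a + 1), r ^ (j + 1)) / (b : ℝ) ^ K →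
        X ≤ (w0 + 2 * m0 * ∑ j ∈ Finset.range (a + 1), r ^ (j + 1)) / B / (b : ℝ) ^ K := by
      intro X K h
      rwa [div_eq_inv_mul _ B]
    apply hgoal
    rw [Finset.sum_range_succ' _ a]
    simp only [bernNorm_zero, Complex.ofReal_one, one_mul]
    -- With no digit left, `H` does not oscillate: its mean need not vanish, and the bound `|b_t| ≤
    -- 2^{-t}` has to suffice.
    rcases Nat.eq_zero_or_pos k' with hk'0 | hk'0
    · rw [hk'0, mu_zero_right, pow_zero, div_one]
      have hHW : ∀ y, H y = cellFn (b ^ A) (fun _ => 1) W y := by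
        intro y
        rw [hH, hk'0, cellFn, cellFn, walE_zero_right]
      have hHint : ∫ y in (0 : ℝ)..1, H y = ∫ t in (0 : ℝ)..1, W t := by
        simp only [hHW]
        rw [cellFn_integral_one hAb _ hWint]
        have hbC : (b : ℂ) ≠ 0 := by exact_mod_cast hbpos.ne'
        simp [hbC]
      rw [hHint]
      rcases Nat.eq_zero_or_pos a with rfl | ha
      -- Here the convolution is the mean minus `H x`. The mean cancels the constant part of `V`,
      -- which saves the `m0 r` needed for the remaining summand.
      · rw [if_pos rfl, bernConv_zero, hHint]
        simp only [Finset.range_zero, Finset.sum_empty, zero_add, Finset.sum_range_one, pow_one]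
        have h2 : ‖(∫ t in (0 : ℝ)..1, W t) - H x‖ ≤ B⁻¹ * (w0 + m0 * r) := by
          rw [hHW, cellFn, one_mul, hW, intervalIntegral.integral_const_mul, hVmean]
          simp only [hV]
          rw [← mul_sub, sub_add_cancel_left, norm_mul, norm_neg, hcn, ← hBe, mul_assoc]
          gcongr
          exact hcp _
        linarith
      · rw [if_neg ha.ne', sub_zero]
        have hU : ‖bernConv a H x‖ ≤ (1 / 2) ^ a * (B⁻¹ * (w0 + 2 * m0 * r)) :=
          norm_integral_mul_le (fun y _ => abs_bernTilde_le a _) hHn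
        have hS : ∑ t ∈ Finset.range a, ‖∫ y in (0 : ℝ)..1, (bernNorm (t + 1) y : ℂ) * H y‖ ≤
            ∑ t ∈ Finset.range a, (1 / 2) ^ (t + 1) * (B⁻¹ * (w0 + 2 * m0 * r)) :=
          Finset.sum_le_sum fun t _ =>
            norm_integral_mul_le (fun y hy => abs_bernNorm_le (t + 1) hy) hHn
        rw [← Finset.sum_mul] at hS
        have h1 := sum_half_pow a
        have h2 : r + r ^ 2 ≤ ∑ j ∈ Finset.range (a + 1), r ^ (j + 1) := by
          have : ∑ j ∈ Finset.range 2, r ^ (j + 1) ≤ ∑ j ∈ Finset.range (a + 1), r ^ (j + 1) :=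
            Finset.sum_le_sum_of_subset_of_nonneg (Finset.range_mono (by omega))
              (fun _ _ _ => by positivity)
          simpa [Finset.sum_range_succ] using this
        have h3 : B⁻¹ * (w0 + 2 * m0 * (r + r ^ 2)) ≤
            B⁻¹ * (w0 + 2 * m0 * ∑ j ∈ Finset.range (a + 1), r ^ (j + 1)) := by gcongr
        refine le_trans ?_ h3
        -- The mean term is paid for by the `r ^ 2` term of the geometric sum, since `2 r ≥ 1`.
        have h4 : B⁻¹ * (m0 * r) ≤ B⁻¹ * (2 * m0 * r ^ 2) := by
          gcongr ?_ * ?_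
          nlinarith [mul_nonneg hm hr0.le]
        have h5 : (∑ t ∈ Finset.range a, ((1 : ℝ) / 2) ^ (t + 1)) * (B⁻¹ * (w0 + 2 * m0 * r)) +
            (1 / 2) ^ a * (B⁻¹ * (w0 + 2 * m0 * r)) = B⁻¹ * (w0 + 2 * m0 * r) := by
          rw [← add_mul, h1, one_mul]
        linarith
    -- Digits remain, so the summand of order zero vanishes, and the rest is the same quantity with
    -- `a` lowered by one.
    · have hz : ∫ y in (0 : ℝ)..1, H y = 0 := by
        rw [hH, cellFn_integral_one hAb _ hWint, sum_walE_eq_zero hk'0 hk'lt]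
        simp
      rw [hz, norm_zero, add_zero]
      rcases Nat.eq_zero_or_pos a with rfl | ha
      · rw [if_pos rfl, bernConv_zero, hz]
        have h := hHn x
        simpa [mu] using h
      · rw [if_neg ha.ne', sub_zero]
        obtain ⟨a, rfl⟩ : ∃ a', a = a' + 1 := ⟨a - 1, by omega⟩
        have h := ih hk'0 hk'lt hWint (fun t _ => hWn t) hWmean a
        refine h.trans (le_of_eq ?_)
        congr 1
        rw [Finset.sum_range_succ' _ (a + 1)]
        have : ∀ j, r ^ (j + 1 + 1) = r * r ^ (j + 1) := fun j => by ring
        simp only [this, ← Finset.mul_sum]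
        ring

end walshBounds

end ExtrapolatedLattice

namespace ExtrapolatedLattice

/-! ### Comparison with the constant `C_α` -/

/-- Passing from `n` to `n + 1` multiplies the right side by `c r`; by `h` the increase covers the
new summand. -/
theorem one_add_geom_le_of_one_le {r c K : ℝ} (hr : 1 ≤ r) (hc : 1 ≤ c) (hK : 5 ≤ K)
    (h : r ≤ (c * r - 1) * K) (n : ℕ) :
    1 + 2 * ∑ j ∈ Finset.range (n + 2), r ^ (j + 1) ≤ 2 * r ^ (n + 2) * c ^ n * K := by
  induction n with
  | zero =>
    simp only [Finset.sum_range_succ, Finset.sum_range_zero]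
    have h1 : r ^ 2 * 5 ≤ r ^ 2 * K := by gcongr
    norm_num
    nlinarith
  | succ n ih =>
    rw [Finset.sum_range_succ]
    have h1 : (1 : ℝ) ≤ c ^ n := one_le_pow₀ hc
    have h2 : 0 < r ^ (n + 2) := by positivity
    have h3 : 2 * r ^ (n + 2) * c ^ n * r ≤ 2 * r ^ (n + 2) * c ^ n * ((c * r - 1) * K) := by
      gcongr
    have h4 : 2 * r ^ (n + 2) * r ≤ 2 * r ^ (n + 2) * c ^ n * r := by
      have : 0 ≤ 2 * r ^ (n + 2) * r := by positivity
      nlinarith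
    have e1 : 2 * r ^ (n + 1 + 2) * c ^ (n + 1) * K =
        2 * r ^ (n + 2) * c ^ n * K + 2 * r ^ (n + 2) * c ^ n * ((c * r - 1) * K) := by ring
    have e2 : r ^ (n + 2 + 1) = r ^ (n + 2) * r := by ring
    rw [e1, e2]
    linarith

theorem one_add_geom_le_of_le {r c K : ℝ} (hr0 : 1 / 2 ≤ r) (hr1 : r ≤ 0.855) (hc : 1.233 ≤ c)
    (hK : 6.15 ≤ K) (n : ℕ) :
    1 + 2 * ∑ j ∈ Finset.range (n + 2), r ^ (j + 1) ≤ r * c ^ n * K := by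
  -- The subtracted `r ^ (n + 2)` strengthens the claim: the increment to be covered becomes `r ^ (n
  -- + 3) * (1 + r)` instead of `2 * r ^ (n + 3)`, which is small enough for these constants.
  have key : 1 + 2 * ∑ j ∈ Finset.range (n + 2), r ^ (j + 1) ≤
      r * (6.15 * c ^ n - r ^ (n + 2)) := by
    induction n with
    | zero =>
      simp only [Finset.sum_range_succ, Finset.sum_range_zero]
      nlinarith [mul_nonneg (sub_nonneg.2 hr0) (sub_nonneg.2 hr1),
        mul_nonneg (mul_nonneg (sub_nonneg.2 hr0) (sub_nonneg.2 hr1)) (by linarith : 0 ≤ r)]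
    | succ n ih =>
      rw [Finset.sum_range_succ]
      have h1 : (1 : ℝ) ≤ c ^ n := one_le_pow₀ (by linarith)
      have h2 : r ^ n ≤ 1 := pow_le_one₀ (by linarith) (by linarith)
      have h0 : 0 ≤ r ^ n := by positivity
      have h3 : r ^ 2 * (1 + r) ≤ 1.4 := by nlinarith
      have h4 : r ^ n * (r ^ 2 * (1 + r)) ≤ 1.4 := by nlinarith [sq_nonneg r]
      have h5 : 1.4 ≤ 6.15 * c ^ n * (c - 1) := by nlinarith
      have h6 : r * (r ^ n * (r ^ 2 * (1 + r))) ≤ r * (6.15 * c ^ n * (c - 1)) :=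
        mul_le_mul_of_nonneg_left (h4.trans h5) (by linarith)
      have e1 : r * (6.15 * c ^ (n + 1) - r ^ (n + 1 + 2)) =
          r * (6.15 * c ^ n - r ^ (n + 2)) + r * (6.15 * c ^ n * (c - 1)) +
            r * (r ^ n * r ^ 2) - r * (r ^ n * r ^ 3) := by ring
      have e2 : r ^ (n + 2 + 1) = r * (r ^ n * r ^ 2) := by ring
      rw [e1, e2]
      nlinarith
  refine key.trans ?_
  have h0 : 0 ≤ r * r ^ (n + 2) := by positivity
  have h1 : 0 ≤ r * c ^ n := by positivity
  nlinarith

/-- Two regimes for `r = 1 / (2 sin(π / b))`. For `b ≤ 5` one has `r ≤ 0.855`, and the entry `z = 1`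
of the maximum suffices. For `b ≥ 7` one has `r ≥ 1`, and the entry `2 r^α` is used. -/
theorem one_add_geom_le_walshConst {b : ℕ} (hb : b.Prime) {α : ℕ} (hα : 2 ≤ α) :
    1 + 2 * ∑ j ∈ Finset.range α, (2 * Real.sin (Real.pi / b))⁻¹ ^ (j + 1) ≤ walshConst b α := by
  obtain ⟨n, rfl⟩ : ∃ n, α = n + 2 := ⟨α - 2, by omega⟩
  have hb2 := hb.two_le
  have hbR : (2 : ℝ) ≤ b := by exact_mod_cast hb2
  set s := 2 * Real.sin (Real.pi / b) with hs
  have hs0 : 0 < s := two_sin_pos hb2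
  set c : ℝ := 1 + 1 / (b : ℝ) + 1 / ((b : ℝ) * (b + 1)) with hc
  set K : ℝ := 3 + 2 / (b : ℝ) + (2 * (b : ℝ) + 1) / ((b : ℝ) - 1) with hK
  have hc0 : 0 < c := by positivity
  have hK5 : 5 ≤ K := by
    have h1 : (2 : ℝ) ≤ (2 * (b : ℝ) + 1) / ((b : ℝ) - 1) := by
      rw [le_div_iff₀ (by linarith)]; linarith
    have h2 : 0 < 2 / (b : ℝ) := by positivity
    linarith
  have hmax1 : 2 * s⁻¹ ^ (n + 2) ≤ max (2 / s ^ (n + 2))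
      (⨆ z : {z // z ∈ Finset.Icc 1 (n + 2 - 1)}, 1 / s ^ (z : ℕ)) := by
    refine le_trans (le_of_eq ?_) (le_max_left _ _)
    rw [inv_pow, div_eq_mul_inv]
  have hmax2 : s⁻¹ ≤ max (2 / s ^ (n + 2))
      (⨆ z : {z // z ∈ Finset.Icc 1 (n + 2 - 1)}, 1 / s ^ (z : ℕ)) := by
    refine le_trans ?_ (le_max_right _ _)
    have := le_ciSup (f := fun z : {z // z ∈ Finset.Icc 1 (n + 2 - 1)} => 1 / s ^ (z : ℕ))
      (Set.finite_range _).bddAbove ⟨1, by simp⟩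
    simpa using this
  have hwc : walshConst b (n + 2) = max (2 / s ^ (n + 2))
      (⨆ z : {z // z ∈ Finset.Icc 1 (n + 2 - 1)}, 1 / s ^ (z : ℕ)) * c ^ n * K := by
    rw [walshConst]
    rfl
  rw [hwc]
  rcases lt_or_ge b 7 with h7 | h7
  · have hb3 : b = 2 ∨ b = 3 ∨ b = 5 := by
      interval_cases b <;> simp_all +decide
    have hs17 : 1.17 ≤ s := by
      rcases hb3 with rfl | rfl | rfl
      · have : s = 2 := by
          rw [hs]; push_cast; rw [Real.sin_pi_div_two]; norm_num
        rw [this]; norm_num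
      · have : s = √3 := by
          rw [hs]; push_cast; rw [Real.sin_pi_div_three]; ring
        rw [this]
        exact Real.le_sqrt_of_sq_le (by norm_num)
      · have h1 : s ^ 2 = (5 - √5) / 2 := by
          rw [hs, mul_pow, Real.sin_sq]
          push_cast
          rw [Real.cos_pi_div_five]
          have := Real.sq_sqrt (show (0 : ℝ) ≤ 5 by norm_num)
          ring_nf
          rw [this]
          ring
        have h2 : √5 ≤ 2.26 := Real.sqrt_le_iff.2 ⟨by norm_num, by norm_num⟩
        nlinarith
    have hr1 : s⁻¹ ≤ 0.855 := by
      rw [inv_le_comm₀ hs0 (by norm_num)]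
      exact le_trans (by norm_num) hs17
    have hr0 : 1 / 2 ≤ s⁻¹ := by
      rw [one_div]
      exact inv_anti₀ hs0 two_sin_le_two
    have hcK : 1.233 ≤ c ∧ 6.15 ≤ K := by
      rcases hb3 with rfl | rfl | rfl <;> rw [hc, hK] <;> norm_num
    refine (one_add_geom_le_of_le hr0 hr1 hcK.1 hcK.2 n).trans ?_
    gcongr
  · have h7R : (7 : ℝ) ≤ b := by exact_mod_cast h7
    have hsb : s ≤ 2 * Real.pi / b := by
      have := Real.sin_le (show 0 ≤ Real.pi / b by positivity)
      rw [hs, mul_div_assoc]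
      linarith
    have hpi := Real.pi_lt_d2
    have hsb' : s * b ≤ 6.3 := by
      rw [le_div_iff₀ (by linarith)] at hsb
      linarith
    have hs1 : s ≤ 1 := by nlinarith
    have hc1 : 1 + 1 / (b : ℝ) ≤ c := by
      rw [hc]
      have : 0 < 1 / ((b : ℝ) * (b + 1)) := by positivity
      linarith
    have hcs : 1 / 5 ≤ c - s := by
      have : s ≤ 6.3 / b := by rw [le_div_iff₀ (by linarith)]; exact hsb'
      have h1 : 1 / 5 ≤ 1 + 1 / (b : ℝ) - 6.3 / b := by
        have : (1 : ℝ) + 1 / (b : ℝ) - 6.3 / b = 1 - 5.3 / b := by ring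
        rw [this]
        have : 5.3 / (b : ℝ) ≤ 5.3 / 7 := by gcongr
        linarith [show (5.3 : ℝ) / 7 ≤ 4 / 5 by norm_num]
      linarith
    have hr1 : 1 ≤ s⁻¹ := (one_le_inv₀ hs0).2 hs1
    refine (one_add_geom_le_of_one_le hr1 (c := c) ?_ hK5 ?_ n).trans ?_
    · have : 0 < 1 / (b : ℝ) := by positivity
      linarith
    · have e : (c * s⁻¹ - 1) * K = s⁻¹ * ((c - s) * K) := by
        field_simp
      rw [e]
      have : 1 ≤ (c - s) * K := by nlinarith
      nlinarith
    · gcongr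

end ExtrapolatedLattice

namespace ExtrapolatedLattice

/-! ### Walsh coefficients and their discrete counterparts -/

section discrete

variable {b : ℕ} [NeZero b]

/-- The `k`-th Walsh function on `[0, ∞)`. -/
noncomputable def walFn (b : ℕ) [NeZero b] (k : ℕ) (y : ℝ) : ℂ :=
  cellFn (b ^ k) (walE b k k) (fun _ => 1) y

/-- The `k`-th Walsh coefficient of a function on `[0, 1]`. -/
noncomputable def walCoef (b : ℕ) [NeZero b] (k : ℕ) (φ : ℝ → ℝ) : ℂ :=
  ∫ y in (0 : ℝ)..1, (φ y : ℂ) * walFn b k y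

theorem cellFn_walE_add {A k : ℕ} (hk : k < b ^ A) (M : ℕ) {y : ℝ} (hy : 0 ≤ y) :
    cellFn (b ^ (A + M)) (walE b (A + M) k) (fun _ => 1) y =
      cellFn (b ^ A) (walE b A k) (fun _ => 1) y := by
  induction M with
  | zero => rfl
  | succ M ih =>
    rw [← ih, ← add_assoc, cellFn_walE_succ _ _ _ hy]
    have hlt : k < b ^ (A + M) :=
      hk.trans_le (Nat.pow_le_pow_right (Nat.pos_of_ne_zero (NeZero.ne b)) (by omega))
    simp [cellFn, Nat.div_eq_of_lt hlt]

/-- A Walsh function does not depend on the mesh once the mesh resolves all digits of `k`; the `b ^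
k` in `walFn` is merely a mesh that always does. -/
theorem cellFn_walE_eq_walFn (hb : 2 ≤ b) {A k : ℕ} (hk : k < b ^ A) {y : ℝ} (hy : 0 ≤ y) :
    cellFn (b ^ A) (walE b A k) (fun _ => 1) y = walFn b k y := by
  have hk' : k < b ^ k := Nat.lt_pow_self hb
  rw [walFn, ← cellFn_walE_add hk k hy, ← cellFn_walE_add hk' A hy, add_comm]

theorem walCoef_eq (hb : 2 ≤ b) {A k : ℕ} (hk : k < b ^ A) (φ : ℝ → ℝ) :
    walCoef b k φ = ∫ y in (0 : ℝ)..1, (φ y : ℂ) * cellFn (b ^ A) (walE b A k) (fun _ => 1) y := by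
  refine intervalIntegral.integral_congr fun y hy => ?_
  rw [Set.uIcc_of_le zero_le_one] at hy
  rw [cellFn_walE_eq_walFn hb hk hy.1]

/-- The discrete Walsh coefficient on the grid with `b ^ n` points. -/
noncomputable def discCoef (b : ℕ) [NeZero b] (n k : ℕ) (φ : ℝ → ℝ) : ℂ :=
  ((b : ℂ) ^ n)⁻¹ * ∑ i ∈ Finset.range (b ^ n), walE b n k i * (φ ((i : ℝ) / (b : ℝ) ^ n) : ℂ)

/-- Orthogonality in the digits above the `n`-th: summing over them selects the fine cells that
begin at a point of the coarse grid. -/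
theorem sum_walE_add_mul {n k : ℕ} (hk : k < b ^ n) (M i : ℕ) :
    ∑ l ∈ Finset.range (b ^ M), walE b (n + M) (k + b ^ n * l) i =
      if b ^ M ∣ i then (b : ℂ) ^ M * walE b n k (i / b ^ M) else 0 := by
  have hb : 0 < b := Nat.pos_of_ne_zero (NeZero.ne b)
  induction M generalizing i with
  | zero => simp
  | succ M ih =>
    rw [pow_succ', sum_range_mul_eq]
    have h1 : ∀ κ ∈ Finset.range b, ∑ l ∈ Finset.range (b ^ M),
        walE b (n + (M + 1)) (k + b ^ n * (b ^ M * κ + l)) i =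
        (∑ l ∈ Finset.range (b ^ M), walE b (n + M) (k + b ^ n * l) (i / b)) *
          ZMod.stdAddChar ((i : ZMod b) * (κ : ZMod b)) := by
      intro κ _
      rw [Finset.sum_mul]
      refine Finset.sum_congr rfl fun l hl => ?_
      have hl' : k + b ^ n * l < b ^ (n + M) := by
        have : l + 1 ≤ b ^ M := Finset.mem_range.1 hl
        calc k + b ^ n * l < b ^ n * (l + 1) := by rw [mul_add]; omega
          _ ≤ b ^ n * b ^ M := Nat.mul_le_mul_left _ this
          _ = b ^ (n + M) := by rw [pow_add]
      have e : k + b ^ n * (b ^ M * κ + l) = k + b ^ n * l + b ^ (n + M) * κ := by ring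
      rw [← add_assoc, walE, e, walE_add_mul, Nat.add_mul_div_left _ _ (by positivity),
        Nat.div_eq_of_lt hl', zero_add, mul_comm (κ : ZMod b)]
    rw [Finset.sum_congr rfl h1, ← Finset.mul_sum, sum_range_stdAddChar, ih]
    by_cases hbi : b ∣ i
    · obtain ⟨j, rfl⟩ := hbi
      rw [Nat.mul_div_cancel_left _ hb, if_pos (c := ((b * j : ℕ) : ZMod b) = 0) (by simp)]
      simp only [Nat.mul_dvd_mul_iff_left hb, Nat.mul_div_mul_left _ _ hb]
      split_ifs
      · ring
      · simp
    · have h2 : ¬ b * b ^ M ∣ i := fun h => hbi ((Dvd.intro _ rfl).trans h)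
      have h3 : (i : ZMod b) ≠ 0 := by rwa [Ne, ZMod.natCast_eq_zero_iff]
      rw [if_neg h2, if_neg h3, mul_zero]

theorem integral_mul_cellFn_one {N : ℕ} (hN : 0 < N) (lam : ℕ → ℂ) {φ : ℝ → ℝ}
    (hφ : Continuous φ) :
    ∫ y in (0 : ℝ)..1, (φ y : ℂ) * cellFn N lam (fun _ => 1) y =
      ∑ i ∈ Finset.range N, lam i * ∫ y in ((i : ℝ) / N)..(((i : ℝ) + 1) / N), (φ y : ℂ) := by
  have hN' : (0 : ℝ) < N := by exact_mod_cast hN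
  have h1 : ∀ i : ℕ, IntervalIntegrable (fun y => (φ y : ℂ) * cellFn N lam (fun _ => 1) y) volume
      ((i : ℝ) / N) (((i + 1 : ℕ) : ℝ) / N) := by
    intro i
    have := (cellFn_interval hN lam (w := fun _ => 1) intervalIntegrable_const i (t := 1)
      (by simp)).1
    push_cast
    exact this.continuousOn_mul (by fun_prop)
  have h2 := intervalIntegral.sum_integral_adjacent_intervals
    (f := fun y => (φ y : ℂ) * cellFn N lam (fun _ => 1) y) (a := fun i : ℕ => (i : ℝ) / N)
    (n := N) (μ := volume) (fun i _ => h1 i)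
  simp only [Nat.cast_zero, zero_div, div_self hN'.ne'] at h2
  rw [← h2]
  refine Finset.sum_congr rfl fun i _ => ?_
  rw [← intervalIntegral.integral_const_mul]
  push_cast
  refine intervalIntegral.integral_congr_ae ?_
  have : ∀ᵐ y : ℝ, y ≠ ((i : ℝ) + 1) / N := by simp [ae_iff, measure_singleton]
  filter_upwards [this] with y hy1 hy
  rw [Set.uIoc_of_le (by gcongr; linarith)] at hy
  rw [cellFn_of_mem hN _ _ i ⟨hy.1.le, lt_of_le_of_ne hy.2 hy1⟩]
  ring

/-- By this selection, the sum over aliases sees `φ` only on intervals of length `b^{-(n+M)}` to the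
right of the grid points. -/
theorem sum_walCoef_eq (hb : 2 ≤ b) {n k : ℕ} (hk : k < b ^ n) (M : ℕ) {φ : ℝ → ℝ}
    (hφ : Continuous φ) :
    ∑ l ∈ Finset.range (b ^ M), walCoef b (k + b ^ n * l) φ =
      ∑ i ∈ Finset.range (b ^ n), (b : ℂ) ^ M * walE b n k i *
        ∫ y in ((i : ℝ) / (b : ℝ) ^ n)..((i : ℝ) / (b : ℝ) ^ n + ((b : ℝ) ^ (n + M))⁻¹), (φ y : ℂ) := by
  have hbpos : 0 < b := by omega
  have hbR : (0 : ℝ) < b := by exact_mod_cast hbpos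
  have hNpos : 0 < b ^ (n + M) := by positivity
  have h1 : ∀ l ∈ Finset.range (b ^ M), walCoef b (k + b ^ n * l) φ =
      ∑ i ∈ Finset.range (b ^ (n + M)), walE b (n + M) (k + b ^ n * l) i *
        ∫ y in ((i : ℝ) / (b ^ (n + M) : ℕ))..(((i : ℝ) + 1) / (b ^ (n + M) : ℕ)), (φ y : ℂ) := by
    intro l hl
    have hl' : k + b ^ n * l < b ^ (n + M) := by
      have : l + 1 ≤ b ^ M := Finset.mem_range.1 hl
      calc k + b ^ n * l < b ^ n * (l + 1) := by rw [mul_add]; omega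
        _ ≤ b ^ n * b ^ M := Nat.mul_le_mul_left _ this
        _ = b ^ (n + M) := by rw [pow_add]
    rw [walCoef_eq hb hl', integral_mul_cellFn_one hNpos _ hφ]
  rw [Finset.sum_congr rfl h1, Finset.sum_comm]
  simp only [← Finset.sum_mul, sum_walE_add_mul hk]
  rw [pow_add, sum_range_mul_eq]
  refine Finset.sum_congr rfl fun i _ => ?_
  rw [Finset.sum_eq_single 0]
  · rw [add_zero, if_pos (by simp), Nat.mul_div_cancel_left _ (by positivity)]
    congr 2
    · push_cast; field_simp
    · push_cast; field_simp
      ring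
  · intro c hc hc0
    rw [if_neg, zero_mul]
    rw [Nat.dvd_add_right (by simp)]
    exact fun h => hc0 (Nat.eq_zero_of_dvd_of_lt h (Finset.mem_range.1 hc))
  · intro h
    exact absurd (Finset.mem_range.2 (by positivity)) h

theorem tendsto_average {φ : ℝ → ℂ} (hφ : Continuous φ) (x : ℝ) {t : ℕ → ℝ} (ht : ∀ M, t M ≠ 0)
    (ht0 : Filter.Tendsto t Filter.atTop (nhds 0)) :
    Filter.Tendsto (fun M => (t M)⁻¹ • ∫ y in x..(x + t M), φ y) Filter.atTop (nhds (φ x)) := by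
  have h := (hφ.integral_hasStrictDerivAt x x).hasDerivAt.tendsto_slope_zero
  have h2 := h.comp (tendsto_nhdsWithin_iff.2 ⟨ht0, Filter.Eventually.of_forall ht⟩)
  refine h2.congr fun M => ?_
  simp

/-- Averages over shrinking intervals tend to the values at the grid points. Continuity of `φ` is
enough; no summability of its Walsh series is required. -/
theorem tendsto_sum_walCoef (hb : 2 ≤ b) {n k : ℕ} (hk : k < b ^ n) {φ : ℝ → ℝ}
    (hφ : Continuous φ) :
    Filter.Tendsto (fun M => ∑ l ∈ Finset.range (b ^ M), walCoef b (k + b ^ n * l) φ)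
      Filter.atTop (nhds (discCoef b n k φ)) := by
  have hb1 : (1 : ℝ) < b := by exact_mod_cast hb
  have hbC : (b : ℂ) ≠ 0 := by exact_mod_cast (by omega : b ≠ 0)
  simp only [sum_walCoef_eq hb hk _ hφ, discCoef, Finset.mul_sum]
  refine tendsto_finsetSum _ fun i _ => ?_
  have ht0 : Filter.Tendsto (fun M : ℕ => ((b : ℝ) ^ (n + M))⁻¹) Filter.atTop (nhds 0) := by
    have := (tendsto_pow_atTop_atTop_of_one_lt hb1).comp (Filter.tendsto_add_atTop_nat n)
    refine tendsto_inv_atTop_zero.comp (this.congr fun M => ?_)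
    simp [add_comm]
  have h := tendsto_average (φ := fun y => (φ y : ℂ)) (by fun_prop) ((i : ℝ) / (b : ℝ) ^ n)
    (fun M => by positivity) ht0
  have h2 := h.const_mul (((b : ℂ) ^ n)⁻¹ * walE b n k i)
  convert! h2 using 1
  · ext M
    rw [Complex.real_smul, inv_inv]
    generalize intervalIntegral (fun y => (φ y : ℂ)) _ _ volume = J
    push_cast
    rw [pow_add]
    field_simp
  · ring_nf

theorem enorm_discCoef_le (hb : 2 ≤ b) {n k : ℕ} (hk : k < b ^ n) {φ : ℝ → ℝ}
    (hφ : Continuous φ) {ε : ℕ → ℝ≥0∞} (hε : ∀ k, ‖walCoef b k φ‖ₑ ≤ ε k) :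
    ‖discCoef b n k φ‖ₑ ≤ ∑' l, ε (k + b ^ n * l) := by
  refine le_of_tendsto (tendsto_sum_walCoef hb hk hφ).enorm (Filter.Eventually.of_forall fun M => ?_)
  refine (enorm_sum_le _ _).trans ((Finset.sum_le_sum fun l _ => hε _).trans ?_)
  exact ENNReal.sum_le_tsum _

/-- Orthogonality in the index rather than in the cell. It serves the inversion formula on the grid
and, with index and point exchanged, the character sum over a lattice. -/
theorem sum_walE_mul_conj {n : ℕ} {i j : ℕ} (hi : i < b ^ n) (hj : j < b ^ n) :
    ∑ k ∈ Finset.range (b ^ n), walE b n k i * (starRingEnd ℂ) (walE b n k j) =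
      if i = j then (b : ℂ) ^ n else 0 := by
  have hb : 0 < b := Nat.pos_of_ne_zero (NeZero.ne b)
  induction n generalizing i j with
  | zero =>
    simp only [pow_zero, Nat.lt_one_iff] at hi hj
    simp [walE, hi, hj]
  | succ n ih =>
    rw [pow_succ', sum_range_mul_eq]
    have hdiv : ∀ {x : ℕ}, x < b ^ (n + 1) → x / b < b ^ n := fun {x} hx => by
      rw [Nat.div_lt_iff_lt_mul hb]; rwa [pow_succ] at hx
    have h1 : ∀ κ ∈ Finset.range b, ∑ l ∈ Finset.range (b ^ n),
        walE b (n + 1) (b ^ n * κ + l) i * (starRingEnd ℂ) (walE b (n + 1) (b ^ n * κ + l) j) =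
        (if i / b = j / b then (b : ℂ) ^ n else 0) *
          ZMod.stdAddChar (((i : ZMod b) - (j : ZMod b)) * (κ : ZMod b)) := by
      intro κ _
      rw [← ih (hdiv hi) (hdiv hj), Finset.sum_mul]
      refine Finset.sum_congr rfl fun l hl => ?_
      have e : b ^ n * κ + l = l + b ^ n * κ := add_comm _ _
      rw [walE, walE, e, walE_add_mul, walE_add_mul, Nat.add_mul_div_left _ _ (by positivity),
        Nat.div_eq_of_lt (Finset.mem_range.1 hl), zero_add, map_mul (starRingEnd ℂ),
        ← AddChar.map_neg_eq_conj, sub_mul, sub_eq_add_neg, AddChar.map_add_eq_mul,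
        mul_comm (i : ZMod b), mul_comm (j : ZMod b)]
      ring
    rw [Finset.sum_congr rfl h1, ← Finset.mul_sum, sum_range_stdAddChar]
    by_cases hij : i = j
    · subst hij
      simp
      ring
    · rw [if_neg hij]
      by_cases hd : i / b = j / b
      · rw [if_neg (c := (i : ZMod b) - (j : ZMod b) = 0), mul_zero]
        intro h
        rw [sub_eq_zero, ZMod.natCast_eq_natCast_iff'] at h
        exact hij (by rw [← Nat.div_add_mod i b, ← Nat.div_add_mod j b, hd, h])
      · rw [if_neg hd, zero_mul]

theorem eq_sum_discCoef {n ξ : ℕ} (hξ : ξ < b ^ n) (φ : ℝ → ℝ) :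
    (φ ((ξ : ℝ) / (b : ℝ) ^ n) : ℂ) =
      ∑ k ∈ Finset.range (b ^ n), discCoef b n k φ * (starRingEnd ℂ) (walE b n k ξ) := by
  have hbC : (b : ℂ) ≠ 0 := by exact_mod_cast NeZero.ne b
  have h : ∀ k ∈ Finset.range (b ^ n), discCoef b n k φ * (starRingEnd ℂ) (walE b n k ξ) =
      ∑ i ∈ Finset.range (b ^ n), ((b : ℂ) ^ n)⁻¹ * (φ ((i : ℝ) / (b : ℝ) ^ n) : ℂ) *
        (walE b n k i * (starRingEnd ℂ) (walE b n k ξ)) := by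
    intro k _
    rw [discCoef, Finset.mul_sum, Finset.sum_mul]
    exact Finset.sum_congr rfl fun i _ => by ring
  rw [Finset.sum_congr rfl h, Finset.sum_comm, Finset.sum_eq_single ξ]
  · rw [← Finset.mul_sum, sum_walE_mul_conj hξ hξ, if_pos rfl]
    field_simp
  · intro i hi hne
    rw [← Finset.mul_sum, sum_walE_mul_conj (Finset.mem_range.1 hi) hξ, if_neg hne, mul_zero]
  · intro h
    exact absurd (Finset.mem_range.2 hξ) h

end discrete

end ExtrapolatedLattice

namespace ExtrapolatedLattice

/-! ### Grid sums of Bernoulli functions -/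

/-- The map `i ↦ c - i` modulo `N` is an involution of the residues, and periodicity ignores the
quotient. -/
theorem sum_range_sub_div {F : ℝ → ℝ} (hF : Function.Periodic F 1) {N : ℕ} (hN : 0 < N)
    (u : ℝ) (c : ℤ) :
    ∑ i ∈ Finset.range N, F (u + ((c - i : ℤ) : ℝ) / N) = ∑ i ∈ Finset.range N, F (u + (i : ℝ) / N) := by
  have hN' : (0 : ℤ) < N := by exact_mod_cast hN
  have hNR : (N : ℝ) ≠ 0 := by positivity
  set e : ℕ → ℕ := fun i => ((c - i) % (N : ℤ)).toNat with he
  have he1 : ∀ i, ((e i : ℕ) : ℤ) = (c - i) % (N : ℤ) := fun i =>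
    Int.toNat_of_nonneg (Int.emod_nonneg _ hN'.ne')
  have he2 : ∀ i, e i ∈ Finset.range N := fun i => by
    rw [Finset.mem_range]
    have := Int.emod_lt_of_pos (c - i) hN'
    rw [← he1] at this
    exact_mod_cast this
  have he3 : ∀ i ∈ Finset.range N, e (e i) = i := by
    intro i hi
    have h1 : ((e (e i) : ℕ) : ℤ) = i := by
      rw [he1, he1, Int.sub_emod_emod, sub_sub_cancel]
      exact Int.emod_eq_of_lt (by positivity) (by exact_mod_cast Finset.mem_range.1 hi)
    exact_mod_cast h1
  refine Finset.sum_bij' (fun i _ => e i) (fun i _ => e i) (fun i _ => he2 i) (fun i _ => he2 i)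
    he3 he3 fun i _ => ?_
  have h1 : (c - i : ℤ) = e i + N * ((c - i) / N) := by
    rw [he1]; exact (Int.emod_add_mul_ediv _ _).symm
  have h2 : u + ((c - i : ℤ) : ℝ) / N = u + (e i : ℝ) / N + (((c - i) / (N : ℤ) : ℤ) : ℝ) * 1 := by
    have h3 : ((c - i : ℤ) : ℝ) = (e i : ℝ) + (N : ℝ) * (((c - i) / (N : ℤ) : ℤ) : ℝ) := by
      have := congrArg (Int.cast : ℤ → ℝ) h1
      rw [Int.cast_add, Int.cast_mul, Int.cast_natCast, Int.cast_natCast] at this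
      exact this
    rw [h3]
    field_simp
    ring
  rw [h2]
  exact hF.int_mul _ _

/-- The multiplication formula for Bernoulli polynomials, source of the pure powers of `b^{-n}` that
the extrapolation removes. -/
theorem sum_bernNorm_grid {N : ℕ} (hN : 0 < N) (t : ℕ) (u : ℝ) :
    (N : ℝ)⁻¹ * ∑ i ∈ Finset.range N, bernNorm t (u + (i : ℝ) / N) =
      ((N : ℝ) ^ t)⁻¹ * bernNorm t (N * u) := by
  have hNR : (N : ℝ) ≠ 0 := by positivity
  simp only [bernNorm, bernoulliFun_mul t hN.ne' u, ← Finset.sum_div]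
  field_simp

theorem sum_bernTilde_grid {N : ℕ} (hN : 0 < N) (t : ℕ) (x : ℝ) :
    (N : ℝ)⁻¹ * ∑ i ∈ Finset.range N, bernTilde t (x - (i : ℝ) / N) =
      ((N : ℝ) ^ t)⁻¹ * bernTilde t (N * x) := by
  have hNR : (0 : ℝ) < N := by positivity
  set u : ℝ := Int.fract (N * x) / N with hu
  have h0 : 0 ≤ u := div_nonneg (Int.fract_nonneg _) hNR.le
  have h1 : ∀ i ∈ Finset.range N, bernTilde t (x - (i : ℝ) / N) =
      bernTilde t (u + ((⌊N * x⌋ - i : ℤ) : ℝ) / N) := by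
    intro i _
    congr 1
    rw [hu, ← Int.self_sub_floor]
    push_cast
    field_simp
    ring
  have h2 : ∀ i ∈ Finset.range N, bernTilde t (u + (i : ℝ) / N) = bernNorm t (u + (i : ℝ) / N) := by
    intro i hi
    rw [bernTilde_eq, Int.fract_eq_self.2 ⟨by positivity, ?_⟩]
    have h3 : (i : ℝ) + 1 ≤ N := by exact_mod_cast Finset.mem_range.1 hi
    rw [hu, ← add_div, div_lt_one hNR]
    linarith [Int.fract_lt_one (N * x)]
  rw [Finset.sum_congr rfl h1, sum_range_sub_div (bernTilde_periodic t) hN, Finset.sum_congr rfl h2,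
    sum_bernNorm_grid hN, bernTilde_eq, hu, mul_div_cancel₀ _ hNR.ne']

theorem abs_bernTilde_le_bernConst (α : ℕ) (x : ℝ) : |bernTilde α x| ≤ bernConst α := by
  refine le_trans ?_ (le_max_right _ _)
  have h : BddAbove (Set.range fun x : Set.Ico (0 : ℝ) 1 => |bernTilde α x|) :=
    ⟨(1 / 2) ^ α, by rintro _ ⟨y, rfl⟩; exact abs_bernTilde_le α y⟩
  have h2 := le_ciSup h ⟨Int.fract x, Int.fract_nonneg x, Int.fract_lt_one x⟩
  refine le_trans (le_of_eq ?_) h2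
  simp only [bernTilde, Int.fract_fract]

theorem abs_bernNorm_zero_le_bernConst {α t : ℕ} (h1 : 1 ≤ t) (h2 : t ≤ α) :
    |bernNorm t 0| ≤ bernConst α := by
  rcases h2.eq_or_lt with rfl | h
  · have := abs_bernTilde_le_bernConst t 0
    rwa [bernTilde_eq, Int.fract_zero] at this
  · refine le_trans ?_ (le_max_left _ _)
    exact le_ciSup (f := fun τ : {τ // τ ∈ Finset.Icc 1 (α - 1)} =>
      |bernoulliFun τ 0 / ((τ : ℕ).factorial : ℝ)|) (Set.finite_range _).bddAbove
      ⟨t, Finset.mem_Icc.2 ⟨h1, by omega⟩⟩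

/-! ### The kernels of the integral representation -/

/-- `b_i(y)` for `i ≤ α`, and `(-1)^{α+1} b̃_α(x - y)` otherwise. -/
noncomputable def kern (α i : ℕ) (x y : ℝ) : ℝ :=
  if i ≤ α then bernNorm i y else (-1) ^ (α + 1) * bernTilde α (x - y)

theorem kern_of_le {α i : ℕ} (h : i ≤ α) (x y : ℝ) : kern α i x y = bernNorm i y := if_pos h

theorem kern_last (α : ℕ) (x y : ℝ) :
    kern α (α + 1) x y = (-1) ^ (α + 1) * bernTilde α (x - y) := if_neg (by omega)

theorem continuous_kern {α : ℕ} (hα : 2 ≤ α) (i : ℕ) :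
    Continuous fun z : ℝ × ℝ => kern α i z.1 z.2 := by
  unfold kern
  split_ifs
  · fun_prop
  · have := continuous_bernTilde hα
    fun_prop

/-! ### Walsh and grid coefficients of the kernels -/

section

variable {b : ℕ} [NeZero b]

/-- Bounds for the Walsh coefficients of `y ↦ kern α i x y`, uniformly in `x`. -/
noncomputable def kernBound (b : ℕ) [NeZero b] (α i k : ℕ) : ℝ≥0∞ :=
  if k = 0 then 0
  else if i ≤ α then ‖walCoef b k (bernNorm i)‖ₑ
  else ENNReal.ofReal (walshConst b α) * ((b : ℝ≥0∞) ^ mu b α k)⁻¹ -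
    ∑ t ∈ Finset.range α, ‖walCoef b k (bernNorm (t + 1))‖ₑ

/-- `walsh_bound_aux` for the constant profile `1`. All nonconstant kernels share one bound, so
summing over them costs no factor `α + 1`. -/
theorem walCoef_bern_bound (hb : b.Prime) {α : ℕ} (hα : 2 ≤ α) {k : ℕ} (hk : 0 < k) (x : ℝ) :
    ∑ t ∈ Finset.range α, ‖walCoef b k (bernNorm (t + 1))‖ₑ +
        ‖walCoef b k (fun y => bernTilde α (x - y))‖ₑ ≤
      ENNReal.ofReal (walshConst b α) * ((b : ℝ≥0∞) ^ mu b α k)⁻¹ := by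
  have hb2 := hb.two_le
  have hbpos : (0 : ℝ) < b := by exact_mod_cast hb.pos
  obtain ⟨a, rfl⟩ : ∃ a, α = a + 1 := ⟨α - 1, by omega⟩
  have hk' : k < b ^ k := Nat.lt_pow_self hb2
  have h := walsh_bound_aux hb2 k hk hk' (w := fun _ => 1) (m0 := 1) (w0 := 1)
    intervalIntegrable_const (by simp) (by simp) a (x := Int.fract x)
    ⟨Int.fract_nonneg x, Int.fract_lt_one x⟩
  rw [bernConv_fract, mul_one] at h
  have h2 : (1 + 2 * ∑ j ∈ Finset.range (a + 1), (2 * Real.sin (Real.pi / b))⁻¹ ^ (j + 1)) /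
      (b : ℝ) ^ mu b (a + 1) k ≤ walshConst b (a + 1) * ((b : ℝ) ^ mu b (a + 1) k)⁻¹ := by
    rw [div_eq_mul_inv]
    gcongr
    exact one_add_geom_le_walshConst hb hα
  have h3 : ENNReal.ofReal (walshConst b (a + 1)) * ((b : ℝ≥0∞) ^ mu b (a + 1) k)⁻¹ =
      ENNReal.ofReal (walshConst b (a + 1) * ((b : ℝ) ^ mu b (a + 1) k)⁻¹) := by
    rw [ENNReal.ofReal_mul' (by positivity), ENNReal.ofReal_inv_of_pos (by positivity),
      ENNReal.ofReal_pow hbpos.le, ENNReal.ofReal_natCast]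
  rw [h3]
  refine le_trans (le_of_eq ?_) (ENNReal.ofReal_le_ofReal (h.trans h2))
  rw [ENNReal.ofReal_add (Finset.sum_nonneg fun _ _ => norm_nonneg _) (norm_nonneg _),
    ENNReal.ofReal_sum_of_nonneg fun _ _ => norm_nonneg _]
  simp only [ofReal_norm]
  rfl

theorem enorm_walCoef_kern_le (hb : b.Prime) {α : ℕ} (hα : 2 ≤ α) {i : ℕ} (h1 : 1 ≤ i) 
    (k : ℕ) (x : ℝ) : ‖walCoef b k (kern α i x)‖ₑ ≤ kernBound b α i k := by
  have hw0 : ∀ y, walFn b 0 y = 1 := fun y => by simp [walFn, cellFn, walE]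
  unfold kernBound
  split_ifs with hk0 hi
  -- At index `0` the coefficient is the mean in `y`, which vanishes for every nonconstant kernel.
  · subst hk0
    simp only [walCoef, hw0, mul_one, nonpos_iff_eq_zero, enorm_eq_zero]
    rw [intervalIntegral.integral_ofReal, Complex.ofReal_eq_zero]
    by_cases hi : i ≤ α
    · simp only [kern_of_le hi]
      obtain ⟨j, rfl⟩ : ∃ j, i = j + 1 := ⟨i - 1, by omega⟩
      exact integral_bernNorm j
    · simp only [kern, if_neg hi, intervalIntegral.integral_const_mul]
      rw [intervalIntegral.integral_comp_sub_left (fun y => bernTilde α y) x,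
        sub_zero]
      have h := (bernTilde_periodic α).intervalIntegral_add_eq (x - 1) 0
      rw [sub_add_cancel, zero_add] at h
      rw [h]
      have : ∫ y in (0 : ℝ)..1, bernTilde α y = ∫ y in (0 : ℝ)..1, bernNorm α y := by
        refine intervalIntegral.integral_congr_ae ?_
        have : ∀ᵐ y : ℝ, y ≠ 1 := by simp [ae_iff, measure_singleton]
        filter_upwards [this] with y hy1 hy
        rw [Set.uIoc_of_le zero_le_one] at hy
        rw [bernTilde_eq, Int.fract_eq_self.2 ⟨hy.1.le, lt_of_le_of_ne hy.2 hy1⟩]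
      obtain ⟨j, rfl⟩ : ∃ j, α = j + 1 := ⟨α - 1, by omega⟩
      rw [this, integral_bernNorm, mul_zero]
  · have : kern α i x = bernNorm i := funext fun y => kern_of_le hi x y
    rw [this]
  · have h := walCoef_bern_bound hb hα (Nat.pos_of_ne_zero hk0) x
    have e : ‖walCoef b k (kern α i x)‖ₑ = ‖walCoef b k (fun y => bernTilde α (x - y))‖ₑ := by
      have : walCoef b k (kern α i x) =
          (-1) ^ (α + 1) * walCoef b k (fun y => bernTilde α (x - y)) := by
        rw [walCoef, walCoef, ← intervalIntegral.integral_const_mul]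
        congr 1
        ext y
        rw [kern, if_neg hi]
        push_cast
        ring
      rw [this, enorm_mul, enorm_pow, enorm_neg, enorm_one, one_pow, one_mul]
    rw [e]
    refine ENNReal.le_sub_of_add_le_left ?_ h
    exact ENNReal.sum_ne_top.2 fun _ _ => enorm_ne_top

/-- The bound for the last kernel is whatever the joint bound leaves, so nothing is lost in the sum.
The truncated subtraction is harmless because the subtracted sum never exceeds the joint bound. -/
theorem sum_kernBound_le (hb : b.Prime) {α : ℕ} (hα : 2 ≤ α) (k : ℕ) :
    ∑ i ∈ Finset.range (α + 1), kernBound b α (i + 1) k ≤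
      if k = 0 then 0 else ENNReal.ofReal (walshConst b α) * ((b : ℝ≥0∞) ^ mu b α k)⁻¹ := by
  split_ifs with hk
  · simp [kernBound, hk]
  · rw [Finset.sum_range_succ]
    have h1 : ∀ i ∈ Finset.range α, kernBound b α (i + 1) k = ‖walCoef b k (bernNorm (i + 1))‖ₑ := by
      intro i hi
      rw [Finset.mem_range] at hi
      rw [kernBound, if_neg hk, if_pos (by omega)]
    rw [Finset.sum_congr rfl h1, kernBound, if_neg hk, if_neg (by omega)]
    rw [add_tsub_cancel_of_le]
    exact le_self_add.trans (walCoef_bern_bound hb hα (Nat.pos_of_ne_zero hk) 0)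

theorem enorm_discCoef_kern_le (hb : b.Prime) {α : ℕ} (hα : 2 ≤ α) {i : ℕ} (h1 : 1 ≤ i)
    {n k : ℕ} (hk : k < b ^ n) (x : ℝ) :
    ‖discCoef b n k (kern α i x)‖ₑ ≤ ∑' l, kernBound b α i (k + b ^ n * l) :=
  enorm_discCoef_le hb.two_le hk ((continuous_kern hα i).comp (Continuous.prodMk_right x))
    fun k => enorm_walCoef_kern_le hb hα h1 k x

theorem discCoef_kern_zero {α n k : ℕ} (hk : k < b ^ n) (x : ℝ) :
    discCoef b n k (kern α 0 x) = if k = 0 then 1 else 0 := by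
  have hbC : (b : ℂ) ≠ 0 := by exact_mod_cast NeZero.ne b
  simp only [discCoef, kern_of_le (Nat.zero_le α), bernNorm_zero, Complex.ofReal_one, mul_one]
  split_ifs with h
  · subst h
    simp [walE_zero_right, hbC]
  · rw [sum_walE_eq_zero (Nat.pos_of_ne_zero h) hk, mul_zero]

theorem discCoef_zero_kern_of_le {α i : ℕ} (hi : i ≤ α) (n : ℕ) (x : ℝ) :
    discCoef b n 0 (kern α i x) = (((b : ℝ) ^ (n * i))⁻¹ * bernNorm i 0 : ℝ) := by
  have hN : 0 < b ^ n := pow_pos (Nat.pos_of_ne_zero (NeZero.ne b)) n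
  have h := sum_bernNorm_grid hN i 0
  rw [mul_zero] at h
  push_cast at h
  rw [pow_mul, ← h]
  simp [discCoef, walE_zero_right, kern_of_le hi]

theorem discCoef_zero_kern_last {α : ℕ} (n : ℕ) (x : ℝ) :
    discCoef b n 0 (kern α (α + 1) x) =
      (((b : ℝ) ^ (n * α))⁻¹ * ((-1) ^ (α + 1) * bernTilde α ((b : ℝ) ^ n * x)) : ℝ) := by
  have hN : 0 < b ^ n := pow_pos (Nat.pos_of_ne_zero (NeZero.ne b)) n
  have h := sum_bernTilde_grid hN α x
  push_cast at h
  have e : ((b : ℝ) ^ (n * α))⁻¹ * ((-1) ^ (α + 1) * bernTilde α ((b : ℝ) ^ n * x)) =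
    (-1) ^ (α + 1) * ((((b : ℝ) ^ n) ^ α)⁻¹ * bernTilde α ((b : ℝ) ^ n * x)) := by
    rw [pow_mul]; ring
  rw [e, ← h]
  simp only [discCoef, walE_zero_right, kern_last, one_mul]
  push_cast
  rw [Finset.mul_sum, Finset.mul_sum, Finset.mul_sum]
  exact Finset.sum_congr rfl fun i _ => by ring

end

end ExtrapolatedLattice

namespace ExtrapolatedLattice

/-! ### Polynomial lattices and the character property -/

section lattice

variable {b : ℕ} [Fact b.Prime]

theorem toLaurent_monomial (i : ℕ) (a : ZMod b) :
    toLaurent b (Polynomial.monomial i a) = HahnSeries.single (-(i : ℤ)) a := by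
  rw [toLaurent, Polynomial.coe_eval₂RingHom, Polynomial.eval₂_monomial, HahnSeries.single_pow,
    HahnSeries.C_apply, HahnSeries.single_mul_single]
  simp

theorem coeff_toLaurent (P : (ZMod b)[X]) (m : ℤ) :
    (toLaurent b P).coeff m = if m ≤ 0 then P.coeff (-m).toNat else 0 := by
  induction P using Polynomial.induction_on' with
  | add P Q hP hQ =>
    rw [map_add, HahnSeries.coeff_add, hP, hQ]
    split_ifs <;> simp
  | monomial i a =>
    rw [toLaurent_monomial, HahnSeries.coeff_single, Polynomial.coeff_monomial]
    split_ifs <;> first | rfl | omega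

theorem toLaurent_ne_zero {P : (ZMod b)[X]} (hP : P ≠ 0) : toLaurent b P ≠ 0 := by
  intro h
  have h1 := coeff_toLaurent P (-(P.natDegree : ℤ))
  rw [h] at h1
  simp at h1
  exact hP (Polynomial.leadingCoeff_eq_zero.1 h1.symm)

theorem order_toLaurent {P : (ZMod b)[X]} (hP : P ≠ 0) :
    (toLaurent b P).order = -(P.natDegree : ℤ) := by
  have h0 := toLaurent_ne_zero hP
  refine le_antisymm (HahnSeries.order_le_of_coeff_ne_zero ?_) ?_
  · rw [coeff_toLaurent]
    simpa using hP
  · have h1 := HahnSeries.coeff_order_eq_zero.not.2 h0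
    rw [coeff_toLaurent] at h1
    split_ifs at h1 with h2
    · have := Polynomial.le_natDegree_of_ne_zero h1
      omega
    · exact absurd rfl h1

/-- If `p ∤ A`, the remainder `R` is nonzero and `R / p` has order `n - deg R`, between `1` and `n`.
Its leading coefficient is then among those assumed zero, as the polynomial part has none there. -/
theorem dvd_of_coeff_div_eq_zero {n : ℕ} {p A : (ZMod b)[X]} (hn : 0 < n) (hp : p.natDegree = n)
    (h : ∀ l < n, (toLaurent b A / toLaurent b p).coeff ((l : ℤ) + 1) = 0) : p ∣ A := by
  by_contra hA
  have hp0 : p ≠ 0 := by rintro rfl; simp at hp; omega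
  have hP := toLaurent_ne_zero hp0
  set R := A % p with hR
  have hR0 : R ≠ 0 := fun h0 => hA (EuclideanDomain.mod_eq_zero.1 h0)
  have hdeg : R.natDegree < n := by
    rw [← hp]
    exact Polynomial.natDegree_mod_lt A (by omega)
  have hR' := toLaurent_ne_zero hR0
  set L := toLaurent b R / toLaurent b p with hL
  have hL0 : L ≠ 0 := div_ne_zero hR' hP
  have hLp : L * toLaurent b p = toLaurent b R := div_mul_cancel₀ _ hP
  have hord : L.order = n - R.natDegree := by
    have := HahnSeries.order_mul hL0 hP
    rw [hLp, order_toLaurent hR0, order_toLaurent hp0, hp] at this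
    omega
  have hAL : toLaurent b A / toLaurent b p = L + toLaurent b (A / p) := by
    rw [hL, div_add' _ _ _ hP]
    congr 1
    rw [← map_mul, ← map_add, hR, mul_comm, EuclideanDomain.mod_add_div]
  have h1 := HahnSeries.coeff_order_eq_zero.not.2 hL0
  have h2 := h (n - R.natDegree - 1) (by omega)
  have e : ((n - R.natDegree - 1 : ℕ) : ℤ) + 1 = L.order := by rw [hord]; omega
  rw [hAL, HahnSeries.coeff_add, coeff_toLaurent, if_neg (by omega), add_zero, e] at h2
  exact h1 h2

/-- The integer with base-`b` digits `L_1, …, L_n`. -/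
def digitNat (b : ℕ) : ℕ → LaurentSeries (ZMod b) → ℕ
  | 0, _ => 0
  | n + 1, L => b * digitNat b n L + (L.coeff ((n : ℤ) + 1)).val

theorem digitNat_lt (n : ℕ) (L : LaurentSeries (ZMod b)) : digitNat b n L < b ^ n := by
  induction n with
  | zero => simp [digitNat]
  | succ n ih =>
    have h1 := ZMod.val_lt (L.coeff ((n : ℤ) + 1))
    rw [digitNat, pow_succ']
    calc _ < b * digitNat b n L + b := by omega
      _ = b * (digitNat b n L + 1) := by ring
      _ ≤ _ := Nat.mul_le_mul_left _ ih

theorem vmap_eq (n : ℕ) (L : LaurentSeries (ZMod b)) :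
    vmap b n L = (digitNat b n L : ℝ) / (b : ℝ) ^ n := by
  have hb : (b : ℝ) ≠ 0 := by exact_mod_cast (Fact.out : b.Prime).ne_zero
  induction n with
  | zero => simp [vmap, digitNat]
  | succ n ih =>
    rw [vmap, Finset.sum_Icc_succ_top (by omega), ← vmap, ih, digitNat]
    push_cast
    field_simp
    ring

theorem digitNat_eq_zero {n : ℕ} {L : LaurentSeries (ZMod b)} (h : digitNat b n L = 0) :
    ∀ l < n, L.coeff ((l : ℤ) + 1) = 0 := by
  have hb : b ≠ 0 := (Fact.out : b.Prime).ne_zero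
  induction n with
  | zero => intro l hl; omega
  | succ n ih =>
    rw [digitNat] at h
    have h1 : digitNat b n L = 0 := by
      have : b * digitNat b n L = 0 := by omega
      simpa [hb] using this
    intro l hl
    rcases Nat.lt_succ_iff_lt_or_eq.1 hl with h2 | rfl
    · exact ih h1 l h2
    · rw [← ZMod.val_eq_zero]; omega

theorem walE_digitNat (n k : ℕ) (L : LaurentSeries (ZMod b)) :
    walE b n k (digitNat b n L) =
      ZMod.stdAddChar (∑ l ∈ Finset.range n, ((k / b ^ l : ℕ) : ZMod b) * L.coeff ((l : ℤ) + 1)) := by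
  induction n with
  | zero => simp [walE]
  | succ n ih =>
    have h1 := ZMod.val_lt (L.coeff ((n : ℤ) + 1))
    rw [digitNat, walE, Nat.mul_add_div (Fact.out : b.Prime).pos, Nat.div_eq_of_lt h1, add_zero, ih,
      Finset.sum_range_succ, AddChar.map_add_eq_mul]
    simp

/-- The exponent of a Walsh function is a residue, the coefficient of `x⁻¹`. In this form the index
and the generator of the point play symmetric roles. -/
theorem coeff_toLaurent_tr_mul (n k : ℕ) (L : LaurentSeries (ZMod b)) :
    (toLaurent b (tr b n k) * L).coeff 1 =
      ∑ l ∈ Finset.range n, ((k / b ^ l : ℕ) : ZMod b) * L.coeff ((l : ℤ) + 1) := by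
  have h : toLaurent b (tr b n k) * L =
      ∑ l ∈ Finset.range n, HahnSeries.single (-(l : ℤ)) ((k / b ^ l : ℕ) : ZMod b) * L := by
    rw [tr, map_sum, Finset.sum_mul]
    refine Finset.sum_congr rfl fun l _ => ?_
    rw [Polynomial.C_mul_X_pow_eq_monomial, toLaurent_monomial, ZMod.natCast_mod]
  rw [h, HahnSeries.coeff_sum]
  refine Finset.sum_congr rfl fun l _ => ?_
  have e : (1 : ℤ) = ((l : ℤ) + 1) + (-(l : ℤ)) := by ring
  conv_lhs => rw [e]
  rw [HahnSeries.coeff_single_mul_add]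

theorem walE_index_zero (A k : ℕ) : walE b A k 0 = 1 := by
  induction A with
  | zero => rfl
  | succ A ih => simp [walE, ih]

theorem stdAddChar_sum {ι : Type*} (t : Finset ι) (f : ι → ZMod b) :
    (ZMod.stdAddChar (∑ i ∈ t, f i) : ℂ) = ∏ i ∈ t, ZMod.stdAddChar (f i) := by
  classical
  induction t using Finset.induction_on with
  | empty => simp
  | insert i t hi ih => rw [Finset.sum_insert hi, Finset.prod_insert hi, AddChar.map_add_eq_mul, ih]

/-- The Walsh functions average to `0` over a polynomial lattice unless the index lies in the
dual lattice. -/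
theorem sum_prod_walE_eq_zero {s n : ℕ} (hn : 0 < n) {p : (ZMod b)[X]} (hp : p.natDegree = n)
    (g : Fin s → (ZMod b)[X]) (k : Fin s → ℕ) (hk : k ∉ dualLattice b n p g) :
    ∑ h ∈ Finset.range (b ^ n), ∏ j, walE b n (k j)
      (digitNat b n (toLaurent b (tr b n h * g j) / toLaurent b p)) = 0 := by
  set A : (ZMod b)[X] := ∑ j, tr b n (k j) * g j with hA
  set D := digitNat b n (toLaurent b A / toLaurent b p) with hD
  -- By the symmetry of the residue pairing, the product over `j` is one Walsh function of index
  -- `h`, evaluated at the digits of `A / p`.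
  have h1 : ∀ h ∈ Finset.range (b ^ n), ∏ j, walE b n (k j)
      (digitNat b n (toLaurent b (tr b n h * g j) / toLaurent b p)) = walE b n h D := by
    intro h _
    simp only [hD, walE_digitNat, ← coeff_toLaurent_tr_mul]
    rw [← stdAddChar_sum, ← HahnSeries.coeff_sum]
    congr 2
    rw [hA, map_sum, Finset.sum_div, Finset.mul_sum]
    refine Finset.sum_congr rfl fun j _ => ?_
    simp only [map_mul]
    ring
  have hD0 : D ≠ 0 := fun h0 => hk (dvd_of_coeff_div_eq_zero hn hp (digitNat_eq_zero h0))
  have h2 := sum_walE_mul_conj (digitNat_lt n (toLaurent b A / toLaurent b p))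
    (pow_pos (Fact.out : b.Prime).pos n)
  rw [if_neg hD0] at h2
  rw [Finset.sum_congr rfl h1, ← h2]
  exact Finset.sum_congr rfl fun h _ => by rw [walE_index_zero, map_one, mul_one]

end lattice

end ExtrapolatedLattice

/-! ### Integral representation from weak derivatives -/

namespace ExtrapolatedLattice

/-! ### Product test functions -/

section product

variable {s : ℕ}

/-- The tensor product of functions of one variable. -/
def tensorFn (φ : Fin s → ℝ → ℝ) (x : Fin s → ℝ) : ℝ := ∏ j, φ j (x j)

theorem contDiff_tensorFn {φ : Fin s → ℝ → ℝ} (hφ : ∀ j, ContDiff ℝ ∞ (φ j)) :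
    ContDiff ℝ ∞ (tensorFn φ) :=
  contDiff_prod fun j _ => (hφ j).comp (contDiff_apply ℝ ℝ j)

theorem continuous_tensorFn {φ : Fin s → ℝ → ℝ} (hφ : ∀ j, Continuous (φ j)) :
    Continuous (tensorFn φ) :=
  continuous_finsetProd _ fun j _ => (hφ j).comp (continuous_apply j)

theorem tensorFn_update (φ : Fin s → ℝ → ℝ) (j : Fin s) (ψ : ℝ → ℝ) (x : Fin s → ℝ) :
    tensorFn (Function.update φ j ψ) x = ψ (x j) * ∏ i ∈ Finset.univ.erase j, φ i (x i) := by
  rw [tensorFn, ← Finset.mul_prod_erase _ _ (Finset.mem_univ j), Function.update_self]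
  congr 1
  refine Finset.prod_congr rfl fun i hi => ?_
  rw [Function.update_of_ne (Finset.ne_of_mem_erase hi)]

theorem partialD_tensorFn {φ : Fin s → ℝ → ℝ} (hφ : ∀ j, Differentiable ℝ (φ j)) (j : Fin s) :
    partialD j (tensorFn φ) = tensorFn (Function.update φ j (deriv (φ j))) := by
  ext x
  have h : ∀ i ∈ (Finset.univ : Finset (Fin s)), HasFDerivAt (fun x : Fin s → ℝ => φ i (x i))
      ((deriv (φ i) (x i)) • ContinuousLinearMap.proj (R := ℝ) (φ := fun _ : Fin s => ℝ) i) x := by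
    intro i _
    have h1 := (hφ i (x i)).hasDerivAt.hasFDerivAt.comp x
      (ContinuousLinearMap.proj (R := ℝ) (φ := fun _ : Fin s => ℝ) i).hasFDerivAt
    refine h1.congr_fderiv ?_
    ext v
    simp [mul_comm]
  have h2 := HasFDerivAt.finsetProd h
  rw [partialD, show tensorFn φ = fun x => ∏ i, φ i (x i) from rfl, h2.fderiv, tensorFn_update]
  rw [_root_.sum_apply, Finset.sum_eq_single j]
  · simp [mul_comm]
  · intro i _ hij
    simp [hij]
  · simp

theorem contDiff_iterate_deriv {φ : ℝ → ℝ} (hφ : ContDiff ℝ ∞ φ) (n : ℕ) :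
    ContDiff ℝ ∞ (deriv^[n] φ) := by
  induction n generalizing φ with
  | zero => exact hφ
  | succ n ih => exact ih (contDiff_infty_iff_deriv.1 hφ).2

theorem iterate_partialD_tensorFn {φ : Fin s → ℝ → ℝ} (hφ : ∀ j, ContDiff ℝ ∞ (φ j)) (j : Fin s)
    (n : ℕ) :
    (partialD j)^[n] (tensorFn φ) = tensorFn (Function.update φ j (deriv^[n] (φ j))) := by
  induction n with
  | zero => simp
  | succ n ih =>
    rw [Function.iterate_succ_apply', ih, partialD_tensorFn, Function.update_self,
      Function.update_idem, Function.iterate_succ_apply']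
    intro i
    rcases eq_or_ne i j with rfl | hij
    · rw [Function.update_self]
      exact (contDiff_iterate_deriv (hφ i) n).differentiable (by simp)
    · rw [Function.update_of_ne hij]
      exact (hφ i).differentiable (by simp)

theorem mixedD_tensorFn {φ : Fin s → ℝ → ℝ} (hφ : ∀ j, ContDiff ℝ ∞ (φ j)) (β : Fin s → ℕ) :
    mixedD β (tensorFn φ) = tensorFn fun j => deriv^[β j] (φ j) := by
  have h : ∀ l : List (Fin s), l.Nodup →
      l.foldr (fun j ψ => (partialD j)^[β j] ψ) (tensorFn φ) =
        tensorFn fun j => if j ∈ l then deriv^[β j] (φ j) else φ j := by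
    intro l hl
    induction l with
    | nil => simp
    | cons i l ih =>
      rw [List.nodup_cons] at hl
      rw [List.foldr_cons, ih hl.2, iterate_partialD_tensorFn, if_neg hl.1]
      · congr 1
        ext j : 1
        rcases eq_or_ne j i with rfl | hij
        · simp
        · simp [hij]
      · intro j
        split_ifs
        · exact contDiff_iterate_deriv (hφ j) _
        · exact hφ j
  rw [mixedD, h _ (List.nodup_finRange s)]
  simp

theorem tsupport_tensorFn_subset (φ : Fin s → ℝ → ℝ) :
    tsupport (tensorFn φ) ⊆ Set.univ.pi fun j => tsupport (φ j) := by
  refine closure_minimal ?_ (isClosed_set_pi fun j _ => isClosed_tsupport _)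
  intro x hx j _
  refine subset_tsupport _ ?_
  intro h0
  exact hx (Finset.prod_eq_zero (Finset.mem_univ j) h0)

/-- Smooth functions on `ℝ` with compact support in `(0,1)`. -/
structure IsTest (ψ : ℝ → ℝ) : Prop where
  contDiff : ContDiff ℝ ∞ ψ
  hasCompactSupport : HasCompactSupport ψ
  tsupport_subset : tsupport ψ ⊆ Set.Ioo 0 1

theorem IsTest.deriv {ψ : ℝ → ℝ} (h : IsTest ψ) : IsTest (deriv ψ) :=
  ⟨(contDiff_infty_iff_deriv.1 h.contDiff).2, h.hasCompactSupport.deriv,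
    tsupport_deriv_subset.trans h.tsupport_subset⟩

theorem hasCompactSupport_tensorFn {φ : Fin s → ℝ → ℝ} (hφ : ∀ j, IsTest (φ j)) :
    HasCompactSupport (tensorFn φ) :=
  (isCompact_univ_pi fun j => (hφ j).hasCompactSupport).of_isClosed_subset (isClosed_tsupport _)
    (tsupport_tensorFn_subset φ)

theorem tsupport_tensorFn_subset_openCube {φ : Fin s → ℝ → ℝ} (hφ : ∀ j, IsTest (φ j)) :
    tsupport (tensorFn φ) ⊆ openCube (Fin s) :=
  (tsupport_tensorFn_subset φ).trans (Set.pi_mono fun j _ => (hφ j).tsupport_subset)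

/-- Pairing of a function on the cube with a product of functions of one variable. -/
noncomputable def tensorPair (G : (Fin s → ℝ) → ℝ) (φ : Fin s → ℝ → ℝ) : ℝ :=
  ∫ x in cube (Fin s), G x * tensorFn φ x

theorem IsWeakDeriv.tensorPair_eq {f G : (Fin s → ℝ) → ℝ} {β : Fin s → ℕ}
    (h : IsWeakDeriv β f G) {φ : Fin s → ℝ → ℝ} (hφ : ∀ j, IsTest (φ j)) :
    tensorPair f (fun j => deriv^[β j] (φ j)) = (-1) ^ (∑ j, β j) * tensorPair G φ := by
  have := h.2 (tensorFn φ) (contDiff_tensorFn fun j => (hφ j).contDiff)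
    (hasCompactSupport_tensorFn hφ) (tsupport_tensorFn_subset_openCube hφ)
  rwa [mixedD_tensorFn fun j => (hφ j).contDiff] at this

/-- Both sides come from pairing `f` with the same derivative of `φ`; comparing the signs for the
orders `|β|` and `|β| + 1` gives one integration by parts. -/
theorem IsWeakDeriv.tensorPair_deriv {f G G' : (Fin s → ℝ) → ℝ} {β : Fin s → ℕ} {j : Fin s}
    (h : IsWeakDeriv β f G) (h' : IsWeakDeriv (Function.update β j (β j + 1)) f G')
    {φ : Fin s → ℝ → ℝ} (hφ : ∀ j, IsTest (φ j)) :
    tensorPair G (Function.update φ j (deriv (φ j))) = -tensorPair G' φ := by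
  have h1 := h.tensorPair_eq (φ := Function.update φ j (deriv (φ j))) (fun i => by
    rcases eq_or_ne i j with rfl | hij
    · rw [Function.update_self]; exact (hφ i).deriv
    · rw [Function.update_of_ne hij]; exact hφ i)
  have h2 := h'.tensorPair_eq hφ
  have e : (fun i => deriv^[β i] (Function.update φ j (deriv (φ j)) i)) =
      fun i => deriv^[Function.update β j (β j + 1) i] (φ i) := by
    ext i : 1
    rcases eq_or_ne i j with rfl | hij
    · simp
    · simp [hij]
  have es : ∑ i, Function.update β j (β j + 1) i = ∑ i, β i + 1 := by
    rw [Finset.sum_update_of_mem (Finset.mem_univ j), ← Finset.add_sum_erase _ _ (Finset.mem_univ j),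
      Finset.sdiff_singleton_eq_erase]
    ring
  rw [e, h2, es, pow_succ] at h1
  have hne : ((-1 : ℝ)) ^ (∑ i, β i) ≠ 0 := pow_ne_zero _ (by norm_num)
  have h3 : (-1 : ℝ) ^ (∑ i, β i) * tensorPair G (Function.update φ j (deriv (φ j))) =
      (-1 : ℝ) ^ (∑ i, β i) * -tensorPair G' φ := by rw [← h1]; ring
  exact mul_left_cancel₀ hne h3

end product

end ExtrapolatedLattice

namespace ExtrapolatedLattice

/-! ### Integration by parts for products of smooth functions -/

section cutoff

/-- Smooth cut-off functions supported in `(0,1)` that increase to `1` there. -/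
noncomputable def cutoff (N : ℕ) (x : ℝ) : ℝ :=
  Real.smoothTransition (((N : ℝ) + 3) * x - 1) * Real.smoothTransition (((N : ℝ) + 3) * (1 - x) - 1)

theorem contDiff_cutoff (N : ℕ) : ContDiff ℝ ∞ (cutoff N) :=
  (Real.smoothTransition.contDiff.comp (by fun_prop)).mul
    (Real.smoothTransition.contDiff.comp (by fun_prop))

theorem cutoff_nonneg (N : ℕ) (x : ℝ) : 0 ≤ cutoff N x :=
  mul_nonneg (Real.smoothTransition.nonneg _) (Real.smoothTransition.nonneg _)

theorem cutoff_le_one (N : ℕ) (x : ℝ) : cutoff N x ≤ 1 :=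
  mul_le_one₀ (Real.smoothTransition.le_one _) (Real.smoothTransition.nonneg _)
    (Real.smoothTransition.le_one _)

theorem tsupport_cutoff_subset (N : ℕ) :
    tsupport (cutoff N) ⊆ Set.Icc (1 / ((N : ℝ) + 3)) (1 - 1 / ((N : ℝ) + 3)) := by
  refine closure_minimal ?_ isClosed_Icc
  intro x hx
  have hN : (0 : ℝ) < (N : ℝ) + 3 := by positivity
  constructor
  · by_contra! h
    refine hx ?_
    rw [lt_div_iff₀ hN] at h
    rw [cutoff, Real.smoothTransition.zero_of_nonpos (by linarith), zero_mul]
  · by_contra! h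
    refine hx ?_
    have h2 : 1 - x < 1 / ((N : ℝ) + 3) := by linarith
    rw [lt_div_iff₀ hN] at h2
    rw [cutoff, Real.smoothTransition.zero_of_nonpos (x := ((N : ℝ) + 3) * (1 - x) - 1)
      (by linarith), mul_zero]

theorem tendsto_cutoff {x : ℝ} (hx : x ∈ Set.Ioo (0 : ℝ) 1) :
    Filter.Tendsto (fun N => cutoff N x) Filter.atTop (nhds 1) := by
  refine tendsto_const_nhds.congr' ?_
  have h1 : Filter.Tendsto (fun N : ℕ => ((N : ℝ) + 3) * x) Filter.atTop Filter.atTop :=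
    (Filter.tendsto_atTop_add_const_right _ 3 tendsto_natCast_atTop_atTop).atTop_mul_const hx.1
  have h2 : Filter.Tendsto (fun N : ℕ => ((N : ℝ) + 3) * (1 - x)) Filter.atTop Filter.atTop :=
    (Filter.tendsto_atTop_add_const_right _ 3 tendsto_natCast_atTop_atTop).atTop_mul_const
      (by linarith [hx.2])
  filter_upwards [h1.eventually_ge_atTop 2, h2.eventually_ge_atTop 2] with N a1 a2
  rw [cutoff, Real.smoothTransition.one_of_one_le (by linarith),
    Real.smoothTransition.one_of_one_le (by linarith), one_mul]

theorem isTest_of_subset_Icc {u : ℝ → ℝ} (hu : ContDiff ℝ ∞ u) {a c : ℝ} (ha : 0 < a) (hc : c < 1)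
    (h : ∀ x, x ∉ Set.Icc a c → u x = 0) : IsTest u := by
  have hs : tsupport u ⊆ Set.Icc a c := by
    refine closure_minimal ?_ isClosed_Icc
    intro x hx
    by_contra hn
    exact hx (h x hn)
  exact ⟨hu, isCompact_Icc.of_isClosed_subset (isClosed_tsupport _) hs,
    hs.trans fun x hx => ⟨ha.trans_le hx.1, hx.2.trans_lt hc⟩⟩

theorem cutoff_eq_zero {N : ℕ} {x : ℝ}
    (hx : x ∉ Set.Icc (1 / ((N : ℝ) + 3)) (1 - 1 / ((N : ℝ) + 3))) : cutoff N x = 0 :=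
  image_eq_zero_of_notMem_tsupport fun h => hx (tsupport_cutoff_subset N h)

theorem isTest_mul_cutoff {u : ℝ → ℝ} (hu : ContDiff ℝ ∞ u) (N : ℕ) :
    IsTest fun x => u x * cutoff N x := by
  have : (0 : ℝ) < 1 / ((N : ℝ) + 3) := by positivity
  refine isTest_of_subset_Icc (hu.mul (contDiff_cutoff N)) this
    (by linarith : 1 - 1 / ((N : ℝ) + 3) < 1) fun x hx => ?_
  simp only [cutoff_eq_zero hx, mul_zero]

theorem contDiff_primitive {u : ℝ → ℝ} (hu : ContDiff ℝ ∞ u) :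
    ContDiff ℝ ∞ fun x => ∫ y in (0 : ℝ)..x, u y := by
  have hd : ∀ x, HasDerivAt (fun x => ∫ y in (0 : ℝ)..x, u y) (u x) x := fun x =>
    (hu.continuous.integral_hasStrictDerivAt 0 x).hasDerivAt
  rw [contDiff_infty_iff_deriv]
  refine ⟨fun x => (hd x).differentiableAt, ?_⟩
  rwa [show deriv (fun x => ∫ y in (0 : ℝ)..x, u y) = u from funext fun x => (hd x).deriv]

theorem integral_cutoff_pos (N : ℕ) : 0 < ∫ y in (0 : ℝ)..1, cutoff N y := by
  refine intervalIntegral.integral_pos zero_lt_one (contDiff_cutoff N).continuous.continuousOn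
    (fun x _ => cutoff_nonneg N x) ⟨1 / 2, by norm_num, ?_⟩
  have h0 : (0 : ℝ) ≤ N := by positivity
  rw [cutoff]
  exact mul_pos (Real.smoothTransition.pos_of_pos (by linarith))
    (Real.smoothTransition.pos_of_pos (by linarith))

theorem isTest_primitive {u : ℝ → ℝ} (hu : ContDiff ℝ ∞ u) {a c : ℝ} (ha : 0 < a)
    (hc : c < 1) (h : ∀ x, x ∉ Set.Icc a c → u x = 0) (h0 : ∫ y in (0 : ℝ)..1, u y = 0) :
    IsTest fun x => ∫ y in (0 : ℝ)..x, u y := by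
  have hi : ∀ x y, IntervalIntegrable u volume x y := fun x y => hu.continuous.intervalIntegrable _ _
  refine isTest_of_subset_Icc (contDiff_primitive hu) ha hc fun x hx => ?_
  by_cases hxa : x < a
  · rw [intervalIntegral.integral_congr (g := fun _ => 0), intervalIntegral.integral_zero]
    intro y hy
    refine h y fun hy2 => ?_
    have := (Set.mem_uIcc.1 hy)
    rcases this with h3 | h3 <;> linarith [hy2.1, h3.1, h3.2]
  · have hxc : c < x := by
      by_contra! h3
      exact hx ⟨not_lt.1 hxa, h3⟩
    have h4 := intervalIntegral.integral_add_adjacent_intervals (hi 0 1) (hi 1 x)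
    rw [h0, zero_add] at h4
    rw [← h4, intervalIntegral.integral_congr (g := fun _ => 0), intervalIntegral.integral_zero]
    intro y hy
    refine h y fun hy2 => ?_
    have := (Set.mem_uIcc.1 hy)
    rcases this with h3 | h3 <;> linarith [hy2.2, h3.1, h3.2]

end cutoff

/-! ### From test functions to smooth functions on the closed cube -/

section extended

variable {s : ℕ}

theorem cube_ae_eq_openCube : cube (Fin s) =ᵐ[volume] openCube (Fin s) :=
  Measure.univ_pi_Ico_ae_eq_Icc.trans Measure.univ_pi_Ioo_ae_eq_Icc.symm

theorem measurableSet_openCube : MeasurableSet (openCube (Fin s)) :=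
  MeasurableSet.univ_pi fun _ => measurableSet_Ioo

theorem measurableSet_cube {ι : Type*} [Countable ι] : MeasurableSet (cube ι) :=
  MeasurableSet.univ_pi fun _ => measurableSet_Ico

theorem tensorPair_congr (G : (Fin s → ℝ) → ℝ) {φ ψ : Fin s → ℝ → ℝ}
    (h : ∀ j, ∀ x ∈ Set.Ioo (0 : ℝ) 1, φ j x = ψ j x) : tensorPair G φ = tensorPair G ψ := by
  rw [tensorPair, tensorPair, setIntegral_congr_set cube_ae_eq_openCube,
    setIntegral_congr_set cube_ae_eq_openCube]
  refine setIntegral_congr_fun measurableSet_openCube fun x hx => ?_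
  have : tensorFn φ x = tensorFn ψ x :=
    Finset.prod_congr rfl fun j _ => h j (x j) (hx j (Set.mem_univ j))
  simp only [this]

theorem tendsto_tensorPair {G : (Fin s → ℝ) → ℝ} (hG : IntegrableOn G (cube (Fin s)))
    {Φ : ℕ → Fin s → ℝ → ℝ} {φ : Fin s → ℝ → ℝ} (hc : ∀ N j, Continuous (Φ N j)) (C : Fin s → ℝ)
    (hC : ∀ N j, ∀ x ∈ Set.Ioo (0 : ℝ) 1, |Φ N j x| ≤ C j)
    (h : ∀ j, ∀ x ∈ Set.Ioo (0 : ℝ) 1,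
      Filter.Tendsto (fun N => Φ N j x) Filter.atTop (nhds (φ j x))) :
    Filter.Tendsto (fun N => tensorPair G (Φ N)) Filter.atTop (nhds (tensorPair G φ)) := by
  have hG' : IntegrableOn G (openCube (Fin s)) := hG.congr_set_ae cube_ae_eq_openCube.symm
  simp only [tensorPair, setIntegral_congr_set cube_ae_eq_openCube]
  refine tendsto_integral_of_dominated_convergence (fun x => |G x| * ∏ j, C j) ?_ ?_ ?_ ?_
  · intro N
    exact hG'.aestronglyMeasurable.mul (continuous_tensorFn (hc N)).aestronglyMeasurable
  · exact hG'.abs.mul_const _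
  · intro N
    filter_upwards [ae_restrict_mem measurableSet_openCube] with x hx
    rw [Real.norm_eq_abs, abs_mul, tensorFn, Finset.abs_prod]
    gcongr with j _
    exact hC N j _ (hx j (Set.mem_univ j))
  · filter_upwards [ae_restrict_mem measurableSet_openCube] with x hx
    exact (tendsto_finsetProd _ fun j _ => h j _ (hx j (Set.mem_univ j))).const_mul _

theorem exists_bound_Icc {u : ℝ → ℝ} (hu : Continuous u) :
    ∃ C, 0 ≤ C ∧ ∀ x ∈ Set.Icc (0 : ℝ) 1, |u x| ≤ C := by
  obtain ⟨C, hC⟩ := isCompact_Icc.exists_bound_of_continuousOn (s := Set.Icc (0 : ℝ) 1)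
    hu.continuousOn
  exact ⟨C, (abs_nonneg _).trans (hC 0 (by simp)), fun x hx => hC x hx⟩

/-- Integration by parts in the `j`-th coordinate, for products of smooth functions whose `j`-th
factor vanishes at the endpoints. -/
theorem IsWeakDeriv.tensorPair_primitive {f G G' : (Fin s → ℝ) → ℝ} {β : Fin s → ℕ} {j : Fin s}
    (h : IsWeakDeriv β f G) (h' : IsWeakDeriv (Function.update β j (β j + 1)) f G')
    {φ : Fin s → ℝ → ℝ} (hφ : ∀ j, ContDiff ℝ ∞ (φ j)) {u : ℝ → ℝ} (hu : ContDiff ℝ ∞ u)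
    (hu0 : ∫ y in (0 : ℝ)..1, u y = 0) :
    tensorPair G (Function.update φ j u) =
      -tensorPair G' (Function.update φ j fun x => ∫ y in (0 : ℝ)..x, u y) := by
  set ρ : ℝ → ℝ := fun x => cutoff 0 x / ∫ y in (0 : ℝ)..1, cutoff 0 y with hρ
  have hρs : ContDiff ℝ ∞ ρ := (contDiff_cutoff 0).div_const _
  have hρ1 : ∫ y in (0 : ℝ)..1, ρ y = 1 := by
    rw [hρ, intervalIntegral.integral_div, div_self (integral_cutoff_pos 0).ne']
  set m : ℕ → ℝ := fun N => ∫ y in (0 : ℝ)..1, u y * cutoff N y with hm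
  -- Cutting off `u` destroys its vanishing mean. Subtracting `m N` times a bump of integral `1`
  -- restores it, so the primitive of `v N` has compact support; `m N → 0` because `u` has mean
  -- zero.
  set v : ℕ → ℝ → ℝ := fun N x => u x * cutoff N x - m N * ρ x with hv
  have hvs : ∀ N, ContDiff ℝ ∞ (v N) := fun N =>
    (hu.mul (contDiff_cutoff N)).sub (contDiff_const.mul hρs)
  obtain ⟨C, hC0, hC⟩ := exists_bound_Icc hu.continuous
  obtain ⟨D, hD0, hD⟩ := exists_bound_Icc hρs.continuous
  have hucut : ∀ N, ∀ x ∈ Set.Icc (0 : ℝ) 1, |u x * cutoff N x| ≤ C := by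
    intro N x hx
    rw [abs_mul, abs_of_nonneg (cutoff_nonneg N x)]
    nlinarith [hC x hx, cutoff_le_one N x, cutoff_nonneg N x, abs_nonneg (u x)]
  have hmC : ∀ N, |m N| ≤ C := by
    intro N
    have := intervalIntegral.norm_integral_le_of_norm_le_const (a := (0 : ℝ)) (b := 1)
      (f := fun y => u y * cutoff N y) (C := C) fun y hy => by
        rw [Set.uIoc_of_le zero_le_one] at hy
        exact hucut N y ⟨hy.1.le, hy.2⟩
    simpa using this
  have hvB : ∀ N, ∀ x ∈ Set.Icc (0 : ℝ) 1, |v N x| ≤ C + C * D := by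
    intro N x hx
    refine (abs_sub _ _).trans (add_le_add (hucut N x hx) ?_)
    rw [abs_mul]
    exact mul_le_mul (hmC N) (hD x hx) (abs_nonneg _) hC0
  have hne1 : ∀ᵐ y : ℝ, y ≠ 1 := by simp [ae_iff, measure_singleton]
  have hmt : Filter.Tendsto m Filter.atTop (nhds 0) := by
    rw [← hu0]
    refine intervalIntegral.tendsto_integral_filter_of_dominated_convergence (fun _ => C)
      (Filter.Eventually.of_forall fun N => ?_) (Filter.Eventually.of_forall fun N => ?_)
      intervalIntegrable_const ?_
    · exact (hu.continuous.mul (contDiff_cutoff N).continuous).aestronglyMeasurable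
    · refine ae_of_all _ fun y hy => ?_
      rw [Set.uIoc_of_le zero_le_one] at hy
      exact hucut N y ⟨hy.1.le, hy.2⟩
    · filter_upwards [hne1] with y hy1 hy
      rw [Set.uIoc_of_le zero_le_one] at hy
      simpa using (tendsto_cutoff ⟨hy.1, lt_of_le_of_ne hy.2 hy1⟩).const_mul (u y)
  have hvt : ∀ x ∈ Set.Ioo (0 : ℝ) 1,
      Filter.Tendsto (fun N => v N x) Filter.atTop (nhds (u x)) := by
    intro x hx
    simpa using ((tendsto_cutoff hx).const_mul (u x)).sub (hmt.mul_const (ρ x))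
  have hv0 : ∀ N, ∫ y in (0 : ℝ)..1, v N y = 0 := by
    intro N
    rw [hv, intervalIntegral.integral_sub, intervalIntegral.integral_const_mul, hρ1, mul_one, sub_self]
    · exact (hu.continuous.mul (contDiff_cutoff N).continuous).intervalIntegrable _ _
    · exact (continuous_const.mul hρs.continuous).intervalIntegrable _ _
  have hpv : ∀ N, IsTest fun x => ∫ y in (0 : ℝ)..x, v N y := by
    intro N
    have hN0 : (0 : ℝ) ≤ N := by positivity
    have h1 : (0 : ℝ) < 1 / ((N : ℝ) + 3) := by positivity
    have h3 : 1 / ((N : ℝ) + 3) ≤ 1 / 3 := by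
      gcongr; linarith
    refine isTest_primitive (hvs N) h1 (by linarith : 1 - 1 / ((N : ℝ) + 3) < 1)
      (fun x hx => ?_) (hv0 N)
    have h4 : cutoff 0 x = 0 := by
      refine cutoff_eq_zero fun h5 => hx ?_
      simp only [Nat.cast_zero, zero_add] at h5
      exact ⟨h3.trans h5.1, h5.2.trans (by linarith)⟩
    simp only [hv, hρ, cutoff_eq_zero hx, h4, mul_zero, zero_div, sub_zero]
  have hpB : ∀ N, ∀ x ∈ Set.Icc (0 : ℝ) 1, |∫ y in (0 : ℝ)..x, v N y| ≤ C + C * D := by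
    intro N x hx
    have := intervalIntegral.norm_integral_le_of_norm_le_const (a := (0 : ℝ)) (b := x)
      (f := v N) (C := C + C * D) fun y hy => by
        rw [Set.uIoc_of_le hx.1] at hy
        exact hvB N y ⟨hy.1.le, hy.2.trans hx.2⟩
    refine this.trans ?_
    rw [sub_zero, abs_of_nonneg hx.1]
    exact mul_le_of_le_one_right (by positivity) hx.2
  have hpt : ∀ x ∈ Set.Ioo (0 : ℝ) 1, Filter.Tendsto (fun N => ∫ y in (0 : ℝ)..x, v N y)
      Filter.atTop (nhds (∫ y in (0 : ℝ)..x, u y)) := by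
    intro x hx
    refine intervalIntegral.tendsto_integral_filter_of_dominated_convergence (fun _ => C + C * D)
      (Filter.Eventually.of_forall fun N => ?_) (Filter.Eventually.of_forall fun N => ?_)
      intervalIntegrable_const ?_
    · exact (hvs N).continuous.aestronglyMeasurable
    · refine ae_of_all _ fun y hy => ?_
      rw [Set.uIoc_of_le hx.1.le] at hy
      exact hvB N y ⟨hy.1.le, hy.2.trans hx.2.le⟩
    · refine ae_of_all _ fun y hy => ?_
      rw [Set.uIoc_of_le hx.1.le] at hy
      exact hvt y ⟨hy.1, hy.2.trans_lt hx.2⟩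
  -- pass to the limit
  choose B hB0 hB using fun i => exists_bound_Icc (hφ i).continuous
  -- The `j`-th factor is built as a primitive, and the other factors are not differentiated. No
  -- derivative of a cut-off ever occurs, so dominated convergence applies.
  set Ψ : ℕ → Fin s → ℝ → ℝ := fun N =>
    Function.update (fun i x => φ i x * cutoff N x) j fun x => ∫ y in (0 : ℝ)..x, v N y with hΨ
  have hΨt : ∀ N i, IsTest (Ψ N i) := by
    intro N i
    rcases eq_or_ne i j with rfl | hij
    · simp only [hΨ, Function.update_self]; exact hpv N
    · simp only [hΨ, Function.update_of_ne hij]; exact isTest_mul_cutoff (hφ i) N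
  have hd : ∀ N, deriv (Ψ N j) = v N := by
    intro N
    simp only [hΨ, Function.update_self]
    exact funext fun x => ((hvs N).continuous.integral_hasStrictDerivAt 0 x).hasDerivAt.deriv
  have hcutB : ∀ N i, ∀ x ∈ Set.Ioo (0 : ℝ) 1, |φ i x * cutoff N x| ≤ B i := by
    intro N i x hx
    rw [abs_mul, abs_of_nonneg (cutoff_nonneg N x)]
    nlinarith [hB i x ⟨hx.1.le, hx.2.le⟩, cutoff_le_one N x, cutoff_nonneg N x, abs_nonneg (φ i x)]
  have hcutT : ∀ i, ∀ x ∈ Set.Ioo (0 : ℝ) 1,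
      Filter.Tendsto (fun N => φ i x * cutoff N x) Filter.atTop (nhds (φ i x)) := by
    intro i x hx
    simpa using (tendsto_cutoff hx).const_mul (φ i x)
  have l1 : Filter.Tendsto (fun N => tensorPair G (Function.update (Ψ N) j (v N))) Filter.atTop
      (nhds (tensorPair G (Function.update φ j u))) := by
    refine tendsto_tensorPair h.1 ?_ (Function.update B j (C + C * D)) ?_ ?_
    · intro N i
      rcases eq_or_ne i j with rfl | hij
      · rw [Function.update_self]; exact (hvs N).continuous
      · rw [Function.update_of_ne hij]; exact (hΨt N i).contDiff.continuous
    · intro N i x hx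
      rcases eq_or_ne i j with rfl | hij
      · rw [Function.update_self, Function.update_self]; exact hvB N x ⟨hx.1.le, hx.2.le⟩
      · simp only [hΨ, Function.update_of_ne hij]; exact hcutB N i x hx
    · intro i x hx
      rcases eq_or_ne i j with rfl | hij
      · simp only [Function.update_self]; exact hvt x hx
      · simp only [hΨ, Function.update_of_ne hij]; exact hcutT i x hx
  have l2 : Filter.Tendsto (fun N => -tensorPair G' (Ψ N)) Filter.atTop
      (nhds (-tensorPair G' (Function.update φ j fun x => ∫ y in (0 : ℝ)..x, u y))) := by
    refine (tendsto_tensorPair h'.1 (fun N i => (hΨt N i).contDiff.continuous)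
      (Function.update B j (C + C * D)) ?_ ?_).neg
    · intro N i x hx
      rcases eq_or_ne i j with rfl | hij
      · simp only [hΨ, Function.update_self]; exact hpB N x ⟨hx.1.le, hx.2.le⟩
      · simp only [hΨ, Function.update_of_ne hij]; exact hcutB N i x hx
    · intro i x hx
      rcases eq_or_ne i j with rfl | hij
      · simp only [hΨ, Function.update_self]; exact hpt x hx
      · simp only [hΨ, Function.update_of_ne hij]; exact hcutT i x hx
  refine tendsto_nhds_unique l1 (l2.congr fun N => ?_)
  rw [← h.tensorPair_deriv h' (hΨt N), hd]

end extended

end ExtrapolatedLattice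

namespace ExtrapolatedLattice

/-! ### Expansion in one coordinate -/

/-- A smooth function on `ℝ` which for `t ≥ 1` agrees on `[0,1)` with
`x ↦ ∫_0^1 b̃_t(x - y) ψ(y) dy`. -/
noncomputable def bernSmooth : ℕ → (ℝ → ℝ) → ℝ → ℝ
  | 0, ψ, x => (∫ y in (0 : ℝ)..1, ψ y) - ψ x
  | t + 1, ψ, x => bernSmooth t (fun z => ∫ y in (0 : ℝ)..z, ψ y) x +
      bernNorm (t + 1) x * ∫ y in (0 : ℝ)..1, ψ y

theorem contDiff_bernNorm (t : ℕ) : ContDiff ℝ ∞ (bernNorm t) :=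
  ((contDiff_bernoulliFun t).of_le le_top).div_const _

theorem contDiff_bernSmooth (t : ℕ) {ψ : ℝ → ℝ} (hψ : ContDiff ℝ ∞ ψ) :
    ContDiff ℝ ∞ (bernSmooth t ψ) := by
  induction t generalizing ψ with
  | zero => exact contDiff_const.sub hψ
  | succ t ih => exact (ih (contDiff_primitive hψ)).add ((contDiff_bernNorm _).mul contDiff_const)

theorem hasDerivAt_bernSmooth (t : ℕ) {ψ : ℝ → ℝ} (hψ : ContDiff ℝ ∞ ψ) (x : ℝ) :
    HasDerivAt (bernSmooth (t + 1) ψ) (bernSmooth t ψ x) x := by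
  induction t generalizing ψ with
  | zero =>
    have h1 := (hψ.continuous.integral_hasStrictDerivAt 0 x).hasDerivAt
    have h2 := (h1.const_sub (∫ z in (0 : ℝ)..1, ∫ y in (0 : ℝ)..z, ψ y)).add
      ((hasDerivAt_bernNorm 0 x).mul_const (∫ y in (0 : ℝ)..1, ψ y))
    refine h2.congr_deriv ?_
    rw [bernSmooth, bernNorm_zero]
    ring
  | succ t ih => exact (ih (contDiff_primitive hψ)).add ((hasDerivAt_bernNorm _ x).mul_const _)

theorem integral_bernSmooth (t : ℕ) {ψ : ℝ → ℝ} (hψ : ContDiff ℝ ∞ ψ) :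
    ∫ x in (0 : ℝ)..1, bernSmooth t ψ x = 0 := by
  induction t generalizing ψ with
  | zero =>
    simp only [bernSmooth]
    rw [intervalIntegral.integral_sub intervalIntegrable_const (hψ.continuous.intervalIntegrable _ _)]
    simp
  | succ t ih =>
    simp only [bernSmooth]
    rw [intervalIntegral.integral_add, ih (contDiff_primitive hψ), intervalIntegral.integral_mul_const,
      integral_bernNorm, zero_mul, add_zero]
    · exact (contDiff_bernSmooth t (contDiff_primitive hψ)).continuous.intervalIntegrable _ _
    · exact Continuous.intervalIntegrable (by fun_prop) _ _

/-- The recursion of `bernSmooth` is that of `bernConv_succ`; its initial value contains `-ψ x` to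
account for the jump term. -/
theorem bernSmooth_eq_bernConv (t : ℕ) {ψ : ℝ → ℝ} (hψ : ContDiff ℝ ∞ ψ) {x : ℝ}
    (hx : x ∈ Set.Ico (0 : ℝ) 1) :
    (bernSmooth t ψ x : ℂ) = bernConv t (fun y => (ψ y : ℂ)) x - if t = 0 then (ψ x : ℂ) else 0 := by
  induction t generalizing ψ with
  | zero =>
    rw [bernConv_zero, intervalIntegral.integral_ofReal, if_pos rfl, bernSmooth]
    push_cast
    rfl
  | succ t ih =>
    rw [if_neg (Nat.succ_ne_zero t), sub_zero, bernSmooth, Complex.ofReal_add, Complex.ofReal_mul,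
      ih (contDiff_primitive hψ),
      bernConv_succ (H := fun z => ((∫ y in (0 : ℝ)..z, ψ y : ℝ) : ℂ)) _ _ hx]
    · exact (Complex.continuous_ofReal.comp hψ.continuous).intervalIntegrable _ _
    · intro y _
      rw [intervalIntegral.integral_ofReal]

theorem bernSmooth_eq_integral {t : ℕ} (ht : t ≠ 0) {ψ : ℝ → ℝ} (hψ : ContDiff ℝ ∞ ψ) {x : ℝ}
    (hx : x ∈ Set.Ico (0 : ℝ) 1) :
    bernSmooth t ψ x = ∫ y in (0 : ℝ)..1, bernTilde t (x - y) * ψ y := by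
  have h := bernSmooth_eq_bernConv t hψ hx
  rw [if_neg ht, sub_zero, bernConv] at h
  have h2 : ((∫ y in (0 : ℝ)..1, bernTilde t (x - y) * ψ y : ℝ) : ℂ) =
      ∫ y in (0 : ℝ)..1, (bernTilde t (x - y) : ℂ) * (ψ y : ℂ) := by
    rw [← intervalIntegral.integral_ofReal]
    push_cast
    rfl
  rw [← h2] at h
  exact_mod_cast h

theorem bernNorm_one_sub (t : ℕ) (y : ℝ) : bernNorm t (1 - y) = (-1) ^ t * bernNorm t y := by
  rw [bernNorm, bernNorm, bernoulliFun_eval_one_sub, mul_div_assoc]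

/-- The reflection `b_t(1 - y) = (-1)^t b_t(y)` turns the value at `0` into an expansion
coefficient. -/
theorem bernSmooth_at_zero {t : ℕ} (ht : t ≠ 0) {ψ : ℝ → ℝ} (hψ : ContDiff ℝ ∞ ψ) :
    bernSmooth t ψ 0 = (-1) ^ t * ∫ y in (0 : ℝ)..1, bernNorm t y * ψ y := by
  rw [bernSmooth_eq_integral ht hψ (by simp), ← intervalIntegral.integral_const_mul]
  refine intervalIntegral.integral_congr_ae (ae_of_all _ fun y hy => ?_)
  rw [Set.uIoc_of_le zero_le_one] at hy
  rw [bernTilde_sub_of_lt t le_rfl hy.2 hy.1, show (0 : ℝ) - y + 1 = 1 - y by ring,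
    bernNorm_one_sub, mul_assoc]

theorem bernSmooth_succ_sub (t : ℕ) {ψ : ℝ → ℝ} (hψ : ContDiff ℝ ∞ ψ) (x : ℝ) :
    ∫ y in (0 : ℝ)..x, bernSmooth t ψ y = bernSmooth (t + 1) ψ x - bernSmooth (t + 1) ψ 0 :=
  intervalIntegral.integral_eq_sub_of_hasDerivAt (fun y _ => hasDerivAt_bernSmooth t hψ y)
    ((contDiff_bernSmooth t hψ).continuous.intervalIntegrable _ _)

/-! ### Euler–Maclaurin expansion in one coordinate, in dual form -/

section coordinate

variable {s : ℕ}

theorem integrableOn_mul_tensorFn {G : (Fin s → ℝ) → ℝ} (hG : IntegrableOn G (cube (Fin s)))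
    {φ : Fin s → ℝ → ℝ} (hφ : ∀ j, Continuous (φ j)) :
    IntegrableOn (fun x => G x * tensorFn φ x) (cube (Fin s)) := by
  choose B hB0 hB using fun i => exists_bound_Icc (hφ i)
  refine Integrable.mul_bdd (c := ∏ j, B j) hG (continuous_tensorFn hφ).aestronglyMeasurable ?_
  filter_upwards [ae_restrict_mem measurableSet_cube] with x hx
  rw [Real.norm_eq_abs, tensorFn, Finset.abs_prod]
  refine Finset.prod_le_prod (fun _ _ => abs_nonneg _) fun j _ => hB j _ ?_
  have := hx j (Set.mem_univ j)
  exact ⟨this.1, this.2.le⟩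

theorem tensorPair_update_linear {G : (Fin s → ℝ) → ℝ} (hG : IntegrableOn G (cube (Fin s)))
    {φ : Fin s → ℝ → ℝ} (hφ : ∀ j, Continuous (φ j)) (j : Fin s) {u v : ℝ → ℝ} (hu : Continuous u)
    (hv : Continuous v) (a c : ℝ) :
    tensorPair G (Function.update φ j fun x => a * u x + c * v x) =
      a * tensorPair G (Function.update φ j u) + c * tensorPair G (Function.update φ j v) := by
  have hup : ∀ {w : ℝ → ℝ}, Continuous w → ∀ i, Continuous (Function.update φ j w i) := by
    intro w hw i
    rcases eq_or_ne i j with rfl | hij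
    · rwa [Function.update_self]
    · rw [Function.update_of_ne hij]; exact hφ i
  rw [tensorPair, tensorPair, tensorPair, ← integral_const_mul, ← integral_const_mul,
    ← integral_add ((integrableOn_mul_tensorFn hG (hup hu)).const_mul a)
      ((integrableOn_mul_tensorFn hG (hup hv)).const_mul c)]
  congr 1
  ext x
  simp only [tensorFn_update]
  ring

theorem tensorPair_update_const {G : (Fin s → ℝ) → ℝ} (φ : Fin s → ℝ → ℝ) (j : Fin s) (a : ℝ)
    (u : ℝ → ℝ) :
    tensorPair G (Function.update φ j fun x => a * u x) = a * tensorPair G (Function.update φ j u) := by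
  rw [tensorPair, tensorPair, ← integral_const_mul]
  congr 1
  ext x
  simp only [tensorFn_update]
  ring

/-- The integral operator with kernel `kern α i`. -/
noncomputable def kernOp (α i : ℕ) (ψ : ℝ → ℝ) (x : ℝ) : ℝ := ∫ y in (0 : ℝ)..1, kern α i x y * ψ y

/-- A smooth function that agrees with `kernOp α i ψ` on `[0,1)`. -/
noncomputable def kernOpSmooth (α i : ℕ) (ψ : ℝ → ℝ) (x : ℝ) : ℝ :=
  if i ≤ α then ∫ y in (0 : ℝ)..1, bernNorm i y * ψ y else (-1) ^ (α + 1) * bernSmooth α ψ x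

theorem contDiff_kernOpSmooth (α i : ℕ) {ψ : ℝ → ℝ} (hψ : ContDiff ℝ ∞ ψ) :
    ContDiff ℝ ∞ (kernOpSmooth α i ψ) := by
  unfold kernOpSmooth
  split_ifs
  · exact contDiff_const
  · exact contDiff_const.mul (contDiff_bernSmooth α hψ)

theorem kernOpSmooth_eq {α : ℕ} (hα : α ≠ 0) (i : ℕ) {ψ : ℝ → ℝ} (hψ : ContDiff ℝ ∞ ψ) {x : ℝ}
    (hx : x ∈ Set.Ico (0 : ℝ) 1) : kernOpSmooth α i ψ x = kernOp α i ψ x := by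
  unfold kernOpSmooth kernOp kern
  split_ifs
  · rfl
  · rw [bernSmooth_eq_integral hα hψ hx, ← intervalIntegral.integral_const_mul]
    simp only [mul_assoc]

/-- Write `ψ` as its mean minus the mean-free `bernSmooth 0 ψ` and integrate by parts `α` times. The
primitive that vanishes at both endpoints differs from the mean-free `bernSmooth (t + 1) ψ` by the
value of the latter at `0`, which yields the coefficient `∫ b_{t+1} ψ`. -/
theorem tensorPair_expand_coordinate {f : (Fin s → ℝ) → ℝ} {α : ℕ} {β : Fin s → ℕ} {j : Fin s}
    {G : ℕ → (Fin s → ℝ) → ℝ} (hG : ∀ t ≤ α, IsWeakDeriv (Function.update β j t) f (G t))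
    {φ : Fin s → ℝ → ℝ} (hφ : ∀ j, ContDiff ℝ ∞ (φ j)) {ψ : ℝ → ℝ} (hψ : ContDiff ℝ ∞ ψ) :
    tensorPair (G 0) (Function.update φ j ψ) = ∑ i ∈ Finset.range (α + 2),
      tensorPair (G (min i α)) (Function.update φ j (kernOpSmooth α i ψ)) := by
  have hφc : ∀ j, Continuous (φ j) := fun j => (hφ j).continuous
  set c : ℕ → ℝ := fun t => ∫ y in (0 : ℝ)..1, bernNorm t y * ψ y with hc
  have key : ∀ n ≤ α, tensorPair (G 0) (Function.update φ j ψ) =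
      ∑ t ∈ Finset.range (n + 1), c t * tensorPair (G t) (Function.update φ j fun _ => 1) +
        (-1) ^ (n + 1) * tensorPair (G n) (Function.update φ j (bernSmooth n ψ)) := by
    intro n hn
    induction n with
    | zero =>
      have h := tensorPair_update_linear (hG 0 (Nat.zero_le _)).1 hφc j (u := fun _ => 1)
        (v := bernSmooth 0 ψ) continuous_const (contDiff_bernSmooth 0 hψ).continuous (c 0) (-1)
      have e : (fun x => c 0 * 1 + -1 * bernSmooth 0 ψ x) = ψ := by
        ext x
        simp only [hc, bernSmooth, bernNorm_zero, one_mul]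
        ring
      rw [e] at h
      rw [h]
      simp
    | succ n ih =>
      rw [ih (by omega), Finset.sum_range_succ _ (n + 1)]
      have h1 := (hG n (by omega)).tensorPair_primitive (j := j)
        (by simpa using hG (n + 1) hn) hφ (contDiff_bernSmooth n hψ) (integral_bernSmooth n hψ)
      have h2 := tensorPair_update_linear (hG (n + 1) hn).1 hφc j (u := bernSmooth (n + 1) ψ)
        (v := fun _ => 1) (contDiff_bernSmooth (n + 1) hψ).continuous continuous_const 1
        (-bernSmooth (n + 1) ψ 0)
      have e : (fun x => 1 * bernSmooth (n + 1) ψ x + -bernSmooth (n + 1) ψ 0 * 1) =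
          fun x => ∫ y in (0 : ℝ)..x, bernSmooth n ψ y := by
        ext x
        rw [bernSmooth_succ_sub n hψ]
        ring
      rw [e, bernSmooth_at_zero (t := n + 1) (Nat.succ_ne_zero n) hψ] at h2
      rw [h1, h2]
      have h3 : ((-1 : ℝ)) ^ (n + 1) * (-1) ^ (n + 1) = 1 := by
        rw [← mul_pow]; simp
      have h4 : c (n + 1) = ∫ y in (0 : ℝ)..1, bernNorm (n + 1) y * ψ y := rfl
      rw [← h4]
      linear_combination (c (n + 1) *
        tensorPair (G (n + 1)) (Function.update φ j fun _ => 1)) * h3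
  rw [key α le_rfl, Finset.sum_range_succ _ (α + 1)]
  congr 1
  · refine Finset.sum_congr rfl fun i hi => ?_
    have hi' : i ≤ α := by rw [Finset.mem_range] at hi; omega
    rw [min_eq_left hi', ← tensorPair_update_const]
    congr 2
    ext x
    rw [kernOpSmooth, if_pos hi', mul_one]
  · rw [min_eq_right (by omega), ← tensorPair_update_const]
    congr 2
    ext x
    rw [kernOpSmooth, if_neg (by omega)]

end coordinate

end ExtrapolatedLattice

namespace ExtrapolatedLattice

/-! ### Expansion in all coordinates -/

/-- Here `none` marks a coordinate not yet expanded; the hypothesis expands any one of them. -/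
theorem sum_option_expand {I : Type*} [Fintype I] {n : ℕ} (Φ : (Fin n → Option I) → ℝ)
    (h : ∀ c j, c j = none → Φ c = ∑ i, Φ (Function.update c j (some i))) :
    Φ (fun _ => none) = ∑ κ : Fin n → I, Φ fun j => some (κ j) := by
  induction n with
  | zero =>
    rw [Fintype.sum_unique]
    congr 1
    ext j
    exact j.elim0
  | succ n ih =>
    rw [h (fun _ => none) 0 rfl, ← (Fin.consEquiv fun _ => I).sum_comp, Fintype.sum_prod_type]
    refine Finset.sum_congr rfl fun i _ => ?_
    have := ih (fun c => Φ (Fin.cons (some i) c)) fun c j hc => by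
      rw [h (Fin.cons (some i) c) j.succ (by simpa using hc)]
      simp only [Fin.cons_update]
    convert this using 1
    · congr 1
      ext j : 1
      refine Fin.cases ?_ (fun j => ?_) j <;> simp
    · refine Finset.sum_congr rfl fun κ _ => ?_
      congr 1
      ext j : 1
      refine Fin.cases ?_ (fun j => ?_) j <;> simp [Fin.consEquiv]

/-- The multi-index of derivatives belonging to a choice of kernels. -/
def kernOrder {s : ℕ} (α : ℕ) (κ : Fin s → Fin (α + 2)) : Fin s → ℕ := fun j => min (κ j : ℕ) α

variable {s : ℕ} {f : (Fin s → ℝ) → ℝ} {α : ℕ}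

theorem isWeakDeriv_weakDeriv {β : Fin s → ℕ} (h : ∃ g, IsWeakDeriv β f g) :
    IsWeakDeriv β f (weakDeriv β f) := by
  rw [weakDeriv, dif_pos h]
  exact h.choose_spec

theorem tensorPair_weakDeriv_expand (hf : ∀ β : Fin s → ℕ, (∀ j, β j ≤ α) → ∃ g, IsWeakDeriv β f g)
    {ψ : Fin s → ℝ → ℝ} (hψ : ∀ j, ContDiff ℝ ∞ (ψ j)) :
    tensorPair (weakDeriv (fun _ => 0) f) ψ = ∑ κ : Fin s → Fin (α + 2),
      tensorPair (weakDeriv (kernOrder α κ) f) fun j => kernOpSmooth α (κ j) (ψ j) := by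
  -- An unexpanded coordinate carries no derivative and its original factor; an expanded one carries
  -- the order `min i α` and the image of its factor under the kernel `i`.
  set ord : (Fin s → Option (Fin (α + 2))) → Fin s → ℕ :=
    fun c j => (c j).elim 0 fun i => min (i : ℕ) α with hord
  set fn : (Fin s → Option (Fin (α + 2))) → Fin s → ℝ → ℝ :=
    fun c j => (c j).elim (ψ j) fun i => kernOpSmooth α i (ψ j) with hfn
  have hfnc : ∀ c j, ContDiff ℝ ∞ (fn c j) := by
    intro c j
    simp only [hfn]
    cases c j with
    | none => exact hψ j
    | some i => exact contDiff_kernOpSmooth _ _ (hψ j)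
  have hordle : ∀ c j, ord c j ≤ α := by
    intro c j
    simp only [hord]
    cases c j with
    | none => exact Nat.zero_le _
    | some i => exact min_le_right _ _
  refine sum_option_expand (fun c => tensorPair (weakDeriv (ord c) f) (fn c)) fun c j hc => ?_
  have e := tensorPair_expand_coordinate (j := j) (β := ord c)
    (G := fun t => weakDeriv (Function.update (ord c) j t) f) (α := α)
    (fun t ht => isWeakDeriv_weakDeriv (hf _ fun i => by
      rcases eq_or_ne i j with rfl | hij
      · rwa [Function.update_self]
      · rw [Function.update_of_ne hij]; exact hordle c i)) (hfnc c) (hψ j)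
  have e1 : Function.update (ord c) j 0 = ord c := by
    rw [Function.update_eq_self_iff]; simp [hord, hc]
  have e2 : Function.update (fn c) j (ψ j) = fn c := by
    rw [Function.update_eq_self_iff]; simp [hfn, hc]
  rw [e1, e2] at e
  rw [e, Finset.sum_range]
  refine Finset.sum_congr rfl fun i _ => ?_
  congr 2
  · ext k
    rcases eq_or_ne k j with rfl | hkj
    · simp [hord]
    · simp [hord, hkj]
  · ext k : 1
    rcases eq_or_ne k j with rfl | hkj
    · simp [hfn]
    · simp [hfn, hkj]

end ExtrapolatedLattice

namespace ExtrapolatedLattice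

/-! ### Integral representation -/

theorem restrict_cube (ι : Type*) [Fintype ι] :
    (volume : Measure (ι → ℝ)).restrict (cube ι) =
      Measure.pi fun _ => (volume : Measure ℝ).restrict (Set.Ico 0 1) := by
  rw [cube, volume_pi, Measure.restrict_pi_pi]

instance isProbabilityMeasure_restrict_Ico :
    IsProbabilityMeasure ((volume : Measure ℝ).restrict (Set.Ico 0 1)) :=
  ⟨by simp⟩

instance isProbabilityMeasure_restrict_cube (ι : Type*) [Fintype ι] :
    IsProbabilityMeasure ((volume : Measure (ι → ℝ)).restrict (cube ι)) := by
  rw [restrict_cube]; infer_instance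

theorem integral_cube_prod {s : ℕ} (F : Fin s → ℝ → ℝ) :
    ∫ y in cube (Fin s), ∏ j, F j (y j) = ∏ j, ∫ y in (0 : ℝ)..1, F j y := by
  rw [restrict_cube, integral_fintype_prod_eq_prod]
  refine Finset.prod_congr rfl fun j _ => ?_
  rw [intervalIntegral.integral_of_le zero_le_one, integral_Ico_eq_integral_Ioc]

variable {s : ℕ} {α : ℕ}

/-- The integral of `G` against a product of kernels. -/
noncomputable def kernIntegral (α : ℕ) (κ : Fin s → Fin (α + 2)) (G : (Fin s → ℝ) → ℝ)
    (y : Fin s → ℝ) : ℝ := ∫ x in cube (Fin s), G x * ∏ j, kern α (κ j) (x j) (y j)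

theorem exists_bound_kern (hα : 2 ≤ α) (i : ℕ) :
    ∃ C, 0 ≤ C ∧ ∀ x ∈ Set.Icc (0 : ℝ) 1, ∀ y ∈ Set.Icc (-1 : ℝ) 2, |kern α i x y| ≤ C := by
  obtain ⟨C, hC⟩ := (isCompact_Icc.prod isCompact_Icc).exists_bound_of_continuousOn
    (s := Set.Icc (0 : ℝ) 1 ×ˢ Set.Icc (-1 : ℝ) 2) (continuous_kern hα i).continuousOn
  exact ⟨C, (abs_nonneg _).trans (hC (0, 0) (by simp)), fun x hx y hy => hC (x, y) ⟨hx, hy⟩⟩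

theorem abs_prod_kern_le {κ : Fin s → Fin (α + 2)} {C : Fin s → ℝ}
    (hC : ∀ j, ∀ x ∈ Set.Icc (0 : ℝ) 1, ∀ y ∈ Set.Icc (-1 : ℝ) 2, |kern α (κ j) x y| ≤ C j)
    {x y : Fin s → ℝ} (hx : x ∈ cube (Fin s)) (hy : ∀ j, y j ∈ Set.Icc (-1 : ℝ) 2) :
    |∏ j, kern α (κ j) (x j) (y j)| ≤ ∏ j, C j := by
  rw [Finset.abs_prod]
  refine Finset.prod_le_prod (fun _ _ => abs_nonneg _) fun j _ => hC j _ ?_ _ (hy j)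
  have := hx j (Set.mem_univ j)
  exact ⟨this.1, this.2.le⟩

theorem continuous_prod_kern (hα : 2 ≤ α) (κ : Fin s → Fin (α + 2)) :
    Continuous fun z : (Fin s → ℝ) × (Fin s → ℝ) => ∏ j, kern α (κ j) (z.1 j) (z.2 j) :=
  continuous_finsetProd _ fun j _ => by
    have h : Continuous fun z : (Fin s → ℝ) × (Fin s → ℝ) => (z.1 j, z.2 j) := by fun_prop
    exact (continuous_kern hα (κ j)).comp h

theorem mem_Icc_of_mem_cube {y : Fin s → ℝ} (hy : y ∈ cube (Fin s)) (j : Fin s) :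
    y j ∈ Set.Icc (-1 : ℝ) 2 := by
  have := hy j (Set.mem_univ j)
  exact ⟨by linarith [this.1], by linarith [this.2]⟩

theorem integrableOn_mul_prod_kern (hα : 2 ≤ α) (κ : Fin s → Fin (α + 2)) {G : (Fin s → ℝ) → ℝ}
    (hG : IntegrableOn G (cube (Fin s))) {y : Fin s → ℝ} (hy : y ∈ cube (Fin s)) :
    IntegrableOn (fun x => G x * ∏ j, kern α (κ j) (x j) (y j)) (cube (Fin s)) := by
  choose C hC0 hC using fun j => exists_bound_kern hα (κ j)
  refine Integrable.mul_bdd (c := ∏ j, C j) hG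
    ((continuous_prod_kern hα κ).comp (Continuous.prodMk_left y)).aestronglyMeasurable ?_
  filter_upwards [ae_restrict_mem measurableSet_cube] with x hx
  exact abs_prod_kern_le hC hx (mem_Icc_of_mem_cube hy)

theorem continuousOn_kernIntegral (hα : 2 ≤ α) (κ : Fin s → Fin (α + 2)) {G : (Fin s → ℝ) → ℝ}
    (hG : IntegrableOn G (cube (Fin s))) : ContinuousOn (kernIntegral α κ G) (cube (Fin s)) := by
  choose C hC0 hC using fun j => exists_bound_kern hα (κ j)
  refine continuousOn_of_dominated (bound := fun x => |G x| * ∏ j, C j) (fun y hy => ?_)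
    (fun y hy => ?_) (hG.abs.mul_const _) ?_
  · exact (integrableOn_mul_prod_kern hα κ hG hy).aestronglyMeasurable
  · filter_upwards [ae_restrict_mem measurableSet_cube] with x hx
    rw [norm_mul, Real.norm_eq_abs, Real.norm_eq_abs]
    exact mul_le_mul_of_nonneg_left (abs_prod_kern_le hC hx (mem_Icc_of_mem_cube hy)) (abs_nonneg _)
  · refine Filter.Eventually.of_forall fun x => Continuous.continuousOn ?_
    exact continuous_const.mul ((continuous_prod_kern hα κ).comp (Continuous.prodMk_right x))

/-- Fubini moves the kernels from the test function to `G`. -/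
theorem tensorPair_kernOpSmooth (hα : 2 ≤ α) (κ : Fin s → Fin (α + 2)) {G : (Fin s → ℝ) → ℝ}
    (hG : IntegrableOn G (cube (Fin s))) {ψ : Fin s → ℝ → ℝ} (hψ : ∀ j, ContDiff ℝ ∞ (ψ j)) :
    tensorPair G (fun j => kernOpSmooth α (κ j) (ψ j)) =
      ∫ y in cube (Fin s), kernIntegral α κ G y * tensorFn ψ y := by
  choose C hC0 hC using fun j => exists_bound_kern hα (κ j)
  choose B hB0 hB using fun j => exists_bound_Icc (hψ j).continuous
  rw [tensorPair_congr G (ψ := fun j => kernOp α (κ j) (ψ j)) fun j x hx =>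
    kernOpSmooth_eq (by omega) _ (hψ j) ⟨hx.1.le, hx.2⟩, tensorPair]
  have h1 : ∀ x, G x * tensorFn (fun j => kernOp α (κ j) (ψ j)) x =
      ∫ y in cube (Fin s), G x * ((∏ j, kern α (κ j) (x j) (y j)) * tensorFn ψ y) := by
    intro x
    rw [integral_const_mul]
    congr 1
    simp only [tensorFn, ← Finset.prod_mul_distrib]
    rw [integral_cube_prod fun j y => kern α (κ j) (x j) y * ψ j y]
    rfl
  simp only [h1]
  rw [integral_integral_swap]
  · refine integral_congr_ae (Filter.Eventually.of_forall fun y => ?_)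
    simp only [kernIntegral]
    rw [← integral_mul_const]
    simp only [mul_assoc]
  · have hc : Continuous fun z : (Fin s → ℝ) × (Fin s → ℝ) =>
        (∏ j, kern α (κ j) (z.1 j) (z.2 j)) * tensorFn ψ z.2 :=
      (continuous_prod_kern hα κ).mul
        ((continuous_tensorFn fun j => (hψ j).continuous).comp continuous_snd)
    refine Integrable.mul_bdd (c := (∏ j, C j) * ∏ j, B j) (hG.comp_fst _)
      hc.aestronglyMeasurable ?_
    rw [Measure.prod_restrict]
    filter_upwards [ae_restrict_mem (measurableSet_cube.prod measurableSet_cube)] with z hz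
    rw [norm_mul, Real.norm_eq_abs, Real.norm_eq_abs]
    refine mul_le_mul (abs_prod_kern_le hC hz.1 (mem_Icc_of_mem_cube hz.2)) ?_ (abs_nonneg _)
      (Finset.prod_nonneg fun j _ => hC0 j)
    rw [tensorFn, Finset.abs_prod]
    refine Finset.prod_le_prod (fun _ _ => abs_nonneg _) fun j _ => hB j _ ?_
    have := hz.2 j (Set.mem_univ j)
    exact ⟨this.1, this.2.le⟩

/-- A function continuous on the open cube whose pairings with all products of test functions
vanish is zero. -/
theorem eq_zero_of_tensorPair_eq_zero {h : (Fin s → ℝ) → ℝ} (hc : ContinuousOn h (openCube (Fin s)))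
    (h0 : ∀ ψ : Fin s → ℝ → ℝ, (∀ j, IsTest (ψ j)) → tensorPair h ψ = 0) {y : Fin s → ℝ}
    (hy : y ∈ openCube (Fin s)) : h y = 0 := by
  have hopen : IsOpen (openCube (Fin s)) := isOpen_set_pi Set.finite_univ fun _ _ => isOpen_Ioo
  by_contra hne
  have hpos : 0 < h y * h y := mul_self_pos.2 hne
  have hnear : ∀ᶠ x in nhds y, x ∈ openCube (Fin s) ∧ 0 < h y * h x :=
    (hopen.eventually_mem hy).and <|
      (((hc y hy).continuousAt (hopen.mem_nhds hy)).const_mul (h y)).eventually_const_lt hpos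
  obtain ⟨ε, hε, hball⟩ := Metric.eventually_nhds_iff_ball.1 hnear
  let ψ : ∀ j, ContDiffBump (y j) := fun j => ⟨ε / 4, ε / 2, by positivity, by linarith⟩
  have hdist : ∀ x : Fin s → ℝ, (∀ j, x j ∈ Metric.closedBall (y j) (ε / 2)) →
      x ∈ Metric.ball y ε := fun x hx =>
    lt_of_le_of_lt ((dist_pi_le_iff (by positivity)).2 fun j => hx j) (by linarith)
  have htest : ∀ j, IsTest (ψ j) := by
    intro j
    refine ⟨(ψ j).contDiff, (ψ j).hasCompactSupport, ?_⟩
    rw [(ψ j).tsupport_eq]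
    intro t ht
    have := (hball (Function.update y j t) (hdist _ fun i => ?_)).1 j (Set.mem_univ j)
    · simpa using this
    · rcases eq_or_ne i j with rfl | hij
      · simpa using ht
      · rw [Function.update_of_ne hij]
        exact Metric.mem_closedBall_self (by positivity)
  -- The factor `h y` fixes the sign: near `y` the product `h y * h x` is positive, whatever the
  -- sign of `h y`.
  set F : (Fin s → ℝ) → ℝ := fun x => h y * h x * tensorFn (fun j => ψ j) x with hF
  have hts : tsupport F ⊆ tsupport (tensorFn fun j => ψ j) := closure_mono fun x hx hx0 =>
    hx (by simp only [hF, hx0, mul_zero])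
  have hFc : Continuous F := by
    refine continuous_of_tsupport fun x hx => ?_
    have hx' := tsupport_tensorFn_subset_openCube htest (hts hx)
    exact (continuousAt_const.mul ((hc x hx').continuousAt (hopen.mem_nhds hx'))).mul
      (continuous_tensorFn fun j => (ψ j).continuous).continuousAt
  have hF0 : 0 ≤ F := by
    intro x
    by_cases hx : x ∈ tsupport (tensorFn fun j => ψ j)
    · have := tsupport_tensorFn_subset _ hx
      refine mul_nonneg (hball x (hdist x fun j => ?_)).2.le
        (Finset.prod_nonneg fun j _ => (ψ j).nonneg)
      have h2 := this j (Set.mem_univ j)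
      change x j ∈ tsupport (ψ j) at h2
      rwa [(ψ j).tsupport_eq] at h2
    · simp only [hF, image_eq_zero_of_notMem_tsupport hx, mul_zero]; exact le_rfl
  have hFy : F y ≠ 0 := by
    have : tensorFn (fun j => ψ j) y = 1 := Finset.prod_eq_one fun j _ =>
      (ψ j).one_of_mem_closedBall (Metric.mem_closedBall_self (ψ j).rIn_pos.le)
    simp only [hF, this, mul_one]
    exact hpos.ne'
  have hcomp : HasCompactSupport F :=
    (hasCompactSupport_tensorFn htest).of_isClosed_subset (isClosed_tsupport _) hts
  have hI := hFc.integral_pos_of_hasCompactSupport_nonneg_nonzero (μ := volume) hcomp hF0 hFy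
  have hsupp : Function.support F ⊆ cube (Fin s) := fun x hx =>
    Set.pi_mono (fun _ _ => Set.Ioo_subset_Ico_self)
      (tsupport_tensorFn_subset_openCube htest (hts (subset_tsupport _ hx)))
  rw [← setIntegral_eq_integral_of_forall_compl_eq_zero (s := cube (Fin s)) fun x hx => by
    by_contra h; exact hx (hsupp h)] at hI
  simp only [hF, mul_assoc] at hI
  rw [integral_const_mul] at hI
  have h1 := h0 _ htest
  rw [tensorPair] at h1
  rw [h1, mul_zero] at hI
  exact lt_irrefl _ hI

theorem cube_subset_closure_openCube : cube (Fin s) ⊆ closure (openCube (Fin s)) := by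
  rw [openCube, closure_pi_set]
  refine Set.pi_mono fun _ _ => ?_
  rw [closure_Ioo zero_ne_one]
  exact Set.Ico_subset_Icc_self

theorem openCube_subset_cube : openCube (Fin s) ⊆ cube (Fin s) :=
  Set.pi_mono fun _ _ => Set.Ioo_subset_Ico_self

variable {f : (Fin s → ℝ) → ℝ}

/-- Compact support is not required of `ψ`, so the constant `1` is allowed; this gives
`cubeIntegral_eq`. -/
theorem tensorPair_weakDeriv_eq (hα : 2 ≤ α)
    (hf : ∀ β : Fin s → ℕ, (∀ j, β j ≤ α) → ∃ g, IsWeakDeriv β f g)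
    {ψ : Fin s → ℝ → ℝ} (hψ : ∀ j, ContDiff ℝ ∞ (ψ j)) :
    tensorPair (weakDeriv (fun _ => 0) f) ψ =
      tensorPair (fun y => ∑ κ, kernIntegral α κ (weakDeriv (kernOrder α κ) f) y) ψ := by
  have hκ : ∀ κ : Fin s → Fin (α + 2), IsWeakDeriv (kernOrder α κ) f (weakDeriv (kernOrder α κ) f) :=
    fun κ => isWeakDeriv_weakDeriv (hf _ fun j => min_le_right _ _)
  have hint : ∀ κ : Fin s → Fin (α + 2), IntegrableOn
      (fun y => kernIntegral α κ (weakDeriv (kernOrder α κ) f) y * tensorFn ψ y) (cube (Fin s)) := by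
    intro κ
    refine integrableOn_mul_tensorFn ?_ fun j => (hψ j).continuous
    choose C hC0 hC using fun j => exists_bound_kern hα (κ j)
    refine Integrable.of_bound
      ((continuousOn_kernIntegral hα κ (hκ κ).1).aestronglyMeasurable measurableSet_cube)
      ((∫ x in cube (Fin s), |weakDeriv (kernOrder α κ) f x|) * ∏ j, C j) ?_
    · filter_upwards [ae_restrict_mem measurableSet_cube] with y hy
      rw [← integral_mul_const]
      refine norm_integral_le_of_norm_le ((hκ κ).1.abs.mul_const _) ?_
      filter_upwards [ae_restrict_mem measurableSet_cube] with x hx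
      rw [norm_mul, Real.norm_eq_abs, Real.norm_eq_abs]
      exact mul_le_mul_of_nonneg_left (abs_prod_kern_le hC hx (mem_Icc_of_mem_cube hy))
        (abs_nonneg _)
  rw [tensorPair_weakDeriv_expand hf hψ, tensorPair]
  simp only [Finset.sum_mul]
  rw [integral_finsetSum _ fun κ _ => hint κ]
  exact Finset.sum_congr rfl fun κ _ => tensorPair_kernOpSmooth hα κ (hκ κ).1 hψ

/-- The weak derivative of order zero is an arbitrary representative. Pairing with test functions
replaces it by `f`, continuity gives equality on the open cube, and closure extends this to faces
with zero coordinates, where lattice points lie. -/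
theorem eq_sum_kernIntegral (hα : 2 ≤ α) (hfc : ContinuousOn f (cube (Fin s)))
    (hf : ∀ β : Fin s → ℕ, (∀ j, β j ≤ α) → ∃ g, IsWeakDeriv β f g) {y : Fin s → ℝ}
    (hy : y ∈ cube (Fin s)) :
    f y = ∑ κ, kernIntegral α κ (weakDeriv (kernOrder α κ) f) y := by
  have hκ : ∀ κ : Fin s → Fin (α + 2), IsWeakDeriv (kernOrder α κ) f (weakDeriv (kernOrder α κ) f) :=
    fun κ => isWeakDeriv_weakDeriv (hf _ fun j => min_le_right _ _)
  have hRc : ContinuousOn (fun y => ∑ κ, kernIntegral α κ (weakDeriv (kernOrder α κ) f) y)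
      (cube (Fin s)) := continuousOn_finsetSum _ fun κ _ => continuousOn_kernIntegral hα κ (hκ κ).1
  have h0 := isWeakDeriv_weakDeriv (hf (fun _ => 0) fun _ => Nat.zero_le _)
  have hopen : ∀ x ∈ openCube (Fin s),
      f x = ∑ κ, kernIntegral α κ (weakDeriv (kernOrder α κ) f) x := by
    intro x hx
    refine sub_eq_zero.1 (eq_zero_of_tensorPair_eq_zero
      (h := fun x => f x - ∑ κ, kernIntegral α κ (weakDeriv (kernOrder α κ) f) x)
      ((hfc.sub hRc).mono openCube_subset_cube) (fun ψ hψ => ?_) hx)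
    have e1 := tensorPair_weakDeriv_eq hα hf fun j => (hψ j).contDiff
    have e2 := h0.tensorPair_eq hψ
    simp only [Function.iterate_zero, id, Finset.sum_const_zero, pow_zero, one_mul] at e2
    rw [e1] at e2
    have hint : ∀ {F : (Fin s → ℝ) → ℝ}, ContinuousOn F (cube (Fin s)) →
        IntegrableOn (fun x => F x * tensorFn ψ x) (cube (Fin s)) := by
      intro F hF
      have hK := hasCompactSupport_tensorFn hψ
      have hsub := (tsupport_tensorFn_subset_openCube hψ).trans openCube_subset_cube
      have h1 : IntegrableOn (fun x => F x * tensorFn ψ x) (tsupport (tensorFn ψ)) :=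
        ((hF.mono hsub).mul (continuous_tensorFn fun j => (hψ j).contDiff.continuous).continuousOn
          ).integrableOn_compact hK
      refine ((integrableOn_iff_integrable_of_support_subset fun x hx => ?_).1 h1).integrableOn
      exact subset_tsupport _ fun h => hx (by simp only [h, mul_zero])
    simp only [tensorPair, sub_mul] at e2 ⊢
    rw [integral_sub (hint hfc) (hint hRc), e2, sub_self]
  exact Set.EqOn.of_subset_closure hopen hfc hRc openCube_subset_cube cube_subset_closure_openCube hy

theorem cubeIntegral_eq (hα : 2 ≤ α) (hfc : ContinuousOn f (cube (Fin s)))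
    (hf : ∀ β : Fin s → ℕ, (∀ j, β j ≤ α) → ∃ g, IsWeakDeriv β f g) :
    cubeIntegral f = ∫ x in cube (Fin s), weakDeriv (fun _ => 0) f x := by
  have := tensorPair_weakDeriv_eq hα hf (ψ := fun _ _ => 1) fun _ => contDiff_const
  simp only [tensorPair, tensorFn, Finset.prod_const_one, mul_one] at this
  rw [this, cubeIntegral]
  exact setIntegral_congr_fun measurableSet_cube fun y hy => eq_sum_kernIntegral hα hfc hf hy

end ExtrapolatedLattice

namespace ExtrapolatedLattice

/-! ### Pairing with functions of the coordinates in `v` -/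

section partialIntegral

variable {s : ℕ} (v : Finset (Fin s))

theorem enorm_prod' {ι : Type*} (t : Finset ι) (a : ι → ℂ) :
    ‖∏ j ∈ t, a j‖ₑ = ∏ j ∈ t, ‖a j‖ₑ := by
  simp only [enorm_eq_nnnorm, nnnorm_prod, ENNReal.ofNNReal_finsetProd]

theorem enorm_ofReal' (x : ℝ) : ‖(x : ℂ)‖ₑ = ‖x‖ₑ := by
  simp only [enorm_eq_nnnorm, Complex.nnnorm_real]

theorem prod_mem_mul_prod_notMem {M : Type*} [CommMonoid M] (F : Fin s → M) :
    ∏ j, F j = (∏ j : {j // j ∈ v}, F j) * ∏ j : {j // j ∉ v}, F j := by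
  rw [← Fintype.prod_subtype_mul_prod_subtype (· ∈ v)]
  congr!

theorem measurePreserving_cube : MeasurePreserving
    (MeasurableEquiv.piEquivPiSubtypeProd (fun _ : Fin s => ℝ) (· ∈ v)).symm
    ((volume.restrict (cube {j // j ∈ v})).prod (volume.restrict (cube {j // j ∉ v})))
    (volume.restrict (cube (Fin s))) := by
  have h := (volume_preserving_piEquivPiSubtypeProd (fun _ : Fin s => ℝ) (· ∈ v)).symm
  have h2 := h.restrict_preimage (s := cube (Fin s)) measurableSet_cube
  have e : (MeasurableEquiv.piEquivPiSubtypeProd (fun _ : Fin s => ℝ) (· ∈ v)).symm ⁻¹'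
      cube (Fin s) = cube {j // j ∈ v} ×ˢ cube {j // j ∉ v} := by
    ext z
    simp only [Set.mem_preimage, cube, Set.mem_univ_pi, Set.mem_prod,
      MeasurableEquiv.piEquivPiSubtypeProd, MeasurableEquiv.coe_mk, MeasurableEquiv.symm_mk,
      Equiv.piEquivPiSubtypeProd_symm_apply]
    constructor
    · refine fun hz => ⟨fun j => ?_, fun j => ?_⟩
      · simpa [j.2] using hz j
      · simpa [j.2] using hz j
    · rintro ⟨h1, h2⟩ j
      split_ifs with hj
      · exact h1 ⟨j, hj⟩
      · exact h2 ⟨j, hj⟩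
  rw [Measure.prod_restrict, ← Measure.volume_eq_prod, ← e]
  convert h2
  rfl

/-- The factors do not depend on coordinates outside `v`, so these are integrated out of `G` first.
Then `L¹ ≤ L^q` on a probability space. -/
theorem enorm_integral_mul_prod_le {G : (Fin s → ℝ) → ℝ} (hG : IntegrableOn G (cube (Fin s)))
    {q : ℝ≥0∞} (hq : 1 ≤ q) {w : Fin s → ℝ → ℂ} (hw : ∀ j, Continuous (w j))
    (hc : ∀ j ∉ v, ∀ x, w j x = w j 0) {W : Fin s → ℝ≥0∞} (hW : ∀ j x, ‖w j x‖ₑ ≤ W j) :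
    ‖∫ x in cube (Fin s), (G x : ℂ) * ∏ j, w j (x j)‖ₑ ≤
      eLpNorm (partialIntegral v G) q (volume.restrict (cube {j // j ∈ v})) * ∏ j, W j := by
  set e := (MeasurableEquiv.piEquivPiSubtypeProd (fun _ : Fin s => ℝ) (· ∈ v)).symm with he
  have hmp := measurePreserving_cube v
  have hGe : Integrable (fun z => G (e z)) ((volume.restrict (cube {j // j ∈ v})).prod
      (volume.restrict (cube {j // j ∉ v}))) :=
    (hmp.integrable_comp_emb e.measurableEmbedding).2 hG
  set c : ({j // j ∈ v} → ℝ) → ℂ :=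
    fun y => (∏ j : {j // j ∈ v}, w j (y j)) * ∏ j : {j // j ∉ v}, w j 0 with hcdef
  have hprod : ∀ z, ∏ j, w j (e z j) = c z.1 := by
    intro z
    rw [prod_mem_mul_prod_notMem v]
    simp only [hcdef]
    congr 1
    · refine Finset.prod_congr rfl fun j _ => ?_
      simp [he, MeasurableEquiv.piEquivPiSubtypeProd, j.2]
    · exact Finset.prod_congr rfl fun j _ => hc j j.2 _
  have hcW : ∀ y, ‖c y‖ₑ ≤ ∏ j, W j := by
    intro y
    rw [prod_mem_mul_prod_notMem v W]
    simp only [hcdef, enorm_mul, enorm_prod']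
    exact mul_le_mul' (Finset.prod_le_prod' fun j _ => hW _ _) (Finset.prod_le_prod' fun j _ => hW _ _)
  have hcc : Continuous c := by
    simp only [hcdef]
    fun_prop
  have hcb : ∃ C, ∀ y ∈ Set.univ.pi fun _ : {j // j ∈ v} => Set.Icc (0 : ℝ) 1, ‖c y‖ ≤ C :=
    (isCompact_univ_pi fun _ => isCompact_Icc).exists_bound_of_continuousOn hcc.continuousOn
  obtain ⟨C, hC⟩ := hcb
  rw [← hmp.integral_comp e.measurableEmbedding (fun x => (G x : ℂ) * ∏ j, w j (x j))]
  simp only [← he, hprod]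
  rw [integral_prod]
  · have h1 : ∀ y, ∫ z, (G (e (y, z)) : ℂ) * c y ∂(volume.restrict (cube {j // j ∉ v})) =
        (partialIntegral v G y : ℂ) * c y := by
      intro y
      rw [integral_mul_const]
      congr 1
      exact integral_ofReal
    simp only [h1]
    refine (enorm_integral_le_lintegral_enorm _).trans ?_
    have hmeas : AEStronglyMeasurable (partialIntegral v G)
        (volume.restrict (cube {j // j ∈ v})) := hGe.integral_prod_left.aestronglyMeasurable
    calc ∫⁻ y, ‖(partialIntegral v G y : ℂ) * c y‖ₑ ∂(volume.restrict (cube {j // j ∈ v}))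
        ≤ ∫⁻ y, ‖partialIntegral v G y‖ₑ * ∏ j, W j ∂(volume.restrict (cube {j // j ∈ v})) := by
          refine lintegral_mono fun y => ?_
          rw [enorm_mul, enorm_ofReal']
          exact mul_le_mul' le_rfl (hcW y)
      _ = eLpNorm (partialIntegral v G) 1 (volume.restrict (cube {j // j ∈ v})) * ∏ j, W j := by
          rw [lintegral_mul_const'' _ hmeas.enorm, eLpNorm_one_eq_lintegral_enorm]
      _ ≤ _ := mul_le_mul' (eLpNorm_le_eLpNorm_of_exponent_le hq hmeas) le_rfl
  · refine Integrable.mul_bdd (c := C) hGe.ofReal (hcc.comp continuous_fst).aestronglyMeasurable ?_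
    rw [Measure.prod_restrict]
    filter_upwards [ae_restrict_mem (measurableSet_cube.prod measurableSet_cube)] with z hz
    exact hC _ fun j _ => ⟨(hz.1 j (Set.mem_univ j)).1, (hz.1 j (Set.mem_univ j)).2.le⟩

end partialIntegral

end ExtrapolatedLattice

/-! ### Error of a single lattice rule against the grid mean -/

namespace ExtrapolatedLattice

/-! ### Expansion of a polynomial lattice rule -/

section rule

variable {b : ℕ} [Fact b.Prime] {s α n : ℕ}

/-- The pairing of `G` with the Walsh coefficients of a product of kernels on the grid
`b⁻ⁿ ℤ^s`. -/
noncomputable def gridCoef (b n α : ℕ) [NeZero b] (κ : Fin s → Fin (α + 2)) (k : Fin s → ℕ)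
    (G : (Fin s → ℝ) → ℝ) : ℂ :=
  ∫ x in cube (Fin s), (G x : ℂ) * ∏ j, discCoef b n (k j) (kern α (κ j) (x j))

theorem continuous_discCoef_kern (hα : 2 ≤ α) (i k : ℕ) :
    Continuous fun x => discCoef b n k (kern α i x) := by
  unfold discCoef
  refine continuous_const.mul (continuous_finsetSum _ fun l _ => continuous_const.mul ?_)
  exact Complex.continuous_ofReal.comp ((continuous_kern hα i).comp (Continuous.prodMk_left _))

theorem integrableOn_mul_prod_discCoef (hα : 2 ≤ α) (κ : Fin s → Fin (α + 2)) (k : Fin s → ℕ)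
    {G : (Fin s → ℝ) → ℝ} (hG : IntegrableOn G (cube (Fin s))) :
    IntegrableOn (fun x => (G x : ℂ) * ∏ j, discCoef b n (k j) (kern α (κ j) (x j)))
      (cube (Fin s)) := by
  have hc : Continuous fun x : Fin s → ℝ => ∏ j, discCoef b n (k j) (kern α (κ j) (x j)) :=
    continuous_finsetProd _ fun j _ =>
      (continuous_discCoef_kern hα (κ j : ℕ) (k j)).comp (continuous_apply j)
  have hcb : ∃ C, ∀ x ∈ Set.univ.pi fun _ : Fin s => Set.Icc (0 : ℝ) 1,
      ‖∏ j, discCoef b n (k j) (kern α (κ j) (x j))‖ ≤ C :=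
    (isCompact_univ_pi fun _ => isCompact_Icc).exists_bound_of_continuousOn hc.continuousOn
  obtain ⟨C, hC⟩ := hcb
  refine Integrable.mul_bdd (c := C) hG.ofReal hc.aestronglyMeasurable ?_
  filter_upwards [ae_restrict_mem measurableSet_cube] with x hx
  exact hC _ fun j _ => ⟨(hx j (Set.mem_univ j)).1, (hx j (Set.mem_univ j)).2.le⟩

theorem kernIntegral_grid (hα : 2 ≤ α) (κ : Fin s → Fin (α + 2)) {G : (Fin s → ℝ) → ℝ}
    (hG : IntegrableOn G (cube (Fin s))) {ξ : Fin s → ℕ} (hξ : ∀ j, ξ j < b ^ n) :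
    (kernIntegral α κ G (fun j => (ξ j : ℝ) / (b : ℝ) ^ n) : ℂ) =
      ∑ k ∈ Fintype.piFinset fun _ : Fin s => Finset.range (b ^ n),
        gridCoef b n α κ k G * (starRingEnd ℂ) (∏ j, walE b n (k j) (ξ j)) := by
  have h1 : ∀ x : Fin s → ℝ,
      ((G x * ∏ j, kern α (κ j) (x j) ((ξ j : ℝ) / (b : ℝ) ^ n) : ℝ) : ℂ) =
      ∑ k ∈ Fintype.piFinset fun _ : Fin s => Finset.range (b ^ n),
        ((G x : ℂ) * ∏ j, discCoef b n (k j) (kern α (κ j) (x j))) *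
          (starRingEnd ℂ) (∏ j, walE b n (k j) (ξ j)) := by
    intro x
    push_cast
    have h2 : ∀ j, (kern α (κ j) (x j) ((ξ j : ℝ) / (b : ℝ) ^ n) : ℂ) = _ := fun j =>
      eq_sum_discCoef (hξ j) (kern α (κ j) (x j))
    simp only [h2]
    rw [Finset.prod_univ_sum, Finset.mul_sum]
    refine Finset.sum_congr rfl fun k _ => ?_
    rw [Finset.prod_mul_distrib, map_prod, mul_assoc]
  rw [kernIntegral, ← integral_complex_ofReal]
  simp only [h1]
  rw [integral_finsetSum _ fun k _ => (integrableOn_mul_prod_discCoef hα κ k hG).mul_const _]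
  exact Finset.sum_congr rfl fun k _ => integral_mul_const _ _

/-- The numerators of the points of a polynomial lattice. -/
noncomputable def latticeDigit (b n : ℕ) [Fact b.Prime] (p : (ZMod b)[X])
    (g : Fin s → (ZMod b)[X]) (h : ℕ) (j : Fin s) : ℕ :=
  digitNat b n (toLaurent b (tr b n h * g j) / toLaurent b p)

theorem latticePoint_eq (p : (ZMod b)[X]) (g : Fin s → (ZMod b)[X]) (h : ℕ) :
    latticePoint b n p g h = fun j => (latticeDigit b n p g h j : ℝ) / (b : ℝ) ^ n :=
  funext fun _ => vmap_eq _ _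

theorem latticePoint_mem_cube (p : (ZMod b)[X]) (g : Fin s → (ZMod b)[X]) (h : ℕ) :
    latticePoint b n p g h ∈ cube (Fin s) := by
  have hb : (0 : ℝ) < (b : ℝ) ^ n := pow_pos (by exact_mod_cast (Fact.out : b.Prime).pos) n
  intro j _
  rw [latticePoint_eq]
  refine ⟨by positivity, (div_lt_one hb).2 ?_⟩
  exact_mod_cast digitNat_lt n _

open scoped Classical in
-- After inversion on the grid the rule is `∑ c k * gridCoef k`, where `c k` is the conjugated
-- lattice average of a Walsh function: `1` at `k = 0`, `0` off the dual lattice, at most `1` in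
-- absolute value elsewhere.
theorem enorm_latticeRule_kernIntegral_sub_le (hα : 2 ≤ α) (hn : 0 < n) {p : (ZMod b)[X]}
    (hp : p.natDegree = n) (g : Fin s → (ZMod b)[X]) (κ : Fin s → Fin (α + 2))
    {G : (Fin s → ℝ) → ℝ} (hG : IntegrableOn G (cube (Fin s))) :
    ‖(latticeRule b n p g (kernIntegral α κ G) : ℂ) - gridCoef b n α κ 0 G‖ₑ ≤
      ∑ k ∈ Fintype.piFinset fun _ : Fin s => Finset.range (b ^ n),
        if k ≠ 0 ∧ k ∈ dualLattice b n p g then ‖gridCoef b n α κ k G‖ₑ else 0 := by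
  have hb : 0 < b := (Fact.out : b.Prime).pos
  have hbC : ((b : ℂ)) ^ n ≠ 0 := pow_ne_zero _ (by exact_mod_cast hb.ne')
  set T := Fintype.piFinset fun _ : Fin s => Finset.range (b ^ n) with hT
  set c : (Fin s → ℕ) → ℂ := fun k => ((b : ℂ) ^ n)⁻¹ * ∑ h ∈ Finset.range (b ^ n),
    (starRingEnd ℂ) (∏ j, walE b n (k j) (latticeDigit b n p g h j)) with hc
  have h1 : (latticeRule b n p g (kernIntegral α κ G) : ℂ) = ∑ k ∈ T, c k * gridCoef b n α κ k G := by
    rw [latticeRule]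
    push_cast
    simp only [latticePoint_eq]
    rw [Finset.sum_congr rfl fun h _ => kernIntegral_grid hα κ hG
      (ξ := latticeDigit b n p g h) fun j => digitNat_lt n _]
    rw [Finset.sum_comm, Finset.mul_sum]
    refine Finset.sum_congr rfl fun k _ => ?_
    rw [← Finset.mul_sum]
    simp only [hc]
    ring
  have hc0 : c 0 = 1 := by
    simp only [hc, Pi.zero_apply, walE_zero_right, Finset.prod_const_one, map_one,
      Finset.sum_const, Finset.card_range, nsmul_eq_mul, mul_one]
    push_cast
    exact inv_mul_cancel₀ hbC
  have hcd : ∀ k, k ∉ dualLattice b n p g → c k = 0 := by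
    intro k hk
    simp only [hc]
    rw [← map_sum]
    have := sum_prod_walE_eq_zero hn hp g k hk
    simp only [latticeDigit]
    rw [this, map_zero, mul_zero]
  have hc1 : ∀ k, ‖c k‖ₑ ≤ 1 := by
    intro k
    have : ‖c k‖ ≤ 1 := by
      simp only [hc]
      rw [norm_mul, norm_inv, norm_pow, Complex.norm_natCast]
      refine inv_mul_le_one_of_le₀ ?_ (by positivity)
      refine (norm_sum_le _ _).trans ?_
      simp [norm_prod, norm_walE]
    rw [enorm_eq_nnnorm]
    exact_mod_cast this
  have h0 : (0 : Fin s → ℕ) ∈ T := by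
    simp only [hT, Fintype.mem_piFinset, Finset.mem_range, Pi.zero_apply]
    exact fun _ => pow_pos hb n
  rw [h1, ← Finset.add_sum_erase _ _ h0, hc0, one_mul, add_sub_cancel_left,
    ← Finset.add_sum_erase T _ h0]
  refine (enorm_sum_le _ _).trans (le_add_left (Finset.sum_le_sum fun k hk => ?_))
  rw [enorm_mul]
  split_ifs with h
  · exact mul_le_of_le_one_left' (hc1 k)
  · rw [hcd k fun hd => h ⟨Finset.ne_of_mem_erase hk, hd⟩]
    simp

/-- The coordinates in which the kernel depends on both variables. -/
def kernLast (κ : Fin s → Fin (α + 2)) : Finset (Fin s) :=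
  Finset.univ.filter fun j => (κ j : ℕ) = α + 1

theorem enorm_gridCoef_le (hα : 2 ≤ α) {q : ℝ≥0∞} (hq : 1 ≤ q) (κ : Fin s → Fin (α + 2))
    (k : Fin s → ℕ) {G : (Fin s → ℝ) → ℝ} (hG : IntegrableOn G (cube (Fin s))) {W : Fin s → ℝ≥0∞}
    (hW : ∀ j x, ‖discCoef b n (k j) (kern α (κ j) x)‖ₑ ≤ W j) :
    ‖gridCoef b n α κ k G‖ₑ ≤ eLpNorm (partialIntegral (kernLast κ) G) q
      (volume.restrict (cube {j // j ∈ kernLast κ})) * ∏ j, W j := by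
  refine enorm_integral_mul_prod_le (kernLast κ) hG hq
    (fun j => continuous_discCoef_kern hα (κ j : ℕ) (k j)) (fun j hj x => ?_) hW
  have hj' : (κ j : ℕ) ≤ α := by
    have h1 : (κ j : ℕ) ≠ α + 1 := by simpa [kernLast] using hj
    have := (κ j).2
    omega
  congr 1
  ext y
  rw [kern_of_le hj', kern_of_le hj']

/-- Bounds for the Walsh coefficients of the kernels, including the constant kernel. -/
noncomputable def kernWeight (b α i K : ℕ) [NeZero b] : ℝ≥0∞ :=
  if i = 0 then if K = 0 then 1 else 0 else kernBound b α i K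

theorem enorm_discCoef_kern_le_tsum (hα : 2 ≤ α) (i : ℕ) {k : ℕ} (hk : k < b ^ n) (x : ℝ) :
    ‖discCoef b n k (kern α i x)‖ₑ ≤ ∑' l, kernWeight b α i (k + b ^ n * l) := by
  unfold kernWeight
  split_ifs with hi
  · subst hi
    rw [discCoef_kern_zero hk]
    refine le_trans ?_ (ENNReal.le_tsum 0)
    split_ifs with h1 h2 h2
    · simp
    · simp [h1] at h2
    · simp
    · simp
  · exact enorm_discCoef_kern_le Fact.out hα (by omega) hk x

end rule

end ExtrapolatedLattice

namespace ExtrapolatedLattice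

/-! ### Summation over the dual lattice -/

theorem prod_tsum_eq_tsum_prod {s : ℕ} (F : Fin s → ℕ → ℝ≥0∞) :
    ∏ j, ∑' l, F j l = ∑' l : Fin s → ℕ, ∏ j, F j (l j) := by
  induction s with
  | zero => simp
  | succ s ih =>
    rw [Fin.prod_univ_succ, ih, ← (Fin.consEquiv fun _ : Fin (s + 1) => ℕ).tsum_eq,
      ENNReal.tsum_prod', ← ENNReal.tsum_mul_right]
    refine tsum_congr fun a => ?_
    rw [← ENNReal.tsum_mul_left]
    refine tsum_congr fun l => ?_
    simp [Fin.prod_univ_succ, Fin.consEquiv]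

/-- The choices of kernels with a nonconstant kernel exactly in the coordinates in `u`. -/
def kernSupport {s : ℕ} (α : ℕ) (u : Finset (Fin s)) : Finset (Fin s → Fin (α + 2)) :=
  Fintype.piFinset fun j => if j ∈ u then Finset.univ.erase 0 else {0}

theorem mem_kernSupport {s α : ℕ} {u : Finset (Fin s)} {κ : Fin s → Fin (α + 2)} :
    κ ∈ kernSupport α u ↔ ∀ j, j ∈ u ↔ κ j ≠ 0 := by
  rw [kernSupport, Fintype.mem_piFinset]
  refine forall_congr' fun j => ?_
  split_ifs with h <;> simp [h]

theorem sum_kernSupport {s α : ℕ} {M : Type*} [AddCommMonoid M] (F : (Fin s → Fin (α + 2)) → M) :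
    ∑ κ, F κ = ∑ u, ∑ κ ∈ kernSupport α u, F κ := by
  classical
  rw [← Finset.sum_fiberwise_of_maps_to (s := Finset.univ) (t := Finset.univ)
    (g := fun κ : Fin s → Fin (α + 2) => Finset.univ.filter fun j => κ j ≠ 0)
    fun _ _ => Finset.mem_univ _]
  refine Finset.sum_congr rfl fun u _ => Finset.sum_congr ?_ fun _ _ => rfl
  ext κ
  rw [mem_kernSupport, Finset.mem_filter, Finset.ext_iff]
  simp only [Finset.mem_univ, true_and, Finset.mem_filter]
  exact forall_congr' fun j => ⟨fun h => h.symm, fun h => h.symm⟩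

theorem card_kernSupport {s α : ℕ} (u : Finset (Fin s)) :
    (kernSupport α u).card = (α + 1) ^ u.card := by
  rw [kernSupport, Fintype.card_piFinset, ← Finset.prod_const,
    ← Finset.prod_subset (Finset.subset_univ u)]
  · refine Finset.prod_congr rfl fun j hj => ?_
    rw [if_pos hj, Finset.card_erase_of_mem (Finset.mem_univ _), Finset.card_univ, Fintype.card_fin]
    rfl
  · intro j _ hj
    rw [if_neg hj, Finset.card_singleton]

theorem tr_mod (b n k : ℕ) : tr b n (k % b ^ n) = tr b n k := by
  refine Finset.sum_congr rfl fun i hi => ?_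
  congr 3
  have hi' := Finset.mem_range.1 hi
  obtain ⟨m, rfl⟩ := Nat.exists_eq_add_of_lt hi'
  rw [show i + m + 1 = i + (m + 1) by ring, pow_add, Nat.mod_mul_right_div_self, pow_succ',
    Nat.mod_mul_right_mod]

theorem mem_dualLattice_add {b s n : ℕ} {p : (ZMod b)[X]} {g : Fin s → (ZMod b)[X]} {k l : Fin s → ℕ} :
    (fun j => k j + b ^ n * l j) ∈ dualLattice b n p g ↔ k ∈ dualLattice b n p g := by
  have : ∀ j, tr b n (k j + b ^ n * l j) = tr b n (k j) := fun j => by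
    rw [← tr_mod, Nat.add_mul_mod_self_left, tr_mod]
  simp only [dualLattice, Set.mem_ofPred_eq, this]

theorem extendZero_restrict {s : ℕ} {u : Finset (Fin s)} {K : Fin s → ℕ} (h : ∀ j, j ∈ u ↔ K j ≠ 0) :
    extendZero u (fun j => K j) = K := by
  ext j
  by_cases hj : j ∈ u
  · simp [extendZero, hj]
  · have : K j = 0 := by
      by_contra h0
      exact hj ((h j).2 h0)
    simp [extendZero, hj, this]

variable {b : ℕ} [Fact b.Prime] {s α n : ℕ}

theorem sum_kernWeight_le (hα : 2 ≤ α) (K : ℕ) :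
    ∑ i ∈ Finset.univ.erase (0 : Fin (α + 2)), kernWeight b α i K ≤
      if K = 0 then 0 else ENNReal.ofReal (walshConst b α) * ((b : ℝ≥0∞) ^ mu b α K)⁻¹ := by
  refine le_trans (le_of_eq ?_) (sum_kernBound_le Fact.out hα K)
  have h : (Finset.univ.erase (0 : Fin (α + 2))) = Finset.univ.image Fin.succ := by
    ext i
    simp
  rw [h, Finset.sum_image fun _ _ _ _ h => Fin.succ_injective _ h, Finset.sum_range]
  refine Finset.sum_congr rfl fun i _ => ?_
  simp [kernWeight]

/-- The sum factors over coordinates. A factor in `u` vanishes if `K j = 0`, one outside `u`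
vanishes unless `K j = 0`; only `K` with support exactly `u` survives. -/
theorem sum_prod_kernWeight_le (hα : 2 ≤ α) (u : Finset (Fin s)) (K : Fin s → ℕ) :
    ∑ κ ∈ kernSupport α u, ∏ j, kernWeight b α (κ j) (K j) ≤
      if ∀ j, j ∈ u ↔ K j ≠ 0 then ENNReal.ofReal (walshConst b α) ^ u.card *
        ((b : ℝ≥0∞) ^ ∑ j : {j // j ∈ u}, mu b α (K j))⁻¹ else 0 := by
  have h : ∀ j, ∑ i ∈ (if j ∈ u then Finset.univ.erase 0 else {(0 : Fin (α + 2))}),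
      kernWeight b α i (K j) ≤ if j ∈ u ↔ K j ≠ 0 then
        (if j ∈ u then ENNReal.ofReal (walshConst b α) * ((b : ℝ≥0∞) ^ mu b α (K j))⁻¹ else 1)
          else 0 := by
    intro j
    by_cases hj : j ∈ u
    · simp only [if_pos hj]
      refine (sum_kernWeight_le hα (K j)).trans (le_of_eq ?_)
      by_cases hK : K j = 0 <;> simp [hj, hK]
    · simp only [if_neg hj, Finset.sum_singleton]
      by_cases hK : K j = 0 <;> simp [kernWeight, hj, hK]
  rw [kernSupport, ← Finset.prod_univ_sum (fun j => if j ∈ u then Finset.univ.erase 0 else {0})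
    fun j (i : Fin (α + 2)) => kernWeight b α i (K j)]
  refine (Finset.prod_le_prod' fun j _ => h j).trans ?_
  split_ifs with hs
  · simp only [hs, if_true]
    have hb : (b : ℝ≥0∞) ≠ 0 := by exact_mod_cast (Fact.out : b.Prime).ne_zero
    simp only [← hs]
    rw [Finset.prod_ite_mem, Finset.univ_inter, Finset.prod_mul_distrib, Finset.prod_const,
      Finset.sum_coe_sort u fun j => mu b α (K j), ← Finset.prod_pow_eq_pow_sum]
    refine mul_le_mul' le_rfl (le_of_eq ?_)
    exact (ENNReal.prod_inv_distrib fun i _ j _ _ => Or.inl (pow_ne_zero _ hb)).symm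
  · push Not at hs
    obtain ⟨j, hj⟩ := hs
    refine le_of_eq (Finset.prod_eq_zero (Finset.mem_univ j) (if_neg ?_))
    tauto

open scoped Classical in
theorem tsum_support_le_dualSum (p : (ZMod b)[X]) (g : Fin s → (ZMod b)[X]) (u : Finset (Fin s)) :
    ∑' K : Fin s → ℕ, (if (K ∈ dualLattice b n p g ∧ ∃ j, ¬ b ^ n ∣ K j) ∧ ∀ j, j ∈ u ↔ K j ≠ 0 then
      ((b : ℝ≥0∞) ^ ∑ j : {j // j ∈ u}, mu b α (K j))⁻¹ else 0) ≤ dualSum b α n p g u := by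
  set Z : Set (Fin s → ℕ) :=
    {K | (K ∈ dualLattice b n p g ∧ ∃ j, ¬ b ^ n ∣ K j) ∧ ∀ j, j ∈ u ↔ K j ≠ 0} with hZ
  set φ : (Fin s → ℕ) → ℝ≥0∞ := fun K => ((b : ℝ≥0∞) ^ ∑ j : {j // j ∈ u}, mu b α (K j))⁻¹ with hφ
  have h1 : ∑' K : Fin s → ℕ, (if (K ∈ dualLattice b n p g ∧ ∃ j, ¬ b ^ n ∣ K j) ∧
      ∀ j, j ∈ u ↔ K j ≠ 0 then ((b : ℝ≥0∞) ^ ∑ j : {j // j ∈ u}, mu b α (K j))⁻¹ else 0) =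
      ∑' K : Z, φ K := by
    rw [tsum_subtype Z φ]
    exact tsum_congr fun K => by simp only [Set.indicator, hZ, Set.mem_ofPred_eq, hφ]
  rw [h1, dualSum]
  have hmem : ∀ K : Z, (fun j : {j // j ∈ u} => K.1 j) ∈ dualProj b n p g u ∧
      ∃ j : {j // j ∈ u}, ¬ b ^ n ∣ K.1 j := by
    rintro ⟨K, ⟨hd, j, hj⟩, hs⟩
    refine ⟨⟨fun j => Nat.pos_of_ne_zero ((hs j).1 j.2), ?_⟩, ⟨j, (hs j).2 fun h => hj ?_⟩, hj⟩
    · rwa [extendZero_restrict hs]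
    · rw [h]; exact dvd_zero _
  refine ENNReal.tsum_comp_le_tsum_of_injective (f := fun K : Z =>
    (⟨fun j => K.1 j, hmem K⟩ : {k : {j // j ∈ u} → ℕ //
      k ∈ dualProj b n p g u ∧ ∃ j, ¬ b ^ n ∣ k j})) (fun K K' h => ?_)
    (fun k => ((b : ℝ≥0∞) ^ ∑ j, mu b α (k.1 j))⁻¹)
  have h2 : (fun j : {j // j ∈ u} => K.1 j) = fun j : {j // j ∈ u} => K'.1 j := congrArg Subtype.val h
  exact Subtype.ext (by
    rw [← extendZero_restrict K.2.2, ← extendZero_restrict K'.2.2, h2])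

open scoped Classical in
-- Division by `b ^ n` in each coordinate: the remainder `k` decides membership in the dual lattice,
-- `k ≠ 0` says that `b ^ n` fails to divide some coordinate, and `(k, l) ↦ k + b ^ n l` is
-- injective.
theorem sum_tsum_add_mul_le (p : (ZMod b)[X]) (g : Fin s → (ZMod b)[X]) (Φ : (Fin s → ℕ) → ℝ≥0∞) :
    ∑ k ∈ Fintype.piFinset fun _ : Fin s => Finset.range (b ^ n),
      (if k ≠ 0 ∧ k ∈ dualLattice b n p g then ∑' l : Fin s → ℕ, Φ (fun j => k j + b ^ n * l j)
        else 0) ≤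
      ∑' K, if K ∈ dualLattice b n p g ∧ ∃ j, ¬ b ^ n ∣ K j then Φ K else 0 := by
  have hN : 0 < b ^ n := pow_pos (Fact.out : b.Prime).pos n
  set T := Fintype.piFinset fun _ : Fin s => Finset.range (b ^ n) with hT
  set Ψ : (Fin s → ℕ) → ℝ≥0∞ := fun K =>
    if K ∈ dualLattice b n p g ∧ ∃ j, ¬ b ^ n ∣ K j then Φ K else 0 with hΨ
  have hTlt : ∀ k ∈ T, ∀ j, k j < b ^ n := fun k hk j => by
    simpa using (Fintype.mem_piFinset.1 hk) j
  have h1 : ∀ k ∈ T, (if k ≠ 0 ∧ k ∈ dualLattice b n p g then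
      ∑' l : Fin s → ℕ, Φ (fun j => k j + b ^ n * l j) else 0) ≤
      ∑' l : Fin s → ℕ, Ψ (fun j => k j + b ^ n * l j) := by
    intro k hk
    split_ifs with h
    · refine le_of_eq (tsum_congr fun l => ?_)
      simp only [hΨ]
      rw [if_pos]
      refine ⟨mem_dualLattice_add.2 h.2, ?_⟩
      obtain ⟨j, hj⟩ := Function.ne_iff.1 h.1
      refine ⟨j, fun hd => hj ?_⟩
      rw [Nat.dvd_add_left (dvd_mul_right _ _)] at hd
      exact Nat.eq_zero_of_dvd_of_lt hd (hTlt k hk j)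
    · exact zero_le
  refine (Finset.sum_le_sum h1).trans ?_
  rw [← Finset.sum_coe_sort T, ← tsum_fintype (L := SummationFilter.unconditional _),
    ← ENNReal.tsum_prod (f := fun (k : T) (l : Fin s → ℕ) => Ψ fun j => k.1 j + b ^ n * l j)]
  refine ENNReal.tsum_comp_le_tsum_of_injective
    (f := fun z : T × (Fin s → ℕ) => fun j => z.1.1 j + b ^ n * z.2 j) ?_ Ψ
  rintro ⟨k, l⟩ ⟨k', l'⟩ h
  have h2 : ∀ j, k.1 j + b ^ n * l j = k'.1 j + b ^ n * l' j := fun j => congrFun h j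
  have h3 : ∀ j, k.1 j = k'.1 j := fun j => by
    have := congrArg (· % b ^ n) (h2 j)
    simpa [Nat.add_mul_mod_self_left, Nat.mod_eq_of_lt (hTlt _ k.2 j),
      Nat.mod_eq_of_lt (hTlt _ k'.2 j)] using this
  have h4 : ∀ j, l j = l' j := fun j => by
    have := h2 j
    rw [h3 j, Nat.add_left_cancel_iff] at this
    exact Nat.eq_of_mul_eq_mul_left hN this
  exact Prod.ext (Subtype.ext (funext h3)) (funext h4)

open scoped Classical in
theorem sum_prod_tsum_kernWeight_le (hα : 2 ≤ α) (p : (ZMod b)[X]) (g : Fin s → (ZMod b)[X])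
    (u : Finset (Fin s)) :
    ∑ κ ∈ kernSupport α u, ∑ k ∈ Fintype.piFinset fun _ : Fin s => Finset.range (b ^ n),
      (if k ≠ 0 ∧ k ∈ dualLattice b n p g then
        ∏ j, ∑' l, kernWeight b α (κ j) (k j + b ^ n * l) else 0) ≤
      ENNReal.ofReal (walshConst b α) ^ u.card * dualSum b α n p g u := by
  simp only [prod_tsum_eq_tsum_prod]
  refine (Finset.sum_le_sum fun κ _ => sum_tsum_add_mul_le (n := n) p g
    fun K => ∏ j, kernWeight b α (κ j) (K j)).trans ?_
  rw [← Summable.tsum_finsetSum fun _ _ => ENNReal.summable]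
  refine le_trans ?_ (mul_le_mul' le_rfl (tsum_support_le_dualSum p g u))
  rw [← ENNReal.tsum_mul_left]
  refine ENNReal.tsum_le_tsum fun K => ?_
  by_cases h : K ∈ dualLattice b n p g ∧ ∃ j, ¬ b ^ n ∣ K j
  · simp only [h]
    refine (sum_prod_kernWeight_le hα u K).trans (le_of_eq ?_)
    split_ifs <;> simp_all
  · simp [h]

end ExtrapolatedLattice

namespace ExtrapolatedLattice

/-! ### The extrapolation coefficients -/

/-- A form of the `q`-binomial theorem. For `i + k = A + 1`, split `b ^ (A + 1) - 1 = b ^ i (b ^ k -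
1) + (b ^ i - 1)`; the recursions of the two products turn the parts into `b ^ (A + 1)` and `-x`
times the sum for `A`. -/
theorem sum_antidiagonal_extrapolation {b : ℝ} (hb : 1 < b) (x : ℝ) (A : ℕ) :
    ∑ z ∈ Finset.HasAntidiagonal.antidiagonal A, (∏ j ∈ Finset.range z.1, (-1 / (b ^ (j + 1) - 1))) *
      (∏ j ∈ Finset.range z.2, (b ^ (j + 1) / (b ^ (j + 1) - 1))) * x ^ z.1 =
      ∏ j ∈ Finset.range A, ((b ^ (j + 1) - x) / (b ^ (j + 1) - 1)) := by
  have hne : ∀ j : ℕ, b ^ (j + 1) - 1 ≠ 0 := fun j =>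
    (sub_pos.2 (one_lt_pow₀ hb j.succ_ne_zero)).ne'
  induction A with
  | zero => simp
  | succ A ih =>
    set d : ℕ → ℝ := fun i => ∏ j ∈ Finset.range i, (-1 / (b ^ (j + 1) - 1)) with hd
    set e : ℕ → ℝ := fun k => ∏ j ∈ Finset.range k, (b ^ (j + 1) / (b ^ (j + 1) - 1)) with he
    have hd1 : ∀ i, (b ^ (i + 1) - 1) * d (i + 1) = -d i := fun i => by
      simp only [hd, Finset.prod_range_succ]
      field_simp [hne i]
    have he1 : ∀ k, (b ^ (k + 1) - 1) * e (k + 1) = b ^ (k + 1) * e k := fun k => by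
      simp only [he, Finset.prod_range_succ]
      field_simp [hne k]
    rw [Finset.prod_range_succ, ← ih, mul_div_assoc', eq_div_iff (hne A), Finset.sum_mul,
      Finset.sum_mul]
    have h1 : ∀ z ∈ Finset.HasAntidiagonal.antidiagonal (A + 1), d z.1 * e z.2 * x ^ z.1 * (b ^ (A + 1) - 1) =
        b ^ z.1 * ((b ^ z.2 - 1) * e z.2) * (d z.1 * x ^ z.1) +
          ((b ^ z.1 - 1) * d z.1) * (e z.2 * x ^ z.1) := by
      intro z hz
      rw [← Finset.HasAntidiagonal.mem_antidiagonal.1 hz, pow_add]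
      ring
    rw [Finset.sum_congr rfl h1, Finset.sum_add_distrib, Finset.Nat.sum_antidiagonal_succ',
      Finset.Nat.sum_antidiagonal_succ]
    simp only [pow_zero, sub_self, zero_mul, mul_zero, zero_add]
    rw [← Finset.sum_add_distrib]
    refine Finset.sum_congr rfl fun z hz => ?_
    rw [he1, hd1, ← Finset.HasAntidiagonal.mem_antidiagonal.1 hz]
    ring

theorem sum_extraCoeff_mul_pow {b : ℕ} (hb : 1 < b) (A : ℕ) (x : ℝ) :
    ∑ τ ∈ Finset.Icc 1 (A + 1), extraCoeff b (A + 1) τ * x ^ (τ - 1) =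
      ∏ j ∈ Finset.range A, (((b : ℝ) ^ (j + 1) - x) / ((b : ℝ) ^ (j + 1) - 1)) := by
  have hIcc : ∀ (n : ℕ) (F : ℕ → ℝ), ∏ j ∈ Finset.Icc 1 n, F j = ∏ j ∈ Finset.range n, F (j + 1) := by
    intro n F
    rw [Finset.range_eq_Ico, Finset.prod_Ico_add' F 0 n 1, zero_add]
    rfl
  have hIcc' : ∀ (n : ℕ) (F : ℕ → ℝ), ∑ j ∈ Finset.Icc 1 n, F j = ∑ j ∈ Finset.range n, F (j + 1) := by
    intro n F
    rw [Finset.range_eq_Ico, Finset.sum_Ico_add' F 0 n 1, zero_add]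
    rfl
  rw [← sum_antidiagonal_extrapolation (by exact_mod_cast hb) x A,
    Finset.Nat.sum_antidiagonal_eq_sum_range_succ_mk, hIcc']
  refine Finset.sum_congr rfl fun i _ => ?_
  rw [extraCoeff, hIcc, hIcc, Nat.add_sub_cancel, Nat.add_sub_add_right]

/-- The extrapolation annihilates the terms `b^{-nt}` of the error expansion for `0 < t < α`. -/
theorem sum_extraCoeff_mul_inv_pow {b : ℕ} (hb : 1 < b) {α m t : ℕ} (hm : α ≤ m) (ht : t < α) :
    ∑ τ ∈ Finset.Icc 1 α, extraCoeff b α τ * ((b : ℝ) ^ ((m - τ + 1) * t))⁻¹ =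
      if t = 0 then 1 else 0 := by
  obtain ⟨A, rfl⟩ : ∃ A, α = A + 1 := ⟨α - 1, by omega⟩
  have hb1 : (1 : ℝ) < b := by exact_mod_cast hb
  have hb0 : (b : ℝ) ≠ 0 := by positivity
  have hne : ∀ j : ℕ, (b : ℝ) ^ (j + 1) - 1 ≠ 0 := fun j =>
    (sub_pos.2 (one_lt_pow₀ hb1 j.succ_ne_zero)).ne'
  have h1 : ∀ τ ∈ Finset.Icc 1 (A + 1), extraCoeff b (A + 1) τ * ((b : ℝ) ^ ((m - τ + 1) * t))⁻¹ =
      ((b : ℝ) ^ (m * t))⁻¹ * (extraCoeff b (A + 1) τ * ((b : ℝ) ^ t) ^ (τ - 1)) := by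
    intro τ hτ
    rw [Finset.mem_Icc] at hτ
    -- Since `1 ≤ τ ≤ m`, one has `m = (m - τ + 1) + (τ - 1)` without truncation.
    have : (b : ℝ) ^ (m * t) = (b : ℝ) ^ ((m - τ + 1) * t) * ((b : ℝ) ^ t) ^ (τ - 1) := by
      rw [← pow_mul, mul_comm t, ← pow_add, ← add_mul]
      congr 2
      omega
    rw [this]
    field_simp
  rw [Finset.sum_congr rfl h1, ← Finset.mul_sum, sum_extraCoeff_mul_pow hb]
  split_ifs with h0
  · subst h0
    simp only [mul_zero, pow_zero, inv_one, one_mul]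
    exact Finset.prod_eq_one fun j _ => div_self (hne j)
  · obtain ⟨i, rfl⟩ := Nat.exists_eq_succ_of_ne_zero h0
    rw [Finset.prod_eq_zero (i := i) (Finset.mem_range.2 (by omega)), mul_zero]
    rw [sub_self, zero_div]

/-! ### Finite `ℓ^p` norms -/

section finLp

variable {ι : Type*} [Fintype ι]

theorem le_finLp {p : ℝ≥0∞} (hp : 1 ≤ p) (a : ι → ℝ≥0∞) (i : ι) : a i ≤ finLp p a := by
  unfold finLp
  split_ifs with h
  · exact le_iSup a i
  · have hp0 : 0 < p.toReal := ENNReal.toReal_pos (by positivity) h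
    rw [one_div, ENNReal.le_rpow_inv_iff hp0]
    exact Finset.single_le_sum (f := fun i => a i ^ p.toReal) (fun _ _ => zero_le)
      (Finset.mem_univ i)

theorem finLp_comp_le {κ : Type*} [Fintype κ] (p : ℝ≥0∞) (a : ι → ℝ≥0∞) {e : κ → ι}
    (he : Function.Injective e) : finLp p (fun k => a (e k)) ≤ finLp p a := by
  unfold finLp
  split_ifs with h
  · exact iSup_le fun k => le_iSup a (e k)
  · refine ENNReal.rpow_le_rpow ?_ (by positivity)
    have := ENNReal.tsum_comp_le_tsum_of_injective he fun i => a i ^ p.toReal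
    rwa [tsum_fintype, tsum_fintype] at this

theorem sum_mul_le_finLp {p q : ℝ≥0∞} (hpq : p.HolderConjugate q) (a c : ι → ℝ≥0∞) :
    ∑ i, a i * c i ≤ finLp p a * finLp q c := by
  have key : ∀ {p q : ℝ≥0∞}, p.HolderConjugate q → p = ⊤ → ∀ a c : ι → ℝ≥0∞,
      ∑ i, a i * c i ≤ finLp p a * finLp q c := by
    intro p q hpq hp a c
    subst hp
    have hq : q = 1 := (ENNReal.HolderConjugate.eq_top_iff_eq_one ⊤ q).1 rfl
    subst hq
    rw [finLp, finLp, if_pos rfl, if_neg ENNReal.one_ne_top]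
    simp only [ENNReal.toReal_one, ENNReal.rpow_one, div_one]
    rw [Finset.mul_sum]
    exact Finset.sum_le_sum fun i _ => mul_le_mul' (le_iSup a i) le_rfl
  by_cases hp : p = ⊤
  · exact key hpq hp a c
  by_cases hq : q = ⊤
  · rw [mul_comm]
    simp only [mul_comm (a _)]
    exact key hpq.symm hq c a
  · rw [finLp, finLp, if_neg hp, if_neg hq]
    have := hpq
    exact ENNReal.inner_le_Lp_mul_Lq _ _ _ (ENNReal.HolderConjugate.toReal_of_ne_top hp hq)

theorem finLp_one_le (q : ℝ≥0∞) :
    finLp q (fun _ : ι => 1) ≤ (Fintype.card ι : ℝ≥0∞) ^ (q⁻¹).toReal := by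
  unfold finLp
  split_ifs with h
  · subst h
    simp
  · simp [ENNReal.toReal_inv]

end finLp

end ExtrapolatedLattice

namespace ExtrapolatedLattice

/-! ### Summation over the derivatives -/

section sum

variable {s α : ℕ} {f : (Fin s → ℝ) → ℝ} {q r q' r' : ℝ≥0∞} {γ : Finset (Fin s) → ℝ≥0}

/-- The norm of the derivative belonging to a choice of kernels. -/
noncomputable def derivNorm (q : ℝ≥0∞) (f : (Fin s → ℝ) → ℝ) (κ : Fin s → Fin (α + 2)) : ℝ≥0∞ :=
  eLpNorm (partialIntegral (kernLast κ) (weakDeriv (kernOrder α κ) f)) q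
    (volume.restrict (cube {j // j ∈ kernLast κ}))

/-- The `ℓ^q` norm of the norms of the derivatives with support `u`. -/
noncomputable def derivSum (α : ℕ) (q : ℝ≥0∞) (f : (Fin s → ℝ) → ℝ) (u : Finset (Fin s)) : ℝ≥0∞ :=
  finLp q fun i : DerivIndex α u => eLpNorm (partialIntegral i.1.1 (weakDeriv i.order f)) q
    (volume.restrict (cube {j // j ∈ i.1.1}))

theorem mem_kernLast {κ : Fin s → Fin (α + 2)} {j : Fin s} : j ∈ kernLast κ ↔ (κ j : ℕ) = α + 1 := by
  simp [kernLast]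

/-- The index of the derivative belonging to a choice of kernels. -/
def kernIndex {u : Finset (Fin s)} (κ : kernSupport α u) : DerivIndex α u :=
  ⟨⟨kernLast κ.1, fun j hj => (mem_kernSupport.1 κ.2 j).2 fun h => by
      rw [mem_kernLast, h] at hj
      simp at hj⟩,
    fun j => ⟨κ.1 j, by
      have h1 := Finset.mem_sdiff.1 j.2
      have h2 := (mem_kernSupport.1 κ.2 j).1 h1.1
      have h3 : (κ.1 j : ℕ) ≠ α + 1 := fun h => h1.2 (mem_kernLast.2 h)
      have h4 := (κ.1 j).2
      have h5 : (κ.1 j : ℕ) ≠ 0 := fun h => h2 (Fin.ext h)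
      rw [Finset.mem_Icc]
      omega⟩⟩

theorem order_kernIndex {u : Finset (Fin s)} (κ : kernSupport α u) :
    (kernIndex κ).order = kernOrder α κ.1 := by
  ext j
  have h4 := (κ.1 j).2
  rw [DerivIndex.order, kernOrder]
  split_ifs with h1 h2
  · have h3 : (κ.1 j : ℕ) ≠ α + 1 := fun h => (Finset.mem_sdiff.1 h1).2 (mem_kernLast.2 h)
    rw [min_eq_left (by omega)]
    rfl
  · rw [mem_kernLast.1 h2, min_eq_right (Nat.le_succ α)]
  · have h3 : κ.1 j = 0 := by
      by_contra h0
      exact h1 (Finset.mem_sdiff.2 ⟨(mem_kernSupport.1 κ.2 j).2 h0, h2⟩)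
    rw [h3]
    simp

theorem kernIndex_injective {u : Finset (Fin s)} :
    Function.Injective (kernIndex : kernSupport α u → DerivIndex α u) := by
  intro κ κ' h
  have h1 : kernOrder α κ.1 = kernOrder α κ'.1 := by rw [← order_kernIndex, h, order_kernIndex]
  have h2 : kernLast κ.1 = kernLast κ'.1 := congrArg (fun i : DerivIndex α u => i.1.1) h
  refine Subtype.ext (funext fun j => Fin.ext ?_)
  have h3 : min (κ.1 j : ℕ) α = min (κ'.1 j : ℕ) α := congrFun h1 j
  have h4 : (κ.1 j : ℕ) = α + 1 ↔ (κ'.1 j : ℕ) = α + 1 := by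
    rw [← mem_kernLast, ← mem_kernLast, h2]
  have h5 := (κ.1 j).2
  have h6 := (κ'.1 j).2
  omega

theorem derivNorm_eq (q : ℝ≥0∞) (f : (Fin s → ℝ) → ℝ) {u : Finset (Fin s)} (κ : kernSupport α u) :
    derivNorm q f κ.1 = eLpNorm (partialIntegral (kernIndex κ).1.1 (weakDeriv (kernIndex κ).order f)) q
      (volume.restrict (cube {j // j ∈ (kernIndex κ).1.1})) := by
  rw [order_kernIndex]
  rfl

theorem derivNorm_le_derivSum (hq : 1 ≤ q) (f : (Fin s → ℝ) → ℝ) {u : Finset (Fin s)}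
    {κ : Fin s → Fin (α + 2)} (hκ : κ ∈ kernSupport α u) : derivNorm q f κ ≤ derivSum α q f u := by
  rw [derivNorm_eq q f ⟨κ, hκ⟩]
  exact le_finLp hq (fun i : DerivIndex α u => eLpNorm (partialIntegral i.1.1 (weakDeriv i.order f)) q
    (volume.restrict (cube {j // j ∈ i.1.1}))) _

/-- Hölder against the constant `1` on the `(α + 1) ^ u.card` choices of kernels supported on `u`.
-/
theorem sum_derivNorm_le (hq' : q.HolderConjugate q') (f : (Fin s → ℝ) → ℝ) (u : Finset (Fin s)) :
    ∑ κ ∈ kernSupport α u, derivNorm q f κ ≤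
      derivSum α q f u * ((α : ℝ≥0∞) + 1) ^ ((u.card : ℝ) * (q'⁻¹).toReal) := by
  have h := sum_mul_le_finLp hq' (fun κ : kernSupport α u => derivNorm q f κ.1) fun _ => 1
  simp only [mul_one] at h
  rw [Finset.sum_coe_sort (kernSupport α u) (derivNorm q f)] at h
  refine h.trans (mul_le_mul' ?_ ((finLp_one_le q').trans (le_of_eq ?_)))
  · simp only [derivNorm_eq]
    exact finLp_comp_le q (fun i : DerivIndex α u => eLpNorm (partialIntegral i.1.1
      (weakDeriv i.order f)) q (volume.restrict (cube {j // j ∈ i.1.1}))) kernIndex_injective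
  · rw [Fintype.card_coe, card_kernSupport, ENNReal.rpow_mul, ENNReal.rpow_natCast]
    push_cast
    rfl

/-- If `γ u = 0`, a finite norm forces `derivSum` to vanish; otherwise the two weights cancel. -/
theorem derivSum_le (hr : 1 ≤ r) (h1 : sobolevNorm α γ q r f ≤ 1) (u : Finset (Fin s)) :
    derivSum α q f u ≤ (γ u : ℝ≥0∞)⁻¹ * derivSum α q f u * γ u := by
  have h2 : (γ u : ℝ≥0∞)⁻¹ * derivSum α q f u ≤ 1 :=
    (le_finLp hr (fun u => (γ u : ℝ≥0∞)⁻¹ * derivSum α q f u) u).trans h1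
  by_cases hγ : γ u = 0
  · rw [hγ, ENNReal.coe_zero, ENNReal.inv_zero] at h2
    have h3 : derivSum α q f u = 0 := by
      by_contra h0
      rw [ENNReal.top_mul h0] at h2
      exact absurd h2 (by simp)
    rw [h3]
    exact zero_le
  · rw [mul_right_comm, ENNReal.inv_mul_cancel (by exact_mod_cast hγ) ENNReal.coe_ne_top, one_mul]

theorem sum_derivSum_mul_le (hr : 1 ≤ r) (hr' : r.HolderConjugate r')
    (h1 : sobolevNorm α γ q r f ≤ 1) (c : Finset (Fin s) → ℝ≥0∞) :
    ∑ u, derivSum α q f u * c u ≤ finLp r' fun u => (γ u : ℝ≥0∞) * c u := by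
  calc ∑ u, derivSum α q f u * c u
      ≤ ∑ u, ((γ u : ℝ≥0∞)⁻¹ * derivSum α q f u) * ((γ u : ℝ≥0∞) * c u) := by
        refine Finset.sum_le_sum fun u _ => ?_
        rw [← mul_assoc]
        exact mul_le_mul' (derivSum_le hr h1 u) le_rfl
    _ ≤ finLp r (fun u => (γ u : ℝ≥0∞)⁻¹ * derivSum α q f u) * finLp r' fun u => (γ u : ℝ≥0∞) * c u :=
        sum_mul_le_finLp hr' _ _
    _ ≤ 1 * finLp r' fun u => (γ u : ℝ≥0∞) * c u := mul_le_mul' h1 le_rfl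
    _ = _ := one_mul _

theorem finLp_eq_of_empty (hr' : 1 ≤ r') (c : Finset (Fin s) → ℝ≥0∞) (h0 : c ∅ = 0) :
    finLp r' c = finLp r' fun u : {u : Finset (Fin s) // u.Nonempty} => c u.1 := by
  unfold finLp
  split_ifs with h
  · refine le_antisymm (iSup_le fun u => ?_) (iSup_le fun u => le_iSup c u.1)
    rcases u.eq_empty_or_nonempty with rfl | hu
    · rw [h0]; exact zero_le
    · exact le_iSup (fun u : {u : Finset (Fin s) // u.Nonempty} => c u.1) ⟨u, hu⟩
  · congr 1
    have hp : 0 < r'.toReal := ENNReal.toReal_pos (by positivity) h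
    refine (Finset.sum_subset (Finset.filter_subset (fun u => u.Nonempty) _) ?_).symm.trans
      (Finset.sum_subtype (Finset.univ.filter fun u => u.Nonempty) (by simp) fun u => c u ^ r'.toReal)
    intro u _ hu
    have : u = ∅ := by simpa [Finset.not_nonempty_iff_eq_empty] using hu
    rw [this, h0, ENNReal.zero_rpow_of_pos hp]

end sum

/-! ### Recovering the two constants `B` and `H` -/

section bounds

variable {b : ℕ} [Fact b.Prime] {s α n : ℕ} {f : (Fin s → ℝ) → ℝ} {q r q' r' : ℝ≥0∞}
  {γ : Finset (Fin s) → ℝ≥0}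

open scoped Classical in
-- The Walsh bounds are already summed over the kernels, so each derivative norm is simply replaced
-- by the `ℓ^q` norm; hence no `q'` in `B`.
theorem sum_derivNorm_mul_dual_le (hα : 2 ≤ α) (hq : 1 ≤ q) (hr : 1 ≤ r) (hr' : r.HolderConjugate r')
    (h1 : sobolevNorm α γ q r f ≤ 1) (p : (ZMod b)[X]) (g : Fin s → (ZMod b)[X]) :
    ∑ κ : Fin s → Fin (α + 2), derivNorm q f κ *
      ∑ k ∈ Fintype.piFinset fun _ : Fin s => Finset.range (b ^ n),
        (if k ≠ 0 ∧ k ∈ dualLattice b n p g then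
          ∏ j, ∑' l, kernWeight b α (κ j) (k j + b ^ n * l) else 0) ≤ boundB b α γ r' n p g := by
  rw [sum_kernSupport]
  have hone : 1 ≤ r' := hr'.symm.one_le
  calc _ ≤ ∑ u, derivSum α q f u * (ENNReal.ofReal (walshConst b α) ^ u.card *
        dualSum b α n p g u) := by
        refine Finset.sum_le_sum fun u _ => ?_
        refine le_trans ?_ (mul_le_mul' le_rfl (sum_prod_tsum_kernWeight_le hα p g u))
        rw [Finset.mul_sum]
        exact Finset.sum_le_sum fun κ hκ => mul_le_mul' (derivNorm_le_derivSum hq f hκ) le_rfl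
    _ ≤ _ := sum_derivSum_mul_le hr hr' h1 _
    _ = _ := by
        rw [boundB, finLp_eq_of_empty hone]
        · simp only [mul_assoc]
        · have : dualSum b α n p g ∅ = 0 := by
            rw [dualSum, ENNReal.tsum_eq_zero]
            rintro ⟨k, -, j, -⟩
            exact absurd j.2 (Finset.notMem_empty _)
          rw [this, mul_zero, mul_zero]

theorem sum_derivNorm_mul_bernConst_le (hr : 1 ≤ r) (hq' : q.HolderConjugate q')
    (hr' : r.HolderConjugate r') (h1 : sobolevNorm α γ q r f ≤ 1) :
    ∑ κ : Fin s → Fin (α + 2), derivNorm q f κ *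
      ENNReal.ofReal (bernConst α) ^ (Finset.univ.filter fun j => κ j ≠ 0).card ≤
        boundH α γ q' r' := by
  rw [sum_kernSupport]
  calc _ ≤ ∑ u : Finset (Fin s), derivSum α q f u *
        (((α : ℝ≥0∞) + 1) ^ ((u.card : ℝ) * (q'⁻¹).toReal) *
          ENNReal.ofReal (bernConst α) ^ u.card) := by
        refine Finset.sum_le_sum fun u _ => ?_
        rw [← mul_assoc]
        refine le_trans (le_of_eq ?_) (mul_le_mul' (sum_derivNorm_le hq' f u) le_rfl)
        rw [Finset.sum_mul]
        refine Finset.sum_congr rfl fun κ hκ => ?_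
        congr 3
        ext j
        simp [(mem_kernSupport.1 hκ j)]
    _ ≤ _ := sum_derivSum_mul_le hr hr' h1 _
    _ = _ := by rw [boundH]; simp only [mul_assoc]

/-- Each coordinate yields a power of `b^{-n}` equal to its derivative order, and each nonconstant
kernel a factor `D_α`; the total order is at least `α`. -/
theorem enorm_gridCoef_zero_le (hα : 2 ≤ α) (hq : 1 ≤ q) (κ : Fin s → Fin (α + 2))
    (hG : IntegrableOn (weakDeriv (kernOrder α κ) f) (cube (Fin s)))
    (hκ : α ≤ ∑ j, kernOrder α κ j) :
    ‖gridCoef b n α κ 0 (weakDeriv (kernOrder α κ) f)‖ₑ ≤ derivNorm q f κ *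
      ENNReal.ofReal (bernConst α) ^ (Finset.univ.filter fun j => κ j ≠ 0).card /
        (b : ℝ≥0∞) ^ (α * n) := by
  have hb0 : (b : ℝ≥0∞) ≠ 0 := by exact_mod_cast (Fact.out : b.Prime).ne_zero
  have hb1 : (1 : ℝ≥0∞) ≤ b := by exact_mod_cast (Fact.out : b.Prime).one_lt.le
  have hbR : (0 : ℝ) < b := by exact_mod_cast (Fact.out : b.Prime).pos
  have hinv : ∀ k : ℕ, ‖((b : ℝ) ^ k)⁻¹‖ₑ = ((b : ℝ≥0∞) ^ k)⁻¹ := fun k => by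
    rw [enorm_inv (pow_ne_zero _ hbR.ne'), enorm_pow]
    simp
  set W : Fin s → ℝ≥0∞ := fun j => ((b : ℝ≥0∞) ^ (n * kernOrder α κ j))⁻¹ *
    if κ j ≠ 0 then ENNReal.ofReal (bernConst α) else 1 with hW
  have hWj : ∀ j x, ‖discCoef b n ((0 : Fin s → ℕ) j) (kern α (κ j) x)‖ₑ ≤ W j := by
    intro j x
    have h2 := (κ j).2
    simp only [Pi.zero_apply, hW, kernOrder]
    rcases Nat.lt_succ_iff_lt_or_eq.1 h2 with h3 | h3
    · have h4 : (κ j : ℕ) ≤ α := by omega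
      rw [discCoef_zero_kern_of_le h4, min_eq_left h4, enorm_ofReal', enorm_mul, hinv]
      refine mul_le_mul' le_rfl ?_
      split_ifs with h5
      · rw [Real.enorm_eq_ofReal_abs]
        refine ENNReal.ofReal_le_ofReal (abs_bernNorm_zero_le_bernConst ?_ h4)
        exact Nat.one_le_iff_ne_zero.2 fun h => h5 (Fin.ext h)
      · rw [not_not.1 h5]
        simp [bernNorm_zero]
    · rw [h3, discCoef_zero_kern_last, min_eq_right (Nat.le_succ α), enorm_ofReal', enorm_mul, hinv]
      refine mul_le_mul' le_rfl ?_
      rw [if_pos fun h => by rw [h] at h3; simp at h3, Real.enorm_eq_ofReal_abs, abs_mul, abs_pow,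
        abs_neg, abs_one, one_pow, one_mul]
      exact ENNReal.ofReal_le_ofReal (abs_bernTilde_le_bernConst α _)
  refine (enorm_gridCoef_le hα hq κ 0 hG hWj).trans ?_
  rw [← derivNorm, mul_div_assoc]
  refine mul_le_mul' le_rfl ?_
  simp only [hW]
  rw [Finset.prod_mul_distrib, mul_comm, ENNReal.div_eq_inv_mul, mul_comm]
  refine mul_le_mul' ?_ (le_of_eq ?_)
  · rw [← ENNReal.prod_inv_distrib fun i _ j _ _ => Or.inl (pow_ne_zero _ hb0), Finset.prod_pow_eq_pow_sum,
      ENNReal.inv_le_inv, ← Finset.mul_sum, mul_comm α n]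
    exact pow_le_pow_right₀ hb1 (Nat.mul_le_mul_left n hκ)
  · rw [Finset.prod_ite, Finset.prod_const, Finset.prod_const_one, mul_one]

theorem gridCoef_zero_eq (κ : Fin s → Fin (α + 2)) (G : (Fin s → ℝ) → ℝ)
    (hκ : ∀ j, (κ j : ℕ) ≤ α) :
    gridCoef b n α κ 0 G = ((((b : ℝ) ^ (n * ∑ j, (κ j : ℕ)))⁻¹ *
      ((∏ j, bernNorm (κ j) 0) * ∫ x in cube (Fin s), G x) : ℝ) : ℂ) := by
  have h1 : ∀ x : Fin s → ℝ, ∏ j, discCoef b n ((0 : Fin s → ℕ) j) (kern α (κ j) (x j)) =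
      ((((b : ℝ) ^ (n * ∑ j, (κ j : ℕ)))⁻¹ * ∏ j, bernNorm (κ j) 0 : ℝ) : ℂ) := by
    intro x
    simp only [Pi.zero_apply, discCoef_zero_kern_of_le (hκ _)]
    rw [← Complex.ofReal_prod, Finset.prod_mul_distrib, Finset.prod_inv_distrib,
      Finset.prod_pow_eq_pow_sum, Finset.mul_sum]
  simp only [gridCoef, h1]
  rw [integral_mul_const, integral_complex_ofReal]
  push_cast
  ring

end bounds

end ExtrapolatedLattice

namespace ExtrapolatedLattice

/-! ### Error of the extrapolated rule -/

section final

variable {b : ℕ} [Fact b.Prime] {s α m : ℕ} {f : (Fin s → ℝ) → ℝ} {q r q' r' : ℝ≥0∞}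
  {γ : Finset (Fin s) → ℝ≥0}

theorem latticeRule_eq_sum {n : ℕ} (hα : 2 ≤ α) (hfc : ContinuousOn f (cube (Fin s)))
    (hf : ∀ β : Fin s → ℕ, (∀ j, β j ≤ α) → ∃ g, IsWeakDeriv β f g) (p : (ZMod b)[X])
    (g : Fin s → (ZMod b)[X]) :
    latticeRule b n p g f = ∑ κ : Fin s → Fin (α + 2),
      latticeRule b n p g (kernIntegral α κ (weakDeriv (kernOrder α κ) f)) := by
  simp only [latticeRule]
  rw [← Finset.mul_sum, Finset.sum_comm]
  congr 1
  exact Finset.sum_congr rfl fun h _ => eq_sum_kernIntegral hα hfc hf (latticePoint_mem_cube p g h)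

/-- The contribution of a choice of kernels to the average of the grid means. -/
theorem enorm_sum_gridCoef_zero_sub_le (hα : 2 ≤ α) (hm : α ≤ m) (hq : 1 ≤ q)
    (hfc : ContinuousOn f (cube (Fin s)))
    (hf : ∀ β : Fin s → ℕ, (∀ j, β j ≤ α) → ∃ g, IsWeakDeriv β f g) (κ : Fin s → Fin (α + 2)) :
    ‖∑ τ ∈ Finset.Icc 1 α, (extraCoeff b α τ : ℂ) *
        gridCoef b (m - τ + 1) α κ 0 (weakDeriv (kernOrder α κ) f) -
        (if κ = 0 then (cubeIntegral f : ℂ) else 0)‖ₑ ≤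
      ∑ τ ∈ Finset.Icc 1 α, ENNReal.ofReal |extraCoeff b α τ| * (derivNorm q f κ *
        ENNReal.ofReal (bernConst α) ^ (Finset.univ.filter fun j => κ j ≠ 0).card /
          (b : ℝ≥0∞) ^ (α * (m - τ + 1))) := by
  have hκ := isWeakDeriv_weakDeriv (hf (kernOrder α κ) fun j => min_le_right _ _)
  rcases le_or_gt α (∑ j, kernOrder α κ j) with h | h
  · have h0 : κ ≠ 0 := by
      rintro rfl
      simp [kernOrder] at h
      omega
    rw [if_neg h0, sub_zero]
    refine (enorm_sum_le _ _).trans (Finset.sum_le_sum fun τ _ => ?_)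
    rw [enorm_mul, enorm_ofReal', Real.enorm_eq_ofReal_abs]
    exact mul_le_mul' le_rfl (enorm_gridCoef_zero_le hα hq κ hκ.1 h)
  -- For total order below `α` no coordinate uses the last kernel. The grid mean is then an exact
  -- multiple of `b^{-n|κ|}`, removed by the extrapolation unless `κ = 0`, when it is `I(f)`.
  · have h1 : ∀ j, kernOrder α κ j < α := fun j =>
      (Finset.single_le_sum (fun _ _ => Nat.zero_le _) (Finset.mem_univ j)).trans_lt h
    have h2 : ∀ j, (κ j : ℕ) ≤ α := fun j => by
      have := h1 j
      rw [kernOrder] at this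
      omega
    have h3 : ∑ j, (κ j : ℕ) < α := by
      refine lt_of_eq_of_lt (Finset.sum_congr rfl fun j _ => ?_) h
      rw [kernOrder, min_eq_left (h2 j)]
    have h4 := sum_extraCoeff_mul_inv_pow (Fact.out : b.Prime).one_lt hm h3
    have h5 : ∑ τ ∈ Finset.Icc 1 α, (extraCoeff b α τ : ℂ) *
        gridCoef b (m - τ + 1) α κ 0 (weakDeriv (kernOrder α κ) f) =
        (if κ = 0 then (cubeIntegral f : ℂ) else 0) := by
      have h7 : ∀ τ ∈ Finset.Icc 1 α, (extraCoeff b α τ : ℂ) *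
          gridCoef b (m - τ + 1) α κ 0 (weakDeriv (kernOrder α κ) f) =
          ((extraCoeff b α τ * ((b : ℝ) ^ ((m - τ + 1) * ∑ j, (κ j : ℕ)))⁻¹ *
            ((∏ j, bernNorm (κ j) 0) *
              ∫ x in cube (Fin s), weakDeriv (kernOrder α κ) f x) : ℝ) : ℂ) := by
        intro τ _
        rw [gridCoef_zero_eq κ _ h2, ← Complex.ofReal_mul, mul_assoc]
      rw [Finset.sum_congr rfl h7, ← Complex.ofReal_sum]
      rw [← Finset.sum_mul, h4]
      have h6 : ∑ j, (κ j : ℕ) = 0 ↔ κ = 0 := by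
        rw [Finset.sum_eq_zero_iff]
        exact ⟨fun h => funext fun j => Fin.ext (h j (Finset.mem_univ j)), fun h j _ => by rw [h]; rfl⟩
      by_cases h0 : κ = 0
      · rw [if_pos (h6.2 h0), if_pos h0, one_mul, cubeIntegral_eq hα hfc hf]
        subst h0
        have e : kernOrder α (0 : Fin s → Fin (α + 2)) = fun _ => 0 := by
          ext j; simp [kernOrder]
        rw [e]
        simp [bernNorm_zero]
      · rw [if_neg fun hc => h0 (h6.1 hc), if_neg h0, zero_mul, Complex.ofReal_zero]
    rw [h5, sub_self, enorm_zero]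
    exact zero_le

open scoped Classical in
theorem enorm_latticeRule_sub_le {n : ℕ} (hα : 2 ≤ α) (hq : 1 ≤ q) (hn : 0 < n)
    (hf : ∀ β : Fin s → ℕ, (∀ j, β j ≤ α) → ∃ g, IsWeakDeriv β f g) {p : (ZMod b)[X]}
    (hp : p.natDegree = n) (g : Fin s → (ZMod b)[X]) (κ : Fin s → Fin (α + 2)) :
    ‖(latticeRule b n p g (kernIntegral α κ (weakDeriv (kernOrder α κ) f)) : ℂ) -
        gridCoef b n α κ 0 (weakDeriv (kernOrder α κ) f)‖ₑ ≤
      derivNorm q f κ * ∑ k ∈ Fintype.piFinset fun _ : Fin s => Finset.range (b ^ n),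
        (if k ≠ 0 ∧ k ∈ dualLattice b n p g then
          ∏ j, ∑' l, kernWeight b α (κ j) (k j + b ^ n * l) else 0) := by
  have hκ := isWeakDeriv_weakDeriv (hf (kernOrder α κ) fun j => min_le_right _ _)
  refine (enorm_latticeRule_kernIntegral_sub_le hα hn hp g κ hκ.1).trans ?_
  rw [Finset.mul_sum]
  refine Finset.sum_le_sum fun k hk => ?_
  split_ifs
  · exact enorm_gridCoef_le hα hq κ k hκ.1 fun j x => enorm_discCoef_kern_le_tsum hα (κ j)
      (by simpa using (Fintype.mem_piFinset.1 hk) j) x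
  · exact zero_le

open scoped Classical in
theorem ofReal_abs_extrapolatedRule_sub_le (hα : 2 ≤ α) (hm : α ≤ m) (hq : 1 ≤ q) (hr : 1 ≤ r)
    (hq' : q.HolderConjugate q') (hr' : r.HolderConjugate r') {p : ℕ → (ZMod b)[X]}
    (g : ℕ → Fin s → (ZMod b)[X]) (hp : ∀ τ ∈ Finset.Icc 1 α, (p τ).natDegree = m - τ + 1)
    (hf : MemSobolev α γ q r f) (h1 : sobolevNorm α γ q r f ≤ 1) :
    ENNReal.ofReal |extrapolatedRule b α m p g f - cubeIntegral f| ≤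
      ∑ τ ∈ Finset.Icc 1 α, ENNReal.ofReal |extraCoeff b α τ| *
        (boundB b α γ r' (m - τ + 1) (p τ) (g τ) +
          boundH α γ q' r' / (b : ℝ≥0∞) ^ (α * (m - τ + 1))) := by
  obtain ⟨hfc, hw, -⟩ := hf
  set G : (Fin s → Fin (α + 2)) → (Fin s → ℝ) → ℝ := fun κ => weakDeriv (kernOrder α κ) f with hG
  set Lκ : ℕ → (Fin s → Fin (α + 2)) → ℝ := fun τ κ =>
    latticeRule b (m - τ + 1) (p τ) (g τ) (kernIntegral α κ (G κ)) with hL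
  set dual : ℕ → (Fin s → Fin (α + 2)) → ℝ≥0∞ := fun τ κ =>
    ∑ k ∈ Fintype.piFinset fun _ : Fin s => Finset.range (b ^ (m - τ + 1)),
      (if k ≠ 0 ∧ k ∈ dualLattice b (m - τ + 1) (p τ) (g τ) then
        ∏ j, ∑' l, kernWeight b α (κ j) (k j + b ^ (m - τ + 1) * l) else 0) with hdual
  set grid : (Fin s → Fin (α + 2)) → ℝ≥0∞ := fun κ =>
    ENNReal.ofReal (bernConst α) ^ (Finset.univ.filter fun j => κ j ≠ 0).card with hgrid
  -- For each `κ`, compare the lattice rule with the grid mean, then the extrapolated grid mean with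
  -- the integral; the integral is charged to `κ = 0` alone.
  have hdecomp : ((extrapolatedRule b α m p g f - cubeIntegral f : ℝ) : ℂ) =
      ∑ κ, (∑ τ ∈ Finset.Icc 1 α, (extraCoeff b α τ : ℂ) *
          ((Lκ τ κ : ℂ) - gridCoef b (m - τ + 1) α κ 0 (G κ)) +
        (∑ τ ∈ Finset.Icc 1 α, (extraCoeff b α τ : ℂ) * gridCoef b (m - τ + 1) α κ 0 (G κ) -
          (if κ = 0 then (cubeIntegral f : ℂ) else 0))) := by
    have e1 : ∀ κ, (∑ τ ∈ Finset.Icc 1 α, (extraCoeff b α τ : ℂ) *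
          ((Lκ τ κ : ℂ) - gridCoef b (m - τ + 1) α κ 0 (G κ)) +
        (∑ τ ∈ Finset.Icc 1 α, (extraCoeff b α τ : ℂ) * gridCoef b (m - τ + 1) α κ 0 (G κ) -
          (if κ = 0 then (cubeIntegral f : ℂ) else 0))) =
        ∑ τ ∈ Finset.Icc 1 α, (extraCoeff b α τ : ℂ) * (Lκ τ κ : ℂ) -
          (if κ = 0 then (cubeIntegral f : ℂ) else 0) := by
      intro κ
      simp only [mul_sub, Finset.sum_sub_distrib]
      ring
    simp only [e1]
    rw [Finset.sum_sub_distrib, Finset.sum_ite_eq' Finset.univ (0 : Fin s → Fin (α + 2)),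
      if_pos (Finset.mem_univ _), Finset.sum_comm, extrapolatedRule, Complex.ofReal_sub,
      Complex.ofReal_sum]
    congr 1
    refine Finset.sum_congr rfl fun τ _ => ?_
    rw [latticeRule_eq_sum hα hfc hw, Complex.ofReal_mul, Complex.ofReal_sum, Finset.mul_sum]
  have hterm : ∀ κ, ‖∑ τ ∈ Finset.Icc 1 α, (extraCoeff b α τ : ℂ) *
          ((Lκ τ κ : ℂ) - gridCoef b (m - τ + 1) α κ 0 (G κ)) +
        (∑ τ ∈ Finset.Icc 1 α, (extraCoeff b α τ : ℂ) * gridCoef b (m - τ + 1) α κ 0 (G κ) -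
          (if κ = 0 then (cubeIntegral f : ℂ) else 0))‖ₑ ≤
      ∑ τ ∈ Finset.Icc 1 α, ENNReal.ofReal |extraCoeff b α τ| *
        (derivNorm q f κ * dual τ κ + derivNorm q f κ * grid κ / (b : ℝ≥0∞) ^ (α * (m - τ + 1))) := by
    intro κ
    refine (enorm_add_le _ _).trans ?_
    rw [Finset.sum_congr rfl fun τ _ => mul_add _ _ _, Finset.sum_add_distrib]
    refine add_le_add ?_ (enorm_sum_gridCoef_zero_sub_le hα hm hq hfc hw κ)
    refine (enorm_sum_le _ _).trans (Finset.sum_le_sum fun τ hτ => ?_)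
    rw [enorm_mul, enorm_ofReal', Real.enorm_eq_ofReal_abs]
    exact mul_le_mul' le_rfl
      (enorm_latticeRule_sub_le hα hq (Nat.succ_pos _) hw (hp τ hτ) (g τ) κ)
  rw [← Real.enorm_eq_ofReal_abs, ← enorm_ofReal', hdecomp]
  refine (enorm_sum_le _ _).trans ((Finset.sum_le_sum fun κ _ => hterm κ).trans ?_)
  rw [Finset.sum_comm]
  refine Finset.sum_le_sum fun τ _ => ?_
  rw [← Finset.mul_sum, Finset.sum_add_distrib]
  refine mul_le_mul' le_rfl (add_le_add (sum_derivNorm_mul_dual_le hα hq hr hr' h1 (p τ) (g τ)) ?_)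
  simp only [ENNReal.div_eq_inv_mul]
  rw [← Finset.mul_sum]
  exact mul_le_mul' le_rfl (sum_derivNorm_mul_bernConst_le hr hq' hr' h1)

end final

end ExtrapolatedLattice
theorem mainTheorem3 (b : ℕ) [Fact b.Prime] (s α m : ℕ) (hs : 1 ≤ s) (hα : 2 ≤ α) (hm : α ≤ m)
    (q r q' r' : ℝ≥0∞) (hq : 1 ≤ q) (hr : 1 ≤ r)
    (hq' : q.HolderConjugate q') (hr' : r.HolderConjugate r')
    (γ : Finset (Fin s) → ℝ≥0)
    (p : ℕ → (ZMod b)[X]) (g : ℕ → Fin s → (ZMod b)[X])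
    (hp : ∀ τ ∈ Finset.Icc 1 α, (p τ).natDegree = m - τ + 1)
    (hg : ∀ τ ∈ Finset.Icc 1 α, ∀ j, g τ j ≠ 0 ∧ (g τ j).natDegree < m - τ + 1) :
    worstCaseError α γ q r (extrapolatedRule b α m p g) ≤
      ∑ τ ∈ Finset.Icc 1 α, ENNReal.ofReal |extraCoeff b α τ| *
        (boundB b α γ r' (m - τ + 1) (p τ) (g τ) +
          boundH α γ q' r' / (b : ℝ≥0∞) ^ (α * (m - τ + 1))) := by
  refine iSup_le fun f => iSup_le fun hf => iSup_le fun h1 => ?_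
  exact ofReal_abs_extrapolatedRule_sub_le hα hm hq hr hq' hr' g hp hf h1
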